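/- Let $U_n$ be the Chebyshev polynomials of the second kind, $U_n(\cos\theta)=\sin((n+1)\theta)/\sin\theta$. Let $\{\mu_N\}$ be a sequence of probability measures on $\mathbb{R}$ with all moments finite, let $s_N>0$ with $s_N\to+\infty$, and put $$\widehat{\mu_N}(n)=\int U_n(\alpha)\,d\mu_N(\alpha),\qquad \sigma_{R,N}(\lambda)=s_N^3\Big(1-\mu_N\big(-\infty,\,1-\tfrac{\lambda}{2s_N^{2}}\big]\Big),\qquad \sigma_{L,N}(\lambda)=s_N^3\,\mu_N\big(-\infty,\,-1+\tfrac{\lambda}{2s_N^{2}}\big]\qquad(\lambda\in\mathbb{R}).$$ Let $0<\delta<1$ and let $\phi_R,\phi_L:(0,\infty)\to\mathbb{R}$ be continuous functions in $L_1\big((0,\infty),e^{-x^{2-\delta}}dx\big)$. Define $\varepsilon_N(n)$ by $$\widehat{\mu_N}(n)=\frac{n}{s_N^3}\Big[\phi_R(n/s_N)+(-1)^n\phi_L(n/s_N)\Big]+\frac{\varepsilon_N(n)}{s_N^2}\qquad(n\ge 1),$$ and assume that, for some constant $C$: 1. $\sum_{1\le n\le s_N}\frac{|\varepsilon_N(n)|}{n}\le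 C$ for all $N$; 2. for every $R\in\mathbb{N}$, $\max_{1\le n\le Rs_N}|\varepsilon_N(n)|\to0$ as $N\to\infty$; 3. $\frac1{s_N}\sum_{1\le n\le s_N}\big|\phi_R(n/s_N)+(-1)^n\phi_L(n/s_N)\big|\le C$ for all $N$ (this is automatic if near $0$ the functions $|\phi_R|,|\phi_L|$ are dominated by a nonincreasing integrable function). Then there are (positive Borel) measures $\sigma_R,\sigma_L$ on $\mathbb{R}$, finite on every half-line $(-\infty,\lambda]$, such that, writing $\sigma(\lambda)=\sigma((-\infty,\lambda])$, $\sigma_{R,N}(\lambda)\to\sigma_R(\lambda)$ at every $\lambda$ with $\sigma_R(\{\lambda\})=0$, and $\sigma_{L,N}(\lambda)\to\sigma_L(\lambda)$ at every $\lambda$ with $\sigma_L(\{\lambda\})=0$. The measure $\sigma_R$ is uniquely determined by $\phi_R$ and $\sigma_L$ by $\phi_L$: there is a single map $S$ from functions on $(0,\infty)$ to measures such that $\sigma_R=S(\phi_R)$ and $\sigma_L=S(\phi_L)$ for all $\{\mu_N\},\{s_N\},\phi_R,\phi_L,\delta$ as above. Both $\sigma=\sigma_R$ and $\sigma=\sigma_L$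 satisfy $$\Big|\sigma(\lambda)-\frac{2}{3\pi}\lambda^{3/2}\Big|=O(\lambda)\quad(\lambda\to+\infty),\qquad \sigma(\lambda)=O\Big[\exp\Big\{-C'|\lambda|^{\frac{1-\delta/2}{1-\delta}}\Big\}\Big]\quad(\lambda\to-\infty)$$ for some $C'>0$. -/

import Mathlib

open MeasureTheory Filter Topology Asymptotics

noncomputable section

/-- The `n`-th Chebyshev coefficient `∫ U_n(α) dμ(α)`, where `U_n` is the Chebyshev polynomial of
the second kind, `U_n(cos θ) = sin((n+1)θ)/sin θ`. -/
def chebCoeff (μ : Measure ℝ) (n : ℕ) : ℝ :=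
  ∫ α, (Polynomial.Chebyshev.U ℝ (n : ℤ)).eval α ∂μ

/-- Distribution function of the measure rescaled at the right edge:
`t ↦ s³ (1 - μ(-∞, 1 - t/(2s²)])`. -/
def edgeRight (μ : Measure ℝ) (s : ℝ) (t : ℝ) : ℝ :=
  s ^ 3 * (1 - μ.real (Set.Iic (1 - t / (2 * s ^ 2))))

/-- Distribution function of the measure rescaled at the left edge:
`t ↦ s³ μ(-∞, -1 + t/(2s²)]`. -/
def edgeLeft (μ : Measure ℝ) (s : ℝ) (t : ℝ) : ℝ :=
  s ^ 3 * μ.real (Set.Iic (-1 + t / (2 * s ^ 2)))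

/-- `φ ∈ C(0,∞) ∩ L₁((0,∞), exp(-x^(2-δ)) dx)`. Values of `φ` outside `(0,∞)` play no role. -/
structure EdgeProfile (δ : ℝ) (φ : ℝ → ℝ) : Prop where
  continuousOn : ContinuousOn φ (Set.Ioi 0)
  integrableOn : IntegrableOn (fun x => φ x * Real.exp (-x ^ (2 - δ))) (Set.Ioi 0)

/-- The hypotheses on the measures `μ N`, the scales `s N`, the profiles `φR`, `φL` and the
error terms `ε N n`. -/
structure EdgeAsymptotics (μ : ℕ → Measure ℝ) (s : ℕ → ℝ) (φR φL : ℝ → ℝ)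
    (ε : ℕ → ℕ → ℝ) : Prop where
  /-- each `μ N` is a probability measure -/
  prob : ∀ N, IsProbabilityMeasure (μ N)
  /-- all Chebyshev coefficients exist -/
  integrable : ∀ N n : ℕ,
    Integrable (fun α => (Polynomial.Chebyshev.U ℝ (n : ℤ)).eval α) (μ N)
  scale_pos : ∀ N, 0 < s N
  scale_tendsto : Tendsto s atTop atTop
  /-- the form of the coefficients, which defines `ε` -/
  coeff : ∀ N n : ℕ, 1 ≤ n → chebCoeff (μ N) n =
    n / s N ^ 3 * (φR (n / s N) + (-1) ^ n * φL (n / s N)) + ε N n / s N ^ 2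
  /-- `∑_{1 ≤ n ≤ s_N} |ε_N(n)| / n ≤ C` -/
  error_sum : ∃ C : ℝ, ∀ N, ∑ n ∈ Finset.Icc 1 ⌊s N⌋₊, |ε N n| / n ≤ C
  /-- for every `R`, `ε_N(n) → 0` uniformly in `1 ≤ n ≤ R s_N` -/
  error_small : ∀ R : ℕ, ∀ η : ℝ, 0 < η → ∀ᶠ N in atTop,
    ∀ n : ℕ, 1 ≤ n → (n : ℝ) ≤ R * s N → |ε N n| ≤ η
  /-- the Riemann sums of the leading term over `(0,1]` stay bounded; automatic when the profiles
  are dominated near `0` by a nonincreasing integrable function -/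
  riemann_sum : ∃ C : ℝ, ∀ N,
    ∑ n ∈ Finset.Icc 1 ⌊s N⌋₊, |φR (n / s N) + (-1) ^ n * φL (n / s N)| / s N ≤ C

/-- The measures with distribution functions `F N` converge to the measure `σ`, which is finite on
half-lines `(-∞, t]`: the distribution functions converge at every continuity point of
`t ↦ σ(-∞, t]`. No mass is lost at `-∞`. -/
def EdgeTendsto (F : ℕ → ℝ → ℝ) (σ : Measure ℝ) : Prop :=
  (∀ t, σ (Set.Iic t) < ⊤) ∧
    ∀ t, σ {t} = 0 → Tendsto (fun N => F N t) atTop (𝓝 (σ.real (Set.Iic t)))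

/-- Growth `σ(-∞, t] = (2/(3π)) t^(3/2) + O(t)` as `t → +∞`, and decay
`σ(-∞, t] = O(exp(-C' |t|^((1-δ/2)/(1-δ))))` as `t → -∞` for some `C' > 0`. -/
def EdgeTails (δ : ℝ) (σ : Measure ℝ) : Prop :=
  (fun t : ℝ => σ.real (Set.Iic t) - 2 / (3 * Real.pi) * t ^ (3 / 2 : ℝ)) =O[atTop]
      (fun t : ℝ => t) ∧
    ∃ C' : ℝ, 0 < C' ∧ (fun t : ℝ => σ.real (Set.Iic t)) =O[atBot]
      (fun t : ℝ => Real.exp (-C' * |t| ^ ((1 - δ / 2) / (1 - δ))))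

end

/-! Blow up `μ N` at the right edge by `t = 2 s² (1 - α)` with total mass `s³`; this is
`edgeMeasure`. At `α = 1 - t/(2s²)` the polynomial `U_{n-1}(α)/s` tends to `sin(x√t)/√t` when `n/s →
x` (`tendsto_chebU_div`). So for an odd test function `a` the polynomial `s⁻² ∑ a(n/s) U_{n-1}`
tends locally uniformly to the sine-type transform `edgeTransform a`, while its integral is a sum of
the given coefficients. In that sum `U_0` contributes `s a(1/s) → a'(0)`, the terms with `φR` form a
Riemann sum for `∫ a(x) x φR(x) dx`, the terms with `(-1)^n φL` cancel in consecutive pairs, and the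
errors vanish (`tendsto_functional`). Any limit `ν` must therefore satisfy `∫ edgeTransform a dν =
a'(0) + ∫ a(x) x φR(x) dx`.

Passing to the limit needs compactness and tightness. Both come from the square of the Fejér-type
kernel `∑ (M - n) U_{n-1}` with `M` about `2 X s`. Products of the `U_n` are sums of `U_n`, so the
integral of the square is bounded by `∑ n |∫ U_n dμ|`, which the hypotheses control by
`exp((12X+1)^(2-δ))` up to powers of `X` (`exists_fejer_le`). The kernel is bounded below near the
edge, decays no faster than `1/t` to the right, and grows like `sinh` to the left. This bounds the
mass of half-lines, the integral of `1/t²` on the right and of functions with exponential growth on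
the left; the opposite edge is handled by `α ↦ -α`. Riesz representation then gives a vague limit
along every ultrafilter, for which the identity above holds (`integral_edgeTransform`).

Uniqueness: by domination the identity extends from compactly supported tests to Gaussian ones. The
test `-(exp(-b x²))'` has transform proportional to `exp(-t/(4b))`, so the identity prescribes the
Laplace transform of `ν` in terms of `φR`, and hence `ν`. All ultrafilter limits agree, so the whole
sequence converges; ramps squeeze the distribution functions at continuity points. The left edge is
the right edge of the reflected measures.

Tails: on the left, Markov's inequality with the kernel gives `exp((12X+1)^(2-δ))/sinh(kX)²` up to
powers for the mass below `-k²`, and `X` of order `k^(1/(1-δ))` is the right choice. On the right,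
the test `-(exp(-x²/2) cos(ux))'` has transform a bump in `√t` around `u`, with integral `u² +
O(1+u)`. Integrating over `0 < u ≤ K` gives `(π/2) ν[0,K²] = K³/3 + O(1+K²)`. -/

/-! ### Chebyshev polynomials of the second kind: identities and bounds -/

/-- The Chebyshev polynomials of the second kind with index shifted by one:
`chebU n (cos θ) = sin (n θ) / sin θ`. -/
def chebU : ℕ → ℝ → ℝ
  | 0, _ => 0
  | 1, _ => 1
  | n + 2, α => 2 * α * chebU (n + 1) α - chebU n α

@[simp] lemma chebU_zero (α : ℝ) : chebU 0 α = 0 := by simp [chebU]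

@[simp] lemma chebU_one (α : ℝ) : chebU 1 α = 1 := by simp [chebU]

lemma chebU_add_two (n : ℕ) (α : ℝ) :
    chebU (n + 2) α = 2 * α * chebU (n + 1) α - chebU n α := by simp [chebU]

lemma chebU_succ_eq_eval (n : ℕ) (α : ℝ) :
    chebU (n + 1) α = (Polynomial.Chebyshev.U ℝ (n : ℤ)).eval α := by
  induction n using Nat.twoStepInduction with
  | zero => simp
  | one => simp [chebU]
  | more n h1 h2 =>
    rw [chebU_add_two, h2, h1]
    push_cast
    rw [Polynomial.Chebyshev.U_add_two]
    simp

@[fun_prop] lemma continuous_chebU (n : ℕ) : Continuous (chebU n) := by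
  cases n with
  | zero => simpa [funext chebU_zero] using continuous_const
  | succ n => simpa only [funext (chebU_succ_eq_eval n)] using Polynomial.continuous _

lemma sin_mul_chebU_cos (n : ℕ) (θ : ℝ) :
    chebU n (Real.cos θ) * Real.sin θ = Real.sin (n * θ) := by
  cases n with
  | zero => simp
  | succ n =>
    rw [chebU_succ_eq_eval, Polynomial.Chebyshev.U_real_cos]
    push_cast
    rfl

/-- Each step `U_n = α U_{n-1} + T_n` adds at most `|T_n| ≤ 1`. -/
lemma abs_chebU_le {α : ℝ} (h : |α| ≤ 1) (n : ℕ) : |chebU n α| ≤ n := by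
  induction n with
  | zero => simp
  | succ n ih =>
    have key : chebU (n + 1) α = α * chebU n α + (Polynomial.Chebyshev.T ℝ (n : ℤ)).eval α := by
      cases n with
      | zero => simp
      | succ m =>
        rw [chebU_succ_eq_eval, chebU_succ_eq_eval]
        push_cast
        rw [Polynomial.Chebyshev.U_eq_X_mul_U_add_T]
        simp
    rw [key]
    have hT := Polynomial.Chebyshev.abs_eval_T_real_le_one (n : ℤ) h
    calc _ ≤ |α * chebU n α| + |(Polynomial.Chebyshev.T ℝ (n : ℤ)).eval α| := abs_add_le _ _
      _ ≤ 1 * |chebU n α| + 1 := by rw [abs_mul]; gcongr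
      _ ≤ _ := by push_cast; linarith

lemma chebU_neg (n : ℕ) (α : ℝ) : chebU n (-α) = (-1) ^ (n + 1) * chebU n α := by
  induction n using Nat.twoStepInduction with
  | zero => simp
  | one => simp
  | more n h1 h2 => rw [chebU_add_two, chebU_add_two, h1, h2]; ring

/-- By the recurrence the difference of the two products does not change when one unit moves from
`p` to `q`, so it can be read off at `p = 0`. Iteration linearises products. -/
lemma chebU_succ_mul_succ (p q : ℕ) (α : ℝ) :
    chebU (p + 1) α * chebU (q + 1) α = chebU p α * chebU q α + chebU (p + q + 1) α := by
  induction p generalizing q with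
  | zero => simp
  | succ p ih =>
    have h1 := ih (q + 1)
    have h2 := ih q
    have e : p + (q + 1) + 1 = p + 1 + q + 1 := by ring
    rw [e] at h1
    rw [chebU_add_two q] at h1
    rw [chebU_add_two p]
    linear_combination h1

lemma two_sub_mul_chebU (n : ℕ) (α : ℝ) :
    (2 - 2 * α) * chebU (n + 1) α = 2 * chebU (n + 1) α - chebU (n + 2) α - chebU n α := by
  rw [chebU_add_two]; ring

/-- Taylor expansion at the edge. It permits a termwise scaling limit, and for `y ≤ 0` all its terms
are nonnegative. The binomials vanish for `j ≥ n`, so the length `m` is free above `n`; the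
induction needs one length for three consecutive indices. -/
lemma chebU_one_sub_half (n m : ℕ) (h : n ≤ m) (y : ℝ) :
    chebU n (1 - y / 2) = ∑ j ∈ Finset.range m, (-y) ^ j * ((n + j).choose (2 * j + 1) : ℝ) := by
  induction n using Nat.twoStepInduction generalizing m with
  | zero =>
    rw [chebU_zero, Finset.sum_eq_zero]
    intro j _
    rw [Nat.choose_eq_zero_of_lt (by omega)]; simp
  | one =>
    obtain ⟨m, rfl⟩ := Nat.exists_eq_add_of_le' h
    rw [chebU_one, Finset.sum_range_succ', Finset.sum_eq_zero]
    · simp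
    · intro j _
      rw [Nat.choose_eq_zero_of_lt (by omega)]; simp
  | more n h1 h2 =>
    obtain ⟨m, rfl⟩ := Nat.exists_eq_add_of_le' (le_trans (by omega : 1 ≤ n + 2) h)
    rw [chebU_add_two, h2 (m + 1) (by omega), h1 (m + 1) (by omega)]
    have e : ∀ A B : ℝ, 2 * (1 - y / 2) * A - B = (2 * A - B) - y * A := by intros; ring
    rw [e, Finset.mul_sum, ← Finset.sum_sub_distrib, sub_eq_iff_eq_add]
    rw [Finset.sum_range_succ', Finset.sum_range_succ', Finset.sum_range_succ _ m]
    rw [Nat.choose_eq_zero_of_lt (by omega : n + 1 + m < 2 * m + 1)]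
    simp only [mul_add, Finset.mul_sum, Nat.cast_zero, mul_zero, add_zero]
    rw [add_right_comm, ← Finset.sum_add_distrib]
    congr 1
    · apply Finset.sum_congr rfl
      intro j _
      -- Pascal's rule three times: the second difference in the upper index lowers the lower index
      -- by two.
      have c : ((n + 2 + (j + 1)).choose (2 * (j + 1) + 1) : ℝ) + (n + (j + 1)).choose (2 * (j + 1) + 1)
          = 2 * (n + 1 + (j + 1)).choose (2 * (j + 1) + 1) + (n + 1 + j).choose (2 * j + 1) := by
        have a1 : n + 2 + (j + 1) = (n + j + 2) + 1 := by ring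
        have a2 : n + 1 + (j + 1) = (n + j + 1) + 1 := by ring
        have a3 : n + (j + 1) = n + j + 1 := by ring
        have a4 : n + 1 + j = n + j + 1 := by ring
        have a5 : 2 * (j + 1) + 1 = (2 * j + 1 + 1) + 1 := by ring
        rw [a1, a2, a3, a4, a5, Nat.choose_succ_succ (n + j + 2),
          Nat.choose_succ_succ (n + j + 1) (2 * j + 1 + 1),
          show n + j + 2 = (n + j + 1) + 1 by ring, Nat.choose_succ_succ (n + j + 1) (2 * j + 1)]
        push_cast; ring
      linear_combination (-(-y) ^ (j + 1)) * c
    · simp; ring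

/-- For `α ≥ 1` the increments do not decrease, since consecutive ones differ by `(2α - 2) chebU (n
+ 1) α`; positivity and the increment bound have to be carried together. -/
lemma chebU_diff {α : ℝ} (h : 1 ≤ α) (n : ℕ) :
    0 ≤ chebU n α ∧ 1 ≤ chebU (n + 1) α - chebU n α := by
  induction n with
  | zero => simp
  | succ n ih =>
    obtain ⟨h0, h1⟩ := ih
    refine ⟨by linarith, ?_⟩
    rw [chebU_add_two]
    nlinarith

lemma chebU_nonneg {α : ℝ} (h : 1 ≤ α) (n : ℕ) : 0 ≤ chebU n α := (chebU_diff h n).1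

lemma chebU_mono {α : ℝ} (h : 1 ≤ α) : Monotone (fun n => chebU n α) :=
  monotone_nat_of_le_succ fun n => by linarith [(chebU_diff h n).2]

lemma le_chebU {α : ℝ} (h : 1 ≤ α) (n : ℕ) : (n : ℝ) ≤ chebU n α := by
  induction n with
  | zero => simp
  | succ n ih => push_cast; linarith [(chebU_diff h n).2]

lemma chebU_mono_arg {α β : ℝ} (h : 1 ≤ α) (hαβ : α ≤ β) (n : ℕ) :
    chebU n α ≤ chebU n β := by
  have e : ∀ γ : ℝ, γ = 1 - (2 - 2 * γ) / 2 := by intro γ; ring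
  rw [e α, e β, chebU_one_sub_half n n le_rfl, chebU_one_sub_half n n le_rfl]
  gcongr with j _
  · linarith

/-- Keeps the first two terms of the positive expansion. The linear term in `y` is what makes the
normalised polynomial large far to the left of the edge. -/
lemma chebU_lower {y : ℝ} (hy : 0 ≤ y) (n : ℕ) :
    (n : ℝ) + y * ((n + 1).choose 3 : ℝ) ≤ chebU n (1 + y / 2) := by
  have e : 1 + y / 2 = 1 - (-y) / 2 := by ring
  rw [e, chebU_one_sub_half n (n + 2) (by omega), Finset.sum_range_succ', Finset.sum_range_succ']
  have : 0 ≤ ∑ k ∈ Finset.range n,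
      (- -y) ^ (k + 1 + 1) * ((n + (k + 1 + 1)).choose (2 * (k + 1 + 1) + 1) : ℝ) :=
    Finset.sum_nonneg fun k _ => by rw [neg_neg]; positivity
  simp only [neg_neg] at this ⊢
  norm_num
  linarith

lemma abs_chebU_of_le_neg_one {α : ℝ} (n : ℕ) : |chebU n α| = |chebU n (-α)| := by
  rw [chebU_neg, abs_mul, abs_pow]; simp

/-! ### Fejér-type kernel: closed form and lower bounds -/

/-- The Fejér-type kernel `∑_{n < M} (M - n) U_{n-1}`. -/
def fejer (M : ℕ) (α : ℝ) : ℝ := ∑ n ∈ Finset.range M, ((M : ℝ) - n) * chebU n α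

lemma two_sub_mul_sum_chebU (M : ℕ) (α : ℝ) :
    (2 - 2 * α) * ∑ n ∈ Finset.range (M + 1), chebU n α = 1 + chebU M α - chebU (M + 1) α := by
  induction M with
  | zero => simp
  | succ M ih => rw [Finset.sum_range_succ, mul_add, ih, two_sub_mul_chebU]; ring

/-- Multiplication by `2 - 2α` acts as minus the second difference in the index, and the kernel is a
double partial sum, so everything telescopes. Since `|chebU M| ≤ M` on `[-1, 1]`, positivity there
is visible. -/
lemma two_sub_mul_fejer (M : ℕ) (α : ℝ) : (2 - 2 * α) * fejer M α = M - chebU M α := by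
  induction M with
  | zero => simp [fejer]
  | succ M ih =>
    have : fejer (M + 1) α = fejer M α + ∑ n ∈ Finset.range (M + 1), chebU n α := by
      simp only [fejer]
      rw [Finset.sum_range_succ, Finset.sum_range_succ, ← add_assoc, ← Finset.sum_add_distrib]
      congr 1
      · apply Finset.sum_congr rfl; intros; push_cast; ring
      · push_cast; ring
    rw [this, mul_add, ih, two_sub_mul_sum_chebU]; push_cast; ring

/-- Drop the indices below `h`; on the others the polynomial is at least `chebU h`, and their
weights `h, h - 1, …, 1` add up to at least `h²/2`. -/
lemma fejer_lower_of_one_le {α : ℝ} (hα : 1 ≤ α) (h : ℕ) :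
    (h : ℝ) ^ 2 / 2 * chebU h α ≤ fejer (2 * h) α := by
  have h1 : ∑ n ∈ Finset.range h, (((2 * h : ℕ) : ℝ) - (h + n : ℕ)) * chebU h α ≤ fejer (2 * h) α := by
    unfold fejer
    rw [two_mul, Finset.sum_range_add]
    have : 0 ≤ ∑ x ∈ Finset.range h, (((h + h : ℕ) : ℝ) - x) * chebU x α := by
      apply Finset.sum_nonneg
      intro n hn
      have := Finset.mem_range.1 hn
      have h2 : (n : ℝ) ≤ (h + h : ℕ) := by exact_mod_cast (by omega)
      exact mul_nonneg (by linarith) (chebU_nonneg hα n)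
    have h3 : ∑ n ∈ Finset.range h, (((h + h : ℕ) : ℝ) - (h + n : ℕ)) * chebU h α
        ≤ ∑ n ∈ Finset.range h, (((h + h : ℕ) : ℝ) - (h + n : ℕ)) * chebU (h + n) α := by
      apply Finset.sum_le_sum
      intro n hn
      have := Finset.mem_range.1 hn
      have h2 : ((h + n : ℕ) : ℝ) ≤ (h + h : ℕ) := by exact_mod_cast (by omega)
      exact mul_le_mul_of_nonneg_left (chebU_mono hα (by omega)) (by linarith)
    linarith
  refine le_trans ?_ h1
  rw [← Finset.sum_mul]
  apply mul_le_mul_of_nonneg_right _ (chebU_nonneg hα h)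
  have h4 : ∀ k : ℕ, (k : ℝ) * (2 * h - k) / 2 ≤ ∑ n ∈ Finset.range k, (((2 * h : ℕ) : ℝ) - (h + n : ℕ)) := by
    intro k
    induction k with
    | zero => simp
    | succ k ih => rw [Finset.sum_range_succ]; push_cast at ih ⊢; nlinarith
  refine le_trans (le_of_eq ?_) (h4 h)
  ring

/-- With `α = cos θ` the double angle formula reads `chebU (2h) = 2 chebU h cos(hθ)`. If `hθ ≤ π/2`,
the loss comes from `cos x ≤ 1 - 2x²/π²` with `2/π² ≥ 1/5`. If `hθ > π/2`, Jordan's inequality gives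
`h sin θ ≥ 1`, so `chebU (2h) ≤ 1/sin θ ≤ h`. -/
lemma chebU_two_mul_le {α : ℝ} (h0 : 0 ≤ α) (h1 : α < 1) {h : ℕ} (hh : 1 ≤ h) :
    2 * (h : ℝ) * min ((h : ℝ) ^ 2 * (2 - 2 * α) / 5) (1 / 2) ≤ 2 * h - chebU (2 * h) α := by
  have hh' : (1 : ℝ) ≤ h := by exact_mod_cast hh
  obtain ⟨θ, hθ0, hθ1, rfl⟩ : ∃ θ : ℝ, 0 < θ ∧ θ ≤ Real.pi / 2 ∧ Real.cos θ = α :=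
    ⟨Real.arccos α, Real.arccos_pos.2 h1, Real.arccos_le_pi_div_two.2 h0,
      Real.cos_arccos (by linarith) h1.le⟩
  have hs : 0 < Real.sin θ := Real.sin_pos_of_pos_of_lt_pi hθ0 (by linarith [Real.pi_pos])
  have hv : 2 - 2 * Real.cos θ ≤ θ ^ 2 := by linarith [Real.one_sub_sq_div_two_le_cos (x := θ)]
  have hv0 : 0 ≤ 2 - 2 * Real.cos θ := by linarith [Real.cos_le_one θ]
  have e1 := sin_mul_chebU_cos (2 * h) θ
  have e2 := sin_mul_chebU_cos h θ
  have hb := abs_chebU_le (α := Real.cos θ) (Real.abs_cos_le_one θ) h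
  set u := chebU (2 * h) (Real.cos θ)
  set w := chebU h (Real.cos θ)
  have e3 : Real.sin ((2 * h : ℕ) * θ) = 2 * Real.sin (h * θ) * Real.cos (h * θ) := by
    rw [← Real.sin_two_mul]; push_cast; ring_nf
  rw [e3, ← e2] at e1
  have e4 : u = 2 * w * Real.cos (h * θ) := by
    apply mul_right_cancel₀ hs.ne'; rw [e1]; ring
  rcases le_or_gt (h * θ) (Real.pi / 2) with hc | hc
  · have c0 : 0 ≤ Real.cos (h * θ) :=
      Real.cos_nonneg_of_mem_Icc ⟨by nlinarith [Real.pi_pos], hc⟩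
    have c1 : Real.cos (h * θ) ≤ 1 - 2 / Real.pi ^ 2 * (h * θ) ^ 2 :=
      Real.cos_le_one_sub_mul_cos_sq (by rw [abs_of_nonneg (by positivity)]; linarith)
    have c2 : (1 : ℝ) / 5 ≤ 2 / Real.pi ^ 2 := by
      rw [div_le_div_iff₀ (by norm_num) (by positivity)]
      nlinarith [Real.pi_lt_d2, Real.pi_pos]
    have c3 : w ≤ h := (abs_le.1 hb).2
    have c4 : u ≤ 2 * h * Real.cos (h * θ) := by rw [e4]; nlinarith
    have c5 : (h : ℝ) ^ 2 * (2 - 2 * Real.cos θ) / 5 ≤ 1 - Real.cos (h * θ) := by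
      have : (h : ℝ) ^ 2 * (2 - 2 * Real.cos θ) / 5 ≤ 2 / Real.pi ^ 2 * (h * θ) ^ 2 := by
        calc _ ≤ (1 / 5) * (h * θ) ^ 2 := by nlinarith [sq_nonneg (h : ℝ)]
          _ ≤ _ := by gcongr
      linarith
    have c6 := min_le_left ((h : ℝ) ^ 2 * (2 - 2 * Real.cos θ) / 5) (1 / 2)
    nlinarith
  · have c1 : 2 / Real.pi * θ ≤ Real.sin θ := Real.mul_le_sin hθ0.le hθ1
    have c2 : 1 ≤ h * Real.sin θ := by
      calc (1 : ℝ) = 2 / Real.pi * (Real.pi / 2) := by field_simp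
        _ ≤ 2 / Real.pi * (h * θ) := by gcongr
        _ = h * (2 / Real.pi * θ) := by ring
        _ ≤ _ := by gcongr
    have c3 : u * Real.sin θ ≤ 1 := by
      rw [e1, e2, mul_assoc]
      have := Real.sin_le_one (2 * (h * θ))
      rw [Real.sin_two_mul] at this
      linarith
    have c4 : u ≤ h := by
      by_contra hcon
      push Not at hcon
      nlinarith
    have c6 := min_le_right ((h : ℝ) ^ 2 * (2 - 2 * Real.cos θ) / 5) (1 / 2)
    nlinarith

lemma fejer_lower {α : ℝ} (h0 : 0 ≤ α) (h1 : α < 1) {h : ℕ} (hh : 1 ≤ h) :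
    2 / 5 * (h : ℝ) ^ 3 / (1 + (h : ℝ) ^ 2 * (2 - 2 * α)) ≤ fejer (2 * h) α := by
  have e := two_sub_mul_fejer (2 * h) α
  have hb := chebU_two_mul_le h0 h1 hh
  have hh' : (1 : ℝ) ≤ h := by exact_mod_cast hh
  have hv : 0 < 2 - 2 * α := by linarith
  have h2 : 0 ≤ (h : ℝ) ^ 2 * (2 - 2 * α) := by positivity
  -- One rational expression that stays below both entries of the minimum.
  have hm : (h : ℝ) ^ 2 * (2 - 2 * α) / 5 / (1 + (h : ℝ) ^ 2 * (2 - 2 * α)) ≤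
      min ((h : ℝ) ^ 2 * (2 - 2 * α) / 5) (1 / 2) := by
    generalize (h : ℝ) ^ 2 * (2 - 2 * α) = z at h2
    apply le_min
    · apply div_le_self <;> linarith
    · rw [div_le_div_iff₀ (by linarith) (by norm_num)]; linarith
  rw [← mul_le_mul_iff_right₀ hv, e]
  push_cast
  refine le_trans (le_of_eq ?_) ((mul_le_mul_of_nonneg_left hm (by positivity)).trans hb)
  field_simp

/-! ### Linearisation of products and the square integral of the kernel -/

lemma chebU_mul_chebU (p d : ℕ) (α : ℝ) :
    chebU (p + 1) α * chebU (p + d + 1) α =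
      ∑ i ∈ Finset.range (p + 1), chebU (d + 2 * i + 1) α := by
  induction p with
  | zero => simp
  | succ p ih =>
    rw [Finset.sum_range_succ, ← ih, chebU_succ_mul_succ]
    congr 2 <;> ring_nf

lemma integrable_chebU_mul {μ : Measure ℝ} (hI : ∀ n, Integrable (chebU n) μ) (p q : ℕ) :
    Integrable (fun α => chebU p α * chebU q α) μ := by
  wlog hpq : p ≤ q generalizing p q with H
  · simpa only [mul_comm] using H q p (by omega)
  cases p with
  | zero => simp
  | succ p =>
    obtain ⟨d, rfl⟩ := Nat.exists_eq_add_of_le hpq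
    have : (fun α => chebU (p + 1) α * chebU (p + 1 + d) α) =
        fun α => ∑ i ∈ Finset.range (p + 1), chebU (d + 2 * i + 1) α := by
      funext α
      rw [← chebU_mul_chebU, show p + 1 + d = p + d + 1 by ring]
    rw [this]
    exact integrable_finsetSum _ fun i _ => hI _

lemma abs_integral_chebU_mul_le {μ : Measure ℝ} (hI : ∀ n, Integrable (chebU n) μ) {M p : ℕ}
    (hp : p < M) (d : ℕ) :
    |∫ α, chebU p α * chebU (p + d) α ∂μ| ≤
      ∑ i ∈ Finset.range M, |∫ α, chebU (d + 2 * i + 1) α ∂μ| := by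
  cases p with
  | zero => simpa using Finset.sum_nonneg fun i _ => abs_nonneg _
  | succ p =>
    have : (fun α => chebU (p + 1) α * chebU (p + 1 + d) α) =
        fun α => ∑ i ∈ Finset.range (p + 1), chebU (d + 2 * i + 1) α := by
      funext α
      rw [← chebU_mul_chebU, show p + 1 + d = p + d + 1 by ring]
    rw [this, integral_finsetSum _ fun i _ => hI _]
    refine (Finset.abs_sum_le_sum_abs _ _).trans ?_
    exact Finset.sum_le_sum_of_subset_of_nonneg (Finset.range_subset_range.2 hp.le)
      fun i _ _ => abs_nonneg _

lemma sum_sum_le_of_symm (M : ℕ) (f : ℕ → ℕ → ℝ) (h0 : ∀ p q, 0 ≤ f p q)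
    (hs : ∀ p q, f p q = f q p) :
    ∑ p ∈ Finset.range M, ∑ q ∈ Finset.range M, f p q ≤
      2 * ∑ p ∈ Finset.range M, ∑ d ∈ Finset.range M, f p (p + d) := by
  have h1 : ∑ p ∈ Finset.range M, ∑ q ∈ Finset.range M, f p q ≤
      ∑ p ∈ Finset.range M, ∑ q ∈ Finset.range M, (if p ≤ q then f p q else 0) +
      ∑ p ∈ Finset.range M, ∑ q ∈ Finset.range M, (if q ≤ p then f p q else 0) := by
    simp_rw [← Finset.sum_add_distrib]
    gcongr with p _ q _
    have := h0 p q
    rcases le_total p q with h | h <;> simp only [h, if_true] <;> split_ifs <;> linarith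
  have h2 : ∑ p ∈ Finset.range M, ∑ q ∈ Finset.range M, (if q ≤ p then f p q else 0) =
      ∑ p ∈ Finset.range M, ∑ q ∈ Finset.range M, (if p ≤ q then f p q else 0) := by
    rw [Finset.sum_comm]
    refine Finset.sum_congr rfl fun p _ => Finset.sum_congr rfl fun q _ => ?_
    rw [hs]
  have h3 : ∑ p ∈ Finset.range M, ∑ q ∈ Finset.range M, (if p ≤ q then f p q else 0) ≤
      ∑ p ∈ Finset.range M, ∑ d ∈ Finset.range M, f p (p + d) := by
    refine Finset.sum_le_sum fun p hp => ?_
    rw [← Finset.sum_filter]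
    have : (Finset.range M).filter (fun q => p ≤ q) = Finset.Ico p M := by
      ext q; simp [and_comm]
    rw [this, Finset.sum_Ico_eq_sum_range]
    exact Finset.sum_le_sum_of_subset_of_nonneg (Finset.range_subset_range.2 (by omega))
      fun i _ _ => h0 _ _
  linarith

/-- A number `n < 3M` is written as `d + 2i` at most once for each `i ≤ n`, hence at most `n + 1`
times. -/
lemma sum_sum_add_two_mul_le (M : ℕ) (F : ℕ → ℝ) (h0 : ∀ n, 0 ≤ F n) :
    ∑ d ∈ Finset.range M, ∑ i ∈ Finset.range M, F (d + 2 * i) ≤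
      ∑ n ∈ Finset.range (3 * M), ((n : ℝ) + 1) * F n := by
  rw [Finset.sum_comm]
  have h1 : ∀ i ∈ Finset.range M, ∑ d ∈ Finset.range M, F (d + 2 * i) ≤
      ∑ n ∈ Finset.range (3 * M), if i ≤ n then F n else 0 := by
    intro i hi
    have hi' := Finset.mem_range.1 hi
    rw [← Finset.sum_filter]
    have : ∑ d ∈ Finset.range M, F (d + 2 * i) =
        ∑ n ∈ (Finset.range M).image (fun d => d + 2 * i), F n := by
      rw [Finset.sum_image]
      intro a _ b _ h
      exact Nat.add_right_cancel h
    rw [this]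
    apply Finset.sum_le_sum_of_subset_of_nonneg
    · intro n hn
      simp only [Finset.mem_image, Finset.mem_range, Finset.mem_filter] at hn ⊢
      obtain ⟨d, hd, rfl⟩ := hn
      omega
    · intros; exact h0 _
  refine (Finset.sum_le_sum h1).trans ?_
  rw [Finset.sum_comm]
  gcongr with n _
  rw [← Finset.sum_filter, Finset.sum_const, nsmul_eq_mul]
  apply mul_le_mul_of_nonneg_right _ (h0 n)
  have : ((Finset.range M).filter (fun i => i ≤ n)).card ≤ (Finset.range (n + 1)).card := by
    apply Finset.card_le_card
    intro i
    simp only [Finset.mem_filter, Finset.mem_range]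
    omega
  rw [Finset.card_range] at this
  exact_mod_cast this

lemma integrable_fejer_sq {μ : Measure ℝ} (hI : ∀ n, Integrable (chebU n) μ) (M : ℕ) :
    Integrable (fun α => fejer M α ^ 2) μ := by
  have : (fun α => fejer M α ^ 2) = fun α => ∑ p ∈ Finset.range M, ∑ q ∈ Finset.range M,
      ((M : ℝ) - p) * ((M : ℝ) - q) * (chebU p α * chebU q α) := by
    funext α
    rw [fejer, sq, Finset.sum_mul_sum]
    refine Finset.sum_congr rfl fun p _ => Finset.sum_congr rfl fun q _ => by ring
  rw [this]
  exact integrable_finsetSum _ fun p _ => integrable_finsetSum _ fun q _ =>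
    (integrable_chebU_mul hI p q).const_mul _

/-- The weights are at most `M²`. For each of the `M` values of `p`, the products with all `p + d`
linearise to a sum in which `U_n` occurs at most `n + 1` times; symmetry in the two indices gives
the factor 2. The weight `n + 1` meets the factor `n` in the hypothesis on the coefficients, and the
`n²` so obtained is at most of order `M²`. -/
lemma integral_fejer_sq_le {μ : Measure ℝ} (hI : ∀ n, Integrable (chebU n) μ) (M : ℕ) :
    ∫ α, fejer M α ^ 2 ∂μ ≤
      2 * (M : ℝ) ^ 3 * ∑ n ∈ Finset.range (3 * M),
        ((n : ℝ) + 1) * |∫ α, chebU (n + 1) α ∂μ| := by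
  have : (fun α => fejer M α ^ 2) = fun α => ∑ p ∈ Finset.range M, ∑ q ∈ Finset.range M,
      ((M : ℝ) - p) * ((M : ℝ) - q) * (chebU p α * chebU q α) := by
    funext α
    rw [fejer, sq, Finset.sum_mul_sum]
    refine Finset.sum_congr rfl fun p _ => Finset.sum_congr rfl fun q _ => by ring
  rw [this, integral_finsetSum _ fun p _ => integrable_finsetSum _ fun q _ =>
    (integrable_chebU_mul hI p q).const_mul _]
  simp_rw [integral_finsetSum _ fun q _ => (integrable_chebU_mul hI _ q).const_mul _,
    integral_const_mul]
  set I : ℕ → ℕ → ℝ := fun p q => ∫ α, chebU p α * chebU q α ∂μ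
  set F : ℕ → ℝ := fun n => |∫ α, chebU (n + 1) α ∂μ|
  calc ∑ p ∈ Finset.range M, ∑ q ∈ Finset.range M, ((M : ℝ) - p) * ((M : ℝ) - q) * I p q
      ≤ ∑ p ∈ Finset.range M, ∑ q ∈ Finset.range M, (M : ℝ) ^ 2 * |I p q| := by
        refine Finset.sum_le_sum fun p hp => Finset.sum_le_sum fun q hq => ?_
        have hp' : (p : ℝ) ≤ M := by exact_mod_cast (Finset.mem_range.1 hp).le
        have hq' : (q : ℝ) ≤ M := by exact_mod_cast (Finset.mem_range.1 hq).le
        have hp0 : (0 : ℝ) ≤ p := p.cast_nonneg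
        have hq0 : (0 : ℝ) ≤ q := q.cast_nonneg
        have h1 : ((M : ℝ) - p) * ((M : ℝ) - q) ≤ (M : ℝ) ^ 2 := by nlinarith
        exact (mul_le_mul_of_nonneg_left (le_abs_self (I p q))
            (mul_nonneg (sub_nonneg.2 hp') (sub_nonneg.2 hq'))).trans
            (mul_le_mul_of_nonneg_right h1 (abs_nonneg _))
    _ = (M : ℝ) ^ 2 * ∑ p ∈ Finset.range M, ∑ q ∈ Finset.range M, |I p q| := by
        simp_rw [Finset.mul_sum]
    _ ≤ (M : ℝ) ^ 2 * (2 * ∑ p ∈ Finset.range M, ∑ d ∈ Finset.range M, |I p (p + d)|) := by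
        gcongr
        apply sum_sum_le_of_symm M (fun p q => |I p q|) (fun _ _ => abs_nonneg _)
        intro p q
        simp only [I, mul_comm]
    _ ≤ (M : ℝ) ^ 2 * (2 * ∑ p ∈ Finset.range M, ∑ n ∈ Finset.range (3 * M),
          ((n : ℝ) + 1) * F n) := by
        gcongr with p hp
        refine le_trans (Finset.sum_le_sum fun d _ =>
          abs_integral_chebU_mul_le hI (Finset.mem_range.1 hp) d) ?_
        exact sum_sum_add_two_mul_le M F fun _ => abs_nonneg _
    _ = _ := by rw [Finset.sum_const, Finset.card_range, nsmul_eq_mul]; ring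

/-! ### Riemann sums and alternating sums -/

/-- Turns a sum over `n` into the integral of a step function of `x = n/s`, so that limits of
Riemann sums follow from dominated convergence. -/
lemma integral_step_ceil {s : ℝ} (hs : 0 < s) (f : ℕ → ℝ) (m : ℕ) (hf : ∀ n, m < n → f n = 0) :
    ∫ x in Set.Ioi (0 : ℝ), f ⌈x * s⌉₊ = (∑ n ∈ Finset.Icc 1 m, f n) / s := by
  have h1 : ∀ x ∈ Set.Ioi (0 : ℝ), f ⌈x * s⌉₊ = ∑ n ∈ Finset.Icc 1 m,
      (Set.Ioc (((n : ℝ) - 1) / s) (n / s)).indicator (fun _ => f n) x := by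
    intro x hx
    have hx' : 0 < x * s := mul_pos hx hs
    have key : ∀ n : ℕ, 1 ≤ n → (x ∈ Set.Ioc (((n : ℝ) - 1) / s) (n / s) ↔ ⌈x * s⌉₊ = n) := by
      intro n hn
      rw [Nat.ceil_eq_iff (by omega), Set.mem_Ioc, div_lt_iff₀ hs, le_div_iff₀ hs,
        Nat.cast_sub hn, Nat.cast_one]
    have hpos : 1 ≤ ⌈x * s⌉₊ := Nat.one_le_ceil_iff.2 hx'
    by_cases hm : ⌈x * s⌉₊ ≤ m
    · rw [Finset.sum_eq_single ⌈x * s⌉₊]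
      · rw [Set.indicator_of_mem ((key _ hpos).2 rfl)]
      · intro n hn hne
        rw [Set.indicator_of_notMem]
        rw [key n (Finset.mem_Icc.1 hn).1]
        exact fun h => hne h.symm
      · intro h
        exact absurd (Finset.mem_Icc.2 ⟨hpos, hm⟩) h
    · rw [hf _ (by omega), Finset.sum_eq_zero]
      intro n hn
      rw [Set.indicator_of_notMem]
      rw [key n (Finset.mem_Icc.1 hn).1]
      have := (Finset.mem_Icc.1 hn).2
      omega
  rw [setIntegral_congr_fun measurableSet_Ioi h1, integral_finsetSum]
  · rw [Finset.sum_div]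
    refine Finset.sum_congr rfl fun n hn => ?_
    have hn1 : (1 : ℝ) ≤ n := by exact_mod_cast (Finset.mem_Icc.1 hn).1
    rw [setIntegral_indicator measurableSet_Ioc, setIntegral_const, smul_eq_mul,
      Set.inter_eq_right.2, Real.volume_real_Ioc_of_le]
    · field_simp; ring
    · gcongr; linarith
    · intro x hx
      exact lt_of_le_of_lt (div_nonneg (by linarith) hs.le) hx.1
  · intro n _
    exact ((integrable_indicator_iff measurableSet_Ioc).2 (by simp)).restrict

/-- Riemann sums of functions `f i` of `n`, which converge to `H x` as `n / s i → x`. -/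
lemma tendsto_riemann_sum {ι : Type*} {l : Filter ι} [l.IsCountablyGenerated] {s : ι → ℝ}
    (hs : Tendsto s l atTop) {f : ι → ℕ → ℝ} {H : ℝ → ℝ} {B R : ℝ} {m : ι → ℕ}
    (hm : ∀ᶠ i in l, R * s i ≤ m i)
    (hB : ∀ᶠ i in l, ∀ n, |f i n| ≤ B) (hR : ∀ᶠ i in l, ∀ n : ℕ, R * s i < n → f i n = 0)
    (hc : ∀ᵐ x : ℝ, 0 < x → ∀ n : ι → ℕ, Tendsto (fun i => n i / s i) l (𝓝 x) →
      Tendsto (fun i => f i (n i)) l (𝓝 (H x))) :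
    Tendsto (fun i => (∑ n ∈ Finset.Icc 1 (m i), f i n) / s i) l (𝓝 (∫ x in Set.Ioi 0, H x)) := by
  have h1 : Tendsto (fun i => ∫ x in Set.Ioi (0 : ℝ), f i ⌈x * s i⌉₊) l
      (𝓝 (∫ x in Set.Ioi 0, H x)) := by
    apply tendsto_integral_filter_of_dominated_convergence
      (fun x => (Set.Ioc 0 R).indicator (fun _ => B) x)
    · refine Eventually.of_forall fun i => ?_
      have : Measurable (fun x : ℝ => f i ⌈x * s i⌉₊) :=
        (measurable_from_nat (f := f i)).comp (Nat.measurable_ceil.comp (measurable_id.mul_const _))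
      exact this.aestronglyMeasurable
    · filter_upwards [hB, hR, hs.eventually_gt_atTop 0] with i h1 h2 h3
      filter_upwards [ae_restrict_mem measurableSet_Ioi] with x hx
      by_cases hxR : x ≤ R
      · rw [Set.indicator_of_mem (show x ∈ Set.Ioc 0 R from ⟨hx, hxR⟩)]
        exact h1 _
      · rw [h2]
        · simp only [norm_zero]
          exact Set.indicator_nonneg (fun _ _ => (abs_nonneg _).trans (h1 0)) _
        · push Not at hxR
          exact lt_of_lt_of_le (mul_lt_mul_of_pos_right hxR h3) (Nat.le_ceil _)
    · exact ((integrable_indicator_iff measurableSet_Ioc).2 (by simp)).restrict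
    · rw [ae_restrict_iff' measurableSet_Ioi]
      filter_upwards [hc] with x hx hx0
      exact hx hx0 _ ((tendsto_nat_ceil_mul_div_atTop (le_of_lt hx0)).comp hs)
  refine h1.congr' ?_
  filter_upwards [hm, hR, hs.eventually_gt_atTop 0] with i h1 h2 h3
  apply integral_step_ceil h3
  intro n hn
  apply h2
  have : (m i : ℝ) < n := by exact_mod_cast hn
  linarith

lemma sum_Icc_alternating (m : ℕ) (F : ℕ → ℝ) :
    ∑ n ∈ Finset.Icc 1 m, (-1) ^ n * F n =
      2 * ∑ j ∈ Finset.Icc 1 (m / 2), F (2 * j) - ∑ n ∈ Finset.Icc 1 m, F n := by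
  induction m with
  | zero => simp
  | succ m ih =>
    rw [Finset.sum_Icc_succ_top (by omega), ih, Finset.sum_Icc_succ_top (by omega)]
    rcases Nat.even_or_odd' m with ⟨k, rfl | rfl⟩
    · rw [show (2 * k + 1) / 2 = k by omega, show 2 * k / 2 = k by omega, pow_succ, pow_mul]
      norm_num
      ring
    · rw [show (2 * k + 1 + 1) / 2 = k + 1 by omega, show (2 * k + 1) / 2 = k by omega,
        Finset.sum_Icc_succ_top (by omega : 1 ≤ k + 1) (fun j => F (2 * j)),
        show 2 * k + 1 + 1 = 2 * (k + 1) by ring, pow_mul]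
      norm_num
      ring

/-- The alternating sum is twice the even part minus the whole. The even part is a Riemann sum at
scale `s/2`, so both have the same limit. This is why the profile of one edge is invisible at the
other. -/
lemma tendsto_alternating_sum {ι : Type*} {l : Filter ι} [l.IsCountablyGenerated] {s : ι → ℝ}
    (hs : Tendsto s l atTop) {f : ι → ℕ → ℝ} {H : ℝ → ℝ} {B R : ℝ} {m : ι → ℕ}
    (hm : ∀ᶠ i in l, R * s i + 1 ≤ m i)
    (hB : ∀ᶠ i in l, ∀ n, |f i n| ≤ B) (hR : ∀ᶠ i in l, ∀ n : ℕ, R * s i < n → f i n = 0)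
    (hc : ∀ᵐ x : ℝ, 0 < x → ∀ n : ι → ℕ, Tendsto (fun i => n i / s i) l (𝓝 x) →
      Tendsto (fun i => f i (n i)) l (𝓝 (H x))) :
    Tendsto (fun i => (∑ n ∈ Finset.Icc 1 (m i), (-1) ^ n * f i n) / s i) l (𝓝 0) := by
  have h1 := tendsto_riemann_sum hs (m := m) (hm.mono fun i h => by linarith) hB hR hc
  have h2 := tendsto_riemann_sum (s := fun i => s i / 2) (hs.atTop_div_const (by norm_num))
    (f := fun i n => f i (2 * n)) (H := H) (B := B) (R := R) (m := fun i => m i / 2) ?_ ?_ ?_ ?_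
  · have := h2.sub h1
    rw [sub_self] at this
    refine this.congr fun i => ?_
    rw [sum_Icc_alternating, sub_div]
    congr 1
    rw [div_div_eq_mul_div, mul_comm]
  -- The extra `1` in `hm` pays for rounding down in `m i / 2`.
  · filter_upwards [hm] with i h
    have : m i ≤ 2 * (m i / 2) + 1 := by omega
    have : (m i : ℝ) ≤ 2 * ((m i / 2 : ℕ) : ℝ) + 1 := by exact_mod_cast this
    linarith
  · filter_upwards [hB] with i h n using h _
  · filter_upwards [hR] with i h n hn
    apply h
    push_cast
    linarith
  · filter_upwards [hc] with x hx hx0 n hn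
    apply hx hx0
    refine hn.congr fun i => ?_
    push_cast
    rw [div_div_eq_mul_div, mul_comm]

/-! ### Test functions and the limit of the linear functional -/

/-- Odd `C⁴` functions which vanish on `[R, ∞)`. -/
structure EdgeTest (a : ℝ → ℝ) (R : ℝ) : Prop where
  pos : 0 < R
  contDiff : ContDiff ℝ 4 a
  odd : ∀ x, a (-x) = -a x
  eq_zero : ∀ x, R ≤ x → a x = 0

namespace EdgeTest

variable {a : ℝ → ℝ} {R : ℝ}

lemma zero (h : EdgeTest a R) : a 0 = 0 := by
  have := h.odd 0
  rw [neg_zero] at this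
  linarith

lemma hasCompactSupport (h : EdgeTest a R) : HasCompactSupport a := by
  apply HasCompactSupport.of_support_subset_isCompact (isCompact_Icc (a := -R) (b := R))
  intro x hx
  rw [Function.mem_support] at hx
  constructor
  · by_contra hlt
    push Not at hlt
    have h1 := h.eq_zero (-x) (by linarith)
    rw [h.odd] at h1
    exact hx (by linarith)
  · by_contra hlt
    push Not at hlt
    exact hx (h.eq_zero x hlt.le)

lemma continuous (h : EdgeTest a R) : Continuous a := h.contDiff.continuous

lemma exists_bound (h : EdgeTest a R) : ∃ A, 0 ≤ A ∧ ∀ x, |a x| ≤ A := by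
  obtain ⟨A, hA⟩ := h.continuous.bounded_above_of_compact_support h.hasCompactSupport
  exact ⟨A, (norm_nonneg _).trans (hA 0), hA⟩

end EdgeTest

lemma EdgeProfile.integrableOn_Ioc {δ : ℝ} (hδ : δ < 1) {φ : ℝ → ℝ} (h : EdgeProfile δ φ) (R : ℝ) :
    IntegrableOn φ (Set.Ioc 0 R) := by
  have hc : Continuous fun x : ℝ => Real.exp (x ^ (2 - δ)) :=
    Real.continuous_exp.comp (Real.continuous_rpow_const (by linarith))
  have h1 : IntegrableOn (fun x => φ x * Real.exp (-x ^ (2 - δ))) (Set.Ioc 0 R) :=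
    h.integrableOn.mono_set fun x hx => hx.1
  have h2 := h1.mul_continuousOn_of_subset (hc.continuousOn (s := Set.Icc 0 R)) measurableSet_Ioc
    isCompact_Icc Set.Ioc_subset_Icc_self
  refine h2.congr_fun (fun x _ => ?_) measurableSet_Ioc
  simp only
  rw [mul_assoc, ← Real.exp_add]
  simp

namespace EdgeAsymptotics

variable {μ : ℕ → Measure ℝ} {s : ℕ → ℝ} {φR φL : ℝ → ℝ} {ε : ℕ → ℕ → ℝ}

lemma integrable_chebU (h : EdgeAsymptotics μ s φR φL ε) (N n : ℕ) :
    Integrable (chebU n) (μ N) := by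
  cases n with
  | zero => simp [funext chebU_zero]
  | succ n => simpa only [funext (chebU_succ_eq_eval n)] using h.integrable N n

lemma integral_chebU_one (h : EdgeAsymptotics μ s φR φL ε) (N : ℕ) :
    ∫ α, chebU 1 α ∂(μ N) = 1 := by
  have := h.prob N
  simp

lemma integral_chebU_succ (h : EdgeAsymptotics μ s φR φL ε) (N n : ℕ) (hn : 1 ≤ n) :
    ∫ α, chebU (n + 1) α ∂(μ N) =
      n / s N ^ 3 * (φR (n / s N) + (-1) ^ n * φL (n / s N)) + ε N n / s N ^ 2 := by
  rw [← h.coeff N n hn, chebCoeff]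
  simp only [chebU_succ_eq_eval]

/-- The profile may be singular at `0`, so indices `n ≤ η s` are removed before a Riemann sum is
taken; what remains is bounded because `φ` is continuous on `[η, R]`. The cut is discontinuous at `x
= η`, hence the exceptional null set. The argument `(n + 1)/s` reflects the shifted index of
`chebU`. -/
lemma tendsto_cut_sum (hs : Tendsto s atTop atTop) {φ : ℝ → ℝ}
    (hφ : ContinuousOn φ (Set.Ioi 0)) {a : ℝ → ℝ} {R : ℝ} (ha : EdgeTest a R) {η : ℝ} (hη : 0 < η) :
    (∃ B, ∀ᶠ N in atTop, ∀ n : ℕ,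
      |if η * s N < n then a ((n + 1) / s N) * (n / s N) * φ (n / s N) else 0| ≤ B) ∧
    (∀ᶠ N in atTop, ∀ n : ℕ, R * s N < n →
      (if η * s N < n then a ((n + 1) / s N) * (n / s N) * φ (n / s N) else 0) = 0) ∧
    (∀ᵐ x : ℝ, 0 < x → ∀ n : ℕ → ℕ, Tendsto (fun N => n N / s N) atTop (𝓝 x) →
      Tendsto (fun N => if η * s N < n N then
        a ((n N + 1) / s N) * (n N / s N) * φ (n N / s N) else 0) atTop
        (𝓝 (if η < x then a x * x * φ x else 0))) := by
  have hR : ∀ᶠ N in atTop, ∀ n : ℕ, R * s N < n →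
      (if η * s N < n then a ((n + 1) / s N) * (n / s N) * φ (n / s N) else 0) = 0 := by
    filter_upwards [hs.eventually_gt_atTop 0] with N hN n hn
    rw [ha.eq_zero ((n + 1) / s N)]
    · simp
    · rw [le_div_iff₀ hN]; linarith
  refine ⟨?_, hR, ?_⟩
  · obtain ⟨A, hA0, hA⟩ := ha.exists_bound
    obtain ⟨B, hB⟩ := (isCompact_Icc (a := η) (b := R)).exists_bound_of_continuousOn
      (hφ.mono fun x hx => lt_of_lt_of_le hη hx.1)
    refine ⟨A * R * |B|, ?_⟩
    filter_upwards [hR, hs.eventually_gt_atTop 0] with N h1 h2 n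
    by_cases hn : R * s N < n
    · rw [h1 n hn, abs_zero]
      have := ha.pos
      positivity
    · push Not at hn
      have h3 : (n : ℝ) / s N ≤ R := by rwa [div_le_iff₀ h2]
      have h4 : 0 ≤ (n : ℝ) / s N := by positivity
      split_ifs with h5
      · have h6 : η ≤ (n : ℝ) / s N := by rw [le_div_iff₀ h2]; exact h5.le
        rw [abs_mul, abs_mul, abs_of_nonneg h4]
        have h7 := (hB _ ⟨h6, h3⟩).trans (le_abs_self B)
        rw [Real.norm_eq_abs] at h7
        have h8 := hA ((n + 1) / s N)
        have h9 := ha.pos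
        gcongr
      · rw [abs_zero]
        have := ha.pos
        positivity
  · have hne : ∀ᵐ x : ℝ, x ≠ η := by
      simp [ae_iff]
    filter_upwards [hne] with x hx hx0 n hn
    have hsp := hs.eventually_gt_atTop 0
    have h1 : Tendsto (fun N => ((n N : ℝ) + 1) / s N) atTop (𝓝 x) := by
      have := hn.add (tendsto_inv_atTop_zero.comp hs)
      rw [add_zero] at this
      refine this.congr fun N => ?_
      simp only [Function.comp]
      ring
    have h2 : Tendsto (fun N => φ (n N / s N)) atTop (𝓝 (φ x)) :=
      ((hφ.continuousAt (Ioi_mem_nhds hx0)).tendsto).comp hn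
    rcases lt_or_gt_of_ne hx with h | h
    · rw [if_neg (by linarith)]
      apply tendsto_const_nhds.congr'
      filter_upwards [hn.eventually_lt_const h, hsp] with N h3 h4
      rw [div_lt_iff₀ h4] at h3
      rw [if_neg (by linarith)]
    · rw [if_pos h]
      have := (((ha.continuous.tendsto x).comp h1).mul hn).mul h2
      refine this.congr' ?_
      filter_upwards [hn.eventually_const_lt h, hsp] with N h3 h4
      rw [lt_div_iff₀ h4] at h3
      rw [if_pos h3]
      rfl

/-- Index `1` carries the total mass `1` and produces the derivative at `0`; index `n + 1` carries
the coefficient of `U_n`, whose factor `n/s³` supplies the `x` in the integral. -/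
lemma tendsto_functional (h : EdgeAsymptotics μ s φR φL ε) (hR : ContinuousOn φR (Set.Ioi 0))
    (hL : ContinuousOn φL (Set.Ioi 0)) {a : ℝ → ℝ} {R : ℝ} (ha : EdgeTest a R)
    (hi : IntegrableOn (fun x => a x * x * φR x) (Set.Ioi 0)) :
    Tendsto (fun N => s N * ∑ n ∈ Finset.Icc 1 (⌈R * s N⌉₊ + 2),
      a (n / s N) * ∫ α, chebU n α ∂(μ N)) atTop
      (𝓝 (deriv a 0 + ∫ x in Set.Ioi 0, a x * x * φR x)) := by
  have hs := h.scale_tendsto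
  obtain ⟨A, hA0, hA⟩ := ha.exists_bound
  have hRp := ha.pos
  set k : ℕ → ℕ := fun N => ⌈R * s N⌉₊ + 1 with hk
  have hk1 : ∀ N, R * s N + 1 ≤ k N := fun N => by
    simp only [hk]; push_cast; linarith [Nat.le_ceil (R * s N)]
  have hk2 : ∀ᶠ N in atTop, (k N : ℝ) ≤ (R + 2) * s N := by
    filter_upwards [hs.eventually_ge_atTop 1] with N hN
    have := Nat.ceil_lt_add_one (mul_nonneg hRp.le (zero_le_one.trans hN))
    simp only [hk]; push_cast; nlinarith
  set F : ℕ → ℕ → ℝ := fun N n => φR (n / s N) + (-1) ^ n * φL (n / s N) with hF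
  -- the value at the first coefficient
  have t1 : Tendsto (fun N => s N * a (1 / s N)) atTop (𝓝 (deriv a 0)) := by
    have hd : HasDerivAt a (deriv a 0) 0 :=
      (ha.contDiff.differentiable (by norm_num)).differentiableAt.hasDerivAt
    have := hd.tendsto_slope.comp (f := fun N => 1 / s N) (x := atTop) ?_
    · refine this.congr fun N => ?_
      simp [slope_def_field, ha.zero]
      ring
    · refine tendsto_nhdsWithin_iff.2 ⟨?_, ?_⟩
      · simpa [Function.comp_def] using tendsto_inv_atTop_zero.comp hs
      · filter_upwards [hs.eventually_gt_atTop 0] with N hN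
        simpa using hN.ne'
  -- the error terms
  have t2 : Tendsto (fun N => (∑ n ∈ Finset.Icc 1 (k N), a ((n + 1) / s N) * ε N n) / s N) atTop
      (𝓝 0) := by
    rw [Metric.tendsto_nhds]
    intro η hη
    obtain ⟨Q, hQ⟩ := exists_nat_ge (R + 2)
    have hη' : 0 < η / (2 * (A + 1) * (R + 2)) := by positivity
    filter_upwards [h.error_small Q _ hη', hk2, hs.eventually_gt_atTop 0] with N h1 h2 h3
    rw [dist_zero_right, Real.norm_eq_abs, abs_div, abs_of_pos h3, div_lt_iff₀ h3]
    calc |∑ n ∈ Finset.Icc 1 (k N), a ((n + 1) / s N) * ε N n|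
        ≤ ∑ n ∈ Finset.Icc 1 (k N), |a ((n + 1) / s N) * ε N n| := Finset.abs_sum_le_sum_abs _ _
      _ ≤ ∑ n ∈ Finset.Icc 1 (k N), (A + 1) * (η / (2 * (A + 1) * (R + 2))) := by
          apply Finset.sum_le_sum
          intro n hn
          rw [Finset.mem_Icc] at hn
          rw [abs_mul]
          apply mul_le_mul _ _ (abs_nonneg _) (by linarith)
          · linarith [hA ((n + 1) / s N)]
          · apply h1 n hn.1
            have : (n : ℝ) ≤ k N := by exact_mod_cast hn.2
            nlinarith
      _ = k N * ((A + 1) * (η / (2 * (A + 1) * (R + 2)))) := by simp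
      _ ≤ (R + 2) * s N * ((A + 1) * (η / (2 * (A + 1) * (R + 2)))) := by gcongr
      _ = η / 2 * s N := by field_simp
      _ < η * s N := by nlinarith
  -- the main terms
  have t3 : Tendsto (fun N => (∑ n ∈ Finset.Icc 1 (k N), a ((n + 1) / s N) * (n / s N) * F N n) / s N)
      atTop (𝓝 (∫ x in Set.Ioi 0, a x * x * φR x)) := by
    obtain ⟨C, hC⟩ := h.riemann_sum
    have hint : Tendsto (fun η : ℝ => ∫ x in Set.Ioi 0, if η < x then a x * x * φR x else 0)
        (𝓝[>] 0) (𝓝 (∫ x in Set.Ioi 0, a x * x * φR x)) := by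
      apply tendsto_integral_filter_of_dominated_convergence (fun x => ‖a x * x * φR x‖)
      · refine Eventually.of_forall fun η => ?_
        have : (fun x => if η < x then a x * x * φR x else 0) =
            (Set.Ioi η).indicator (fun x => a x * x * φR x) := by
          funext x; simp [Set.indicator_apply]
        rw [this]
        exact hi.aestronglyMeasurable.indicator measurableSet_Ioi
      · refine Eventually.of_forall fun η => Eventually.of_forall fun x => ?_
        split_ifs
        · exact le_rfl
        · simp only [norm_zero]; positivity
      · exact hi.norm
      · filter_upwards [ae_restrict_mem measurableSet_Ioi] with x hx
        apply tendsto_const_nhds.congr'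
        filter_upwards [Ioo_mem_nhdsGT (Set.mem_Ioi.1 hx)] with η hη
        rw [if_pos hη.2]
    rw [Metric.tendsto_nhds]
    intro θ hθ
    have e1 : ∀ᶠ η : ℝ in 𝓝[>] 0, dist (∫ x in Set.Ioi 0, if η < x then a x * x * φR x else 0)
        (∫ x in Set.Ioi 0, a x * x * φR x) < θ / 3 := (Metric.tendsto_nhds.1 hint) _ (by linarith)
    have e2 : ∀ᶠ η : ℝ in 𝓝[>] 0, A * η * |C| < θ / 3 := by
      have : Tendsto (fun η : ℝ => A * η * |C|) (𝓝[>] 0) (𝓝 (A * 0 * |C|)) :=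
        ((tendsto_id.mono_left nhdsWithin_le_nhds).const_mul A).mul_const _
      refine this.eventually_lt_const ?_
      simp; linarith
    -- The cut `η` is fixed before `N`: it must be harmless for the limit integral and for the
    -- discarded terms, which carry `n/s ≤ η` and are otherwise controlled by `riemann_sum`. The
    -- bound `η < 1` puts them in the range `n ≤ s N` of that hypothesis.
    obtain ⟨η, ⟨e1, e2⟩, hη0, hη1⟩ := ((e1.and e2).and (Ioo_mem_nhdsGT one_pos)).exists
    obtain ⟨⟨B1, hB1⟩, hz1, hc1⟩ := tendsto_cut_sum hs hR ha hη0
    obtain ⟨⟨B2, hB2⟩, hz2, hc2⟩ := tendsto_cut_sum hs hL ha hη0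
    have r1 := tendsto_riemann_sum hs (m := k)
      (Eventually.of_forall fun N => by linarith [hk1 N]) hB1 hz1 hc1
    have r2 := tendsto_alternating_sum hs (m := k) (Eventually.of_forall hk1) hB2 hz2 hc2
    have r3 := r1.add r2
    rw [add_zero] at r3
    filter_upwards [(Metric.tendsto_nhds.1 r3) (θ / 3) (by linarith),
      hs.eventually_gt_atTop 0] with N h1 h2
    have h3 : |(∑ n ∈ Finset.Icc 1 (k N), a ((n + 1) / s N) * (n / s N) * F N n) / s N -
        ((∑ n ∈ Finset.Icc 1 (k N), if η * s N < n then
            a ((n + 1) / s N) * (n / s N) * φR (n / s N) else 0) / s N +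
          (∑ n ∈ Finset.Icc 1 (k N), (-1) ^ n * if η * s N < n then
            a ((n + 1) / s N) * (n / s N) * φL (n / s N) else 0) / s N)| ≤ A * η * |C| := by
      rw [← add_div, ← sub_div, ← Finset.sum_add_distrib, ← Finset.sum_sub_distrib, abs_div,
        abs_of_pos h2]
      have h4 : ∀ n ∈ Finset.Icc 1 (k N), |a ((n + 1) / s N) * (n / s N) * F N n -
          ((if η * s N < n then a ((n + 1) / s N) * (n / s N) * φR (n / s N) else 0) +
          (-1) ^ n * if η * s N < n then a ((n + 1) / s N) * (n / s N) * φL (n / s N) else 0)| ≤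
          if n ≤ ⌊s N⌋₊ then A * η * |F N n| else 0 := by
        intro n _
        split_ifs with h5 h6 h6
        · have : a ((n + 1) / s N) * (n / s N) * F N n -
            (a ((n + 1) / s N) * (n / s N) * φR (n / s N) +
            (-1) ^ n * (a ((n + 1) / s N) * (n / s N) * φL (n / s N))) = 0 := by
            simp only [hF]; ring
          rw [this, abs_zero]
          positivity
        · have : a ((n + 1) / s N) * (n / s N) * F N n -
            (a ((n + 1) / s N) * (n / s N) * φR (n / s N) +
            (-1) ^ n * (a ((n + 1) / s N) * (n / s N) * φL (n / s N))) = 0 := by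
            simp only [hF]; ring
          rw [this, abs_zero]
        · push Not at h5
          have h7 : (n : ℝ) / s N ≤ η := by rwa [div_le_iff₀ h2]
          have h8 : 0 ≤ (n : ℝ) / s N := by positivity
          simp only [mul_zero, add_zero, sub_zero]
          rw [abs_mul, abs_mul, abs_of_nonneg h8]
          have := hA ((n + 1) / s N)
          gcongr
        · push Not at h5
          exfalso
          apply h6
          apply Nat.le_floor
          nlinarith
      rw [div_le_iff₀ h2]
      refine (Finset.abs_sum_le_sum_abs _ _).trans ((Finset.sum_le_sum h4).trans ?_)
      rw [← Finset.sum_filter, ← Finset.mul_sum]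
      have h5 : ∑ n ∈ (Finset.Icc 1 (k N)).filter (fun n => n ≤ ⌊s N⌋₊), |F N n| ≤
          ∑ n ∈ Finset.Icc 1 ⌊s N⌋₊, |F N n| := by
        apply Finset.sum_le_sum_of_subset_of_nonneg
        · intro n
          simp only [Finset.mem_filter, Finset.mem_Icc]
          tauto
        · intros; positivity
      have h6 := hC N
      rw [← Finset.sum_div, div_le_iff₀ h2] at h6
      calc _ ≤ A * η * (C * s N) := by
            gcongr
            exact h5.trans h6
        _ ≤ A * η * (|C| * s N) := by
            gcongr
            exact le_abs_self C
        _ = _ := by ring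
    rw [Real.dist_eq] at *
    set X := (∑ n ∈ Finset.Icc 1 (k N), a ((n + 1) / s N) * (n / s N) * F N n) / s N
    set Y := (∑ n ∈ Finset.Icc 1 (k N), if η * s N < n then
            a ((n + 1) / s N) * (n / s N) * φR (n / s N) else 0) / s N +
          (∑ n ∈ Finset.Icc 1 (k N), (-1) ^ n * if η * s N < n then
            a ((n + 1) / s N) * (n / s N) * φL (n / s N) else 0) / s N
    rw [abs_lt] at *
    rw [abs_le] at h3
    constructor <;> linarith
  have t4 := (t1.add t3).add t2
  rw [add_zero] at t4
  refine t4.congr' ?_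
  filter_upwards [hs.eventually_gt_atTop 0] with N hN
  have e : Finset.Icc 1 (⌈R * s N⌉₊ + 2) = insert 1 ((Finset.Icc 1 (k N)).image (· + 1)) := by
    ext n
    simp only [Finset.mem_Icc, Finset.mem_insert, Finset.mem_image, hk]
    constructor
    · intro hn
      by_cases h1 : n = 1
      · exact Or.inl h1
      · exact Or.inr ⟨n - 1, by omega, by omega⟩
    · rintro (rfl | ⟨j, hj, rfl⟩) <;> omega
  rw [e, Finset.sum_insert, Finset.sum_image]
  · rw [h.integral_chebU_one, mul_add, add_assoc]
    congr 1
    · simp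
    rw [← add_div, ← Finset.sum_add_distrib, Finset.mul_sum, Finset.sum_div]
    apply Finset.sum_congr rfl
    intro n hn
    rw [h.integral_chebU_succ N n (Finset.mem_Icc.1 hn).1]
    push_cast
    simp only [hF]
    field_simp
  · intro x _ y _ hxy
    exact Nat.add_right_cancel hxy
  · simp
    
end EdgeAsymptotics

/-! ### Moment bounds for the kernel from the hypotheses on the coefficients -/

lemma EdgeProfile.setIntegral_abs_le {δ : ℝ} (hδ : δ < 1) {φ : ℝ → ℝ} (h : EdgeProfile δ φ)
    (Y : ℝ) :
    ∫ x in Set.Ioc 1 Y, |φ x| ≤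
      Real.exp (Y ^ (2 - δ)) * ∫ x in Set.Ioi 0, |φ x * Real.exp (-x ^ (2 - δ))| := by
  have hsub : Set.Ioc 1 Y ⊆ Set.Ioi (0 : ℝ) := fun x hx => lt_trans one_pos hx.1
  rw [← integral_const_mul]
  have hint : IntegrableOn (fun x => Real.exp (Y ^ (2 - δ)) *
      |φ x * Real.exp (-x ^ (2 - δ))|) (Set.Ioi 0) :=
    h.integrableOn.norm.const_mul (Real.exp (Y ^ (2 - δ)))
  refine le_trans (setIntegral_mono_on ?_ (hint.mono_set hsub) measurableSet_Ioc ?_)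
    (setIntegral_mono_set hint (Eventually.of_forall fun x => by simp only [Pi.zero_apply]; positivity)
      (LE.le.eventuallyLE hsub))
  · exact ((h.integrableOn_Ioc hδ Y).mono_set fun x hx => ⟨lt_trans one_pos hx.1, hx.2⟩).abs
  · intro x hx
    rw [abs_mul, Real.abs_exp, mul_left_comm, ← Real.exp_add]
    have hx0 : 0 ≤ x := zero_le_one.trans hx.1.le
    have : x ^ (2 - δ) ≤ Y ^ (2 - δ) := Real.rpow_le_rpow hx0 hx.2 (by linarith)
    exact le_mul_of_one_le_right (abs_nonneg _) (Real.one_le_exp (by linarith))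

lemma tendsto_riemann_sum_abs {s : ℕ → ℝ} (hs : Tendsto s atTop atTop) {φ : ℝ → ℝ}
    (hφ : ContinuousOn φ (Set.Ioi 0)) (Y : ℝ) :
    Tendsto (fun N => (∑ n ∈ Finset.Icc 1 ⌈Y * s N⌉₊,
      if s N < n ∧ n ≤ Y * s N then |φ (n / s N)| else 0) / s N) atTop
      (𝓝 (∫ x in Set.Ioc 1 Y, |φ x|)) := by
  have hset : Set.Ioc 1 Y = Set.Ioi 0 ∩ Set.Ioc 1 Y := by
    rw [Set.inter_eq_right.2]
    exact fun x hx => lt_trans one_pos hx.1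
  rw [hset, ← setIntegral_indicator measurableSet_Ioc]
  obtain ⟨B, hB⟩ := (isCompact_Icc (a := 1) (b := Y)).exists_bound_of_continuousOn
    (hφ.mono fun x hx => lt_of_lt_of_le one_pos hx.1)
  apply tendsto_riemann_sum hs (B := |B|) (R := Y)
  · exact Eventually.of_forall fun N => Nat.le_ceil _
  · filter_upwards [hs.eventually_gt_atTop 0] with N hN n
    split_ifs with h1
    · rw [abs_abs]
      refine (hB _ ⟨?_, ?_⟩).trans (le_abs_self B)
      · rw [le_div_iff₀ hN]; linarith
      · rw [div_le_iff₀ hN]; linarith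
    · simp
  · refine Eventually.of_forall fun N n hn => ?_
    rw [if_neg]
    rintro ⟨_, h2⟩
    linarith
  · have hne : ∀ᵐ x : ℝ, x ≠ 1 ∧ x ≠ Y := by
      rw [ae_iff]
      refine measure_mono_null (t := {1, Y}) ?_ ((Set.toFinite _).measure_zero _)
      intro x hx
      simp only [Set.mem_ofPred_eq] at hx
      simp only [Set.mem_insert_iff, Set.mem_singleton_iff]
      tauto
    filter_upwards [hne] with x hx hx0 n hn
    have h2 : Tendsto (fun N => |φ (n N / s N)|) atTop (𝓝 |φ x|) :=
      (((hφ.continuousAt (Ioi_mem_nhds hx0)).tendsto).comp hn).abs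
    by_cases h : x ∈ Set.Ioc 1 Y
    · rw [Set.indicator_of_mem h]
      refine h2.congr' ?_
      filter_upwards [hn.eventually_const_lt h.1, hn.eventually_lt_const (lt_of_le_of_ne h.2 hx.2),
        hs.eventually_gt_atTop 0] with N h3 h4 h5
      rw [lt_div_iff₀ h5] at h3
      rw [div_lt_iff₀ h5] at h4
      rw [if_pos ⟨by linarith, by linarith⟩]
    · rw [Set.indicator_of_notMem h]
      apply tendsto_const_nhds.congr'
      rw [Set.mem_Ioc, not_and_or] at h
      rcases h with h | h
      · push Not at h
        filter_upwards [hn.eventually_lt_const (lt_of_le_of_ne h hx.1),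
          hs.eventually_gt_atTop 0] with N h3 h5
        rw [div_lt_iff₀ h5] at h3
        rw [if_neg]
        rintro ⟨h6, _⟩
        linarith
      · push Not at h
        filter_upwards [hn.eventually_const_lt h, hs.eventually_gt_atTop 0] with N h3 h5
        rw [lt_div_iff₀ h5] at h3
        rw [if_neg]
        rintro ⟨_, h6⟩
        linarith

namespace EdgeAsymptotics

variable {μ : ℕ → Measure ℝ} {s : ℕ → ℝ} {φR φL : ℝ → ℝ} {ε : ℕ → ℕ → ℝ}

/-- Since `U_n` has parity `n`, the map `α ↦ -α` multiplies the coefficients by `(-1)^n`, which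
exchanges the two profiles. Statements at the left edge reduce to the right edge. -/
lemma reflect (h : EdgeAsymptotics μ s φR φL ε) :
    EdgeAsymptotics (fun N => (μ N).map Neg.neg) s φL φR (fun N n => (-1) ^ n * ε N n) := by
  have hme : MeasurableEmbedding (Neg.neg : ℝ → ℝ) := (MeasurableEquiv.neg ℝ).measurableEmbedding
  have hU : ∀ (n : ℕ) (α : ℝ), (Polynomial.Chebyshev.U ℝ (n : ℤ)).eval (-α) =
      (-1) ^ n * (Polynomial.Chebyshev.U ℝ (n : ℤ)).eval α := by
    intro n α
    rw [← chebU_succ_eq_eval, ← chebU_succ_eq_eval, chebU_neg]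
    ring
  have hsq : ∀ n : ℕ, ((-1 : ℝ) ^ n) * (-1) ^ n = 1 := fun n => by
    rw [← mul_pow]; norm_num
  refine ⟨fun N => ?_, fun N n => ?_, h.scale_pos, h.scale_tendsto, fun N n hn => ?_, ?_, ?_, ?_⟩
  · have := h.prob N
    exact Measure.isProbabilityMeasure_map measurable_neg.aemeasurable
  · rw [hme.integrable_map_iff]
    simp only [Function.comp_def, hU]
    exact (h.integrable N n).const_mul _
  · have := h.coeff N n hn
    rw [chebCoeff] at this ⊢
    rw [hme.integral_map]
    simp only [hU]
    rw [integral_const_mul, this]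
    linear_combination (n / s N ^ 3 * φL (n / s N)) * hsq n
  · obtain ⟨C, hC⟩ := h.error_sum
    exact ⟨C, fun N => by simpa [abs_mul] using hC N⟩
  · intro R η hη
    simpa [abs_mul] using h.error_small R η hη
  · obtain ⟨C, hC⟩ := h.riemann_sum
    refine ⟨C, fun N => (le_of_eq ?_).trans (hC N)⟩
    refine Finset.sum_congr rfl fun n _ => ?_
    have e : φL (n / s N) + (-1) ^ n * φR (n / s N) =
        (-1) ^ n * (φR (n / s N) + (-1) ^ n * φL (n / s N)) := by
      linear_combination (-φL (n / s N)) * hsq n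
    rw [e, abs_mul]
    simp

/-- Bound for the partial sums of the leading terms and of the error terms up to `Y * s N`. -/
lemma exists_sum_le (h : EdgeAsymptotics μ s φR φL ε) {δ : ℝ} (hδ : δ < 1)
    (hR : EdgeProfile δ φR) (hL : EdgeProfile δ φL) :
    ∃ C : ℝ, 0 ≤ C ∧ ∀ Y : ℝ, 1 ≤ Y → ∀ᶠ N in atTop, ∑ n ∈ Finset.Icc 1 ⌊Y * s N⌋₊,
      (|φR (n / s N) + (-1) ^ n * φL (n / s N)| / s N + |ε N n| / n) ≤
        C * Real.exp (Y ^ (2 - δ)) := by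
  obtain ⟨C1, hC1⟩ := h.error_sum
  obtain ⟨C2, hC2⟩ := h.riemann_sum
  have hs := h.scale_tendsto
  set KR := ∫ x in Set.Ioi 0, |φR x * Real.exp (-x ^ (2 - δ))| with hKR
  set KL := ∫ x in Set.Ioi 0, |φL x * Real.exp (-x ^ (2 - δ))| with hKL
  have hKR0 : 0 ≤ KR := by positivity
  have hKL0 : 0 ≤ KL := by positivity
  refine ⟨|C1| + |C2| + KR + KL + 3, by positivity, fun Y hY => ?_⟩
  obtain ⟨Q, hQ⟩ := exists_nat_ge Y
  have hY0 : 0 < Y := by linarith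
  have e1 : 1 ≤ Real.exp (Y ^ (2 - δ)) := Real.one_le_exp (by positivity)
  -- With errors at most `1/Y`, the at most `Y s` terms beyond `s` contribute `|ε|/n ≤ 1/(Y s)`
  -- each, hence at most `1` together.
  filter_upwards [h.error_small Q (1 / Y) (by positivity), hs.eventually_gt_atTop 0,
    (tendsto_riemann_sum_abs hs hR.continuousOn Y).eventually_le_const (u := _ + 1) (lt_add_one _),
    (tendsto_riemann_sum_abs hs hL.continuousOn Y).eventually_le_const (u := _ + 1) (lt_add_one _)]
    with N h1 h2 h3 h4
  have h5 := hR.setIntegral_abs_le hδ Y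
  have h6 := hL.setIntegral_abs_le hδ Y
  have h7 : ∀ n ∈ Finset.Icc 1 ⌊Y * s N⌋₊,
      |φR (n / s N) + (-1) ^ n * φL (n / s N)| / s N + |ε N n| / n ≤
      (if n ≤ ⌊s N⌋₊ then |φR (n / s N) + (-1) ^ n * φL (n / s N)| / s N else 0) +
      (if n ≤ ⌊s N⌋₊ then |ε N n| / n else 0) +
      (if s N < n ∧ n ≤ Y * s N then |φR (n / s N)| else 0) / s N +
      (if s N < n ∧ n ≤ Y * s N then |φL (n / s N)| else 0) / s N + 1 / (Y * s N) := by
    intro n hn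
    rw [Finset.mem_Icc] at hn
    have hn2 : (n : ℝ) ≤ Y * s N := (Nat.le_floor_iff (by positivity)).1 hn.2
    by_cases hns : n ≤ ⌊s N⌋₊
    · have hns' : (n : ℝ) ≤ s N := (Nat.le_floor_iff h2.le).1 hns
      have : ¬ (s N < n ∧ (n : ℝ) ≤ Y * s N) := fun hh => by linarith [hh.1]
      rw [if_pos hns, if_pos hns, if_neg this, if_neg this]
      have : 0 ≤ 1 / (Y * s N) := by positivity
      rw [zero_div]
      linarith
    · have hns' : s N < n := by
        by_contra hcon
        push Not at hcon
        exact hns (Nat.le_floor hcon)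
      rw [if_neg hns, if_neg hns, if_pos ⟨hns', hn2⟩, if_pos ⟨hns', hn2⟩]
      have k1 : |φR (n / s N) + (-1) ^ n * φL (n / s N)| ≤ |φR (n / s N)| + |φL (n / s N)| := by
        refine (abs_add_le _ _).trans ?_
        rw [abs_mul, abs_pow]
        simp
      have k2 : |ε N n| / n ≤ 1 / (Y * s N) := by
        calc |ε N n| / n ≤ (1 / Y) / s N := by
              gcongr
              exact h1 n hn.1 (by nlinarith)
          _ = _ := by rw [div_div]
      have k3 : |φR (n / s N) + (-1) ^ n * φL (n / s N)| / s N ≤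
          |φR (n / s N)| / s N + |φL (n / s N)| / s N := by
        rw [← add_div]; gcongr
      linarith
  refine (Finset.sum_le_sum h7).trans ?_
  simp only [Finset.sum_add_distrib]
  have b1 : ∑ n ∈ Finset.Icc 1 ⌊Y * s N⌋₊, (if n ≤ ⌊s N⌋₊ then
      |φR (n / s N) + (-1) ^ n * φL (n / s N)| / s N else 0) ≤ |C2| := by
    rw [← Finset.sum_filter]
    refine le_trans (Finset.sum_le_sum_of_subset_of_nonneg ?_ ?_) ((hC2 N).trans (le_abs_self C2))
    · intro n
      simp only [Finset.mem_filter, Finset.mem_Icc]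
      tauto
    · intros; positivity
  have b2 : ∑ n ∈ Finset.Icc 1 ⌊Y * s N⌋₊, (if n ≤ ⌊s N⌋₊ then |ε N n| / n else 0) ≤ |C1| := by
    rw [← Finset.sum_filter]
    refine le_trans (Finset.sum_le_sum_of_subset_of_nonneg ?_ ?_) ((hC1 N).trans (le_abs_self C1))
    · intro n
      simp only [Finset.mem_filter, Finset.mem_Icc]
      tauto
    · intros; positivity
  have b3 : ∀ φ : ℝ → ℝ, ∑ n ∈ Finset.Icc 1 ⌊Y * s N⌋₊,
      (if s N < n ∧ n ≤ Y * s N then |φ (n / s N)| else 0) / s N ≤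
      (∑ n ∈ Finset.Icc 1 ⌈Y * s N⌉₊,
        if s N < n ∧ n ≤ Y * s N then |φ (n / s N)| else 0) / s N := by
    intro φ
    rw [Finset.sum_div]
    apply Finset.sum_le_sum_of_subset_of_nonneg
    · exact Finset.Icc_subset_Icc_right (Nat.floor_le_ceil _)
    · intros
      apply div_nonneg _ h2.le
      split_ifs <;> positivity
  have b4 : ∑ n ∈ Finset.Icc 1 ⌊Y * s N⌋₊, 1 / (Y * s N) ≤ 1 := by
    rw [Finset.sum_const, Nat.card_Icc, nsmul_eq_mul, mul_one_div, div_le_one (by positivity)]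
    simpa using Nat.floor_le (by positivity : 0 ≤ Y * s N)
  have b5 := b3 φR
  have b6 := b3 φL
  have b7 := abs_nonneg C1
  have b8 := abs_nonneg C2
  nlinarith

/-- The basic moment bound, for a kernel of degree about `X * s N`. -/
lemma exists_fejer_le (h : EdgeAsymptotics μ s φR φL ε) {δ : ℝ} (hδ : δ < 1)
    (hR : EdgeProfile δ φR) (hL : EdgeProfile δ φL) :
    ∃ C : ℝ, 0 ≤ C ∧ ∀ X : ℝ, 0 < X → ∀ᶠ N in atTop,
      s N ^ 3 * ∫ α, (fejer (2 * ⌈X * s N⌉₊) α / (⌈X * s N⌉₊ : ℝ) ^ 3) ^ 2 ∂(μ N) ≤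
        C * ((1 + X ^ 2) / X ^ 3 * Real.exp ((12 * X + 1) ^ (2 - δ))) := by
  obtain ⟨C, hC0, hC⟩ := h.exists_sum_le hδ hR hL
  refine ⟨16 * (1 + 288 * C), by positivity, fun X hX => ?_⟩
  have hs := h.scale_tendsto
  -- The square involves indices below `6H`, where `6H ≤ 6Xs + 6 ≤ (12X + 1)s` once `s ≥ 6`. The
  -- condition `s ≥ 1/X` gives `Xs ≤ H ≤ 2Xs`.
  filter_upwards [hC (12 * X + 1) (by linarith), hs.eventually_ge_atTop 6,
    hs.eventually_ge_atTop (1 / X)] with N h1 h2 h3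
  have hsp : 0 < s N := by linarith
  set H := ⌈X * s N⌉₊ with hH
  have hXs : 1 ≤ X * s N := by rwa [div_le_iff₀' hX] at h3
  have g1 : X * s N ≤ H := Nat.le_ceil _
  have g2 : (H : ℝ) ≤ X * s N + 1 := (Nat.ceil_lt_add_one (by positivity)).le
  have g3 : (1 : ℝ) ≤ H := hXs.trans g1
  set E := Real.exp ((12 * X + 1) ^ (2 - δ)) with hE
  have hE1 : 1 ≤ E := Real.one_le_exp (by positivity)
  have key : ∑ n ∈ Finset.range (3 * (2 * H)), ((n : ℝ) + 1) * |∫ α, chebU (n + 1) α ∂(μ N)| ≤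
      1 + 72 * (H / s N) ^ 2 * (C * E) := by
    have hH1 : 1 ≤ H := by exact_mod_cast g3
    obtain ⟨k, hk⟩ := Nat.exists_eq_add_of_le' (show 1 ≤ 3 * (2 * H) by omega)
    -- The term with index `0` is the total mass, outside the scope of the coefficient formula; it
    -- accounts for the summand `1`.
    rw [hk, Finset.sum_range_succ', add_comm]
    rw [h.integral_chebU_one]
    have : ∑ j ∈ Finset.range k, (((j + 1 : ℕ) : ℝ) + 1) * |∫ α, chebU (j + 1 + 1) α ∂(μ N)| ≤
        72 * (H / s N) ^ 2 * ∑ n ∈ Finset.Icc 1 ⌊(12 * X + 1) * s N⌋₊,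
          (|φR (n / s N) + (-1) ^ n * φL (n / s N)| / s N + |ε N n| / n) := by
      rw [Finset.mul_sum, ← Finset.sum_image (s := Finset.range k) (g := fun j => j + 1)
        (f := fun n : ℕ => ((n : ℝ) + 1) * |∫ α, chebU (n + 1) α ∂(μ N)|)]
      · refine (Finset.sum_le_sum (g := fun n : ℕ => 72 * (H / s N) ^ 2 *
          (|φR (n / s N) + (-1) ^ n * φL (n / s N)| / s N + |ε N n| / n)) ?_).trans
          (Finset.sum_le_sum_of_subset_of_nonneg ?_ ?_)
        · intro n hn
          simp only [Finset.mem_image, Finset.mem_range] at hn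
          obtain ⟨j, hj, rfl⟩ := hn
          set n := j + 1
          have n1 : (1 : ℝ) ≤ n := by simp [n]
          have n2 : (n : ℝ) ≤ 6 * H := by exact_mod_cast (by omega)
          rw [h.integral_chebU_succ N n (by omega)]
          set F := φR (n / s N) + (-1) ^ n * φL (n / s N)
          have m1 : |(n : ℝ) / s N ^ 3 * F + ε N n / s N ^ 2| ≤
              n / s N ^ 3 * |F| + |ε N n| / s N ^ 2 := by
            refine (abs_add_le _ _).trans (le_of_eq ?_)
            rw [abs_mul, abs_div, abs_div, abs_of_pos (pow_pos hsp 3), abs_of_pos (pow_pos hsp 2),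
              Nat.abs_cast]
          have m2 : (n : ℝ) ^ 2 ≤ 36 * H ^ 2 := by nlinarith
          calc ((n : ℝ) + 1) * |(n : ℝ) / s N ^ 3 * F + ε N n / s N ^ 2|
              ≤ (2 * n) * (n / s N ^ 3 * |F| + |ε N n| / s N ^ 2) := by gcongr; linarith
            _ = 2 * (n : ℝ) ^ 2 / s N ^ 2 * (|F| / s N + |ε N n| / n) := by
                field_simp
            _ ≤ 2 * (36 * (H : ℝ) ^ 2) / s N ^ 2 * (|F| / s N + |ε N n| / n) := by gcongr
            _ = _ := by ring
        · intro n hn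
          simp only [Finset.mem_image, Finset.mem_range, Finset.mem_Icc] at hn ⊢
          obtain ⟨j, hj, rfl⟩ := hn
          refine ⟨by omega, Nat.le_floor ?_⟩
          have : ((j + 1 : ℕ) : ℝ) ≤ 6 * H := by exact_mod_cast (by omega)
          nlinarith
        · intros; positivity
      · intro a _ b _ hab
        exact Nat.add_right_cancel hab
    have h8 := this.trans (mul_le_mul_of_nonneg_left h1 (by positivity))
    simp only [Nat.cast_zero, zero_add, abs_one, mul_one]
    linarith
  have q1 := integral_fejer_sq_le (h.integrable_chebU N) (2 * H)
  have q2 : ∫ α, (fejer (2 * H) α / (H : ℝ) ^ 3) ^ 2 ∂(μ N) =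
      (∫ α, fejer (2 * H) α ^ 2 ∂(μ N)) / (H : ℝ) ^ 6 := by
    rw [← integral_div]
    congr 1; funext α; rw [div_pow]; ring
  rw [q2]
  have q3 : (H : ℝ) / s N ≤ 2 * X := by rw [div_le_iff₀ hsp]; linarith
  calc s N ^ 3 * ((∫ α, fejer (2 * H) α ^ 2 ∂(μ N)) / (H : ℝ) ^ 6)
      ≤ s N ^ 3 * ((2 * ((2 * H : ℕ) : ℝ) ^ 3 * (1 + 72 * (H / s N) ^ 2 * (C * E))) / (H : ℝ) ^ 6) := by
        gcongr
        exact q1.trans (mul_le_mul_of_nonneg_left key (by positivity))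
    _ = 16 * (s N / H) ^ 3 * (1 + 72 * (H / s N) ^ 2 * (C * E)) := by
        push_cast; field_simp; ring
    _ ≤ 16 * (1 / X) ^ 3 * (1 + 72 * (2 * X) ^ 2 * (C * E)) := by
        gcongr 16 * ?_ ^ 3 * (1 + 72 * ?_ ^ 2 * (C * E))
        rw [div_le_div_iff₀ (by positivity) hX]; linarith
    _ ≤ 16 * (1 / X) ^ 3 * ((1 + 288 * C) * (1 + X ^ 2) * E) := by
        gcongr
        have : 0 ≤ C * X ^ 2 := by positivity
        nlinarith [mul_nonneg hC0 (sub_nonneg.2 hE1), mul_nonneg (sq_nonneg X) (sub_nonneg.2 hE1),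
          mul_nonneg this (sub_nonneg.2 hE1)]
    _ = _ := by field_simp

end EdgeAsymptotics

/-! ### Scaling limit of the Chebyshev polynomials at the edge -/

/-- `edgeSin x t = sin (x √t) / √t`, as an entire function of `t`. -/
noncomputable def edgeSin (x t : ℝ) : ℝ := ∑' j : ℕ, (-t) ^ j * (x ^ (2 * j + 1) / (2 * j + 1).factorial)

lemma summable_pow_mul_odd (x t : ℝ) :
    Summable fun j : ℕ => |t| ^ j * (|x| ^ (2 * j + 1) / (2 * j + 1).factorial) := by
  have h := (Real.summable_pow_div_factorial (max |t| 1 * |x|)).comp_injective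
    (i := fun j : ℕ => 2 * j + 1) (fun a b h => by simpa using h)
  refine Summable.of_nonneg_of_le (fun j => by positivity) (fun j => ?_) h
  simp only [Function.comp]
  rw [mul_pow, mul_div_assoc]
  gcongr
  calc |t| ^ j ≤ (max |t| 1) ^ j := by gcongr; exact le_max_left _ _
    _ ≤ _ := pow_le_pow_right₀ (le_max_right _ _) (by omega)

/-- The binomial vanishes unless `j < n`, and then `n + j ≤ 2n`; this gives a summable majorant
independent of `n` and `s`. -/
lemma abs_chebU_div_le {s Λ t y : ℝ} (hs : 0 < s) (ht : |t| ≤ Λ) {n : ℕ} (hn : n / s ≤ y) (j : ℕ) :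
    |(-t) ^ j * (((n + j).choose (2 * j + 1) : ℝ) / s ^ (2 * j + 1))| ≤
      |Λ| ^ j * (|2 * y| ^ (2 * j + 1) / (2 * j + 1).factorial) := by
  rcases le_or_gt n j with hj | hj
  · rw [Nat.choose_eq_zero_of_lt (by omega)]
    simp only [Nat.cast_zero, zero_div, mul_zero, abs_zero]
    positivity
  · rw [abs_mul, abs_pow, abs_neg, abs_of_nonneg (by positivity : 0 ≤ ((n + j).choose (2 * j + 1) : ℝ) / s ^ (2 * j + 1))]
    have hΛ : |t| ≤ |Λ| := ht.trans (le_abs_self _)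
    refine mul_le_mul (pow_le_pow_left₀ (abs_nonneg _) hΛ j) ?_ (by positivity) (by positivity)
    have h1 : ((n + j).choose (2 * j + 1) : ℝ) ≤ ((n + j : ℕ) : ℝ) ^ (2 * j + 1) / (2 * j + 1).factorial :=
      Nat.choose_le_pow_div _ _
    have h2 : ((n + j : ℕ) : ℝ) ≤ 2 * n := by exact_mod_cast (by omega)
    calc ((n + j).choose (2 * j + 1) : ℝ) / s ^ (2 * j + 1)
        ≤ (((n + j : ℕ) : ℝ) ^ (2 * j + 1) / (2 * j + 1).factorial) / s ^ (2 * j + 1) := by gcongr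
      _ = (((n + j : ℕ) : ℝ) / s) ^ (2 * j + 1) / (2 * j + 1).factorial := by
          rw [div_pow]; field_simp
      _ ≤ _ := by
          gcongr
          refine le_trans ?_ (le_abs_self _)
          calc ((n + j : ℕ) : ℝ) / s ≤ 2 * n / s := by gcongr
            _ = 2 * (n / s) := by ring
            _ ≤ _ := by gcongr

lemma chebU_div_eq_tsum {s : ℝ} (hs : 0 < s) (t : ℝ) (n : ℕ) :
    chebU n (1 - t / (2 * s ^ 2)) / s =
      ∑' j : ℕ, (-t) ^ j * (((n + j).choose (2 * j + 1) : ℝ) / s ^ (2 * j + 1)) := by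
  have e : 1 - t / (2 * s ^ 2) = 1 - (t / s ^ 2) / 2 := by field_simp
  rw [e, chebU_one_sub_half n n le_rfl, tsum_eq_sum (s := Finset.range n), Finset.sum_div]
  · refine Finset.sum_congr rfl fun j _ => ?_
    have : s ^ (2 * j + 1) = (s ^ 2) ^ j * s := by rw [pow_succ, pow_mul]
    rw [neg_div', div_pow, this]
    field_simp
  · intro j hj
    have hj' : n ≤ j := by simpa using hj
    rw [Nat.choose_eq_zero_of_lt (by omega)]
    simp

lemma abs_chebU_div_le_tsum {s Λ t y : ℝ} (hs : 0 < s) (ht : |t| ≤ Λ) {n : ℕ} (hn : n / s ≤ y) :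
    |chebU n (1 - t / (2 * s ^ 2)) / s| ≤
      ∑' j : ℕ, |Λ| ^ j * (|2 * y| ^ (2 * j + 1) / (2 * j + 1).factorial) := by
  rw [chebU_div_eq_tsum hs]
  exact tsum_of_norm_bounded (summable_pow_mul_odd (2 * y) Λ).hasSum
    fun j => by rw [Real.norm_eq_abs]; exact abs_chebU_div_le hs ht hn j

lemma tendsto_choose_div {ι : Type*} {l : Filter ι} {s : ι → ℝ} (hs : Tendsto s l atTop) {x : ℝ}
    {n : ι → ℕ} (hn : Tendsto (fun i => n i / s i) l (𝓝 x)) (j : ℕ) :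
    Tendsto (fun i => ((n i + j).choose (2 * j + 1) : ℝ) / s i ^ (2 * j + 1)) l
      (𝓝 (x ^ (2 * j + 1) / (2 * j + 1).factorial)) := by
  have h1 : ∀ k : ℕ, Tendsto (fun i => ((n i + j - k : ℕ) : ℝ) / s i) l (𝓝 x) := by
    intro k
    have h2 : Tendsto (fun i => (((n i + j - k : ℕ) : ℝ) - n i) / s i) l (𝓝 0) := by
      apply squeeze_zero_norm' (a := fun i => ((j : ℝ) + k) / s i)
      · filter_upwards [hs.eventually_gt_atTop 0] with i hi
        rw [Real.norm_eq_abs, abs_div, abs_of_pos hi]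
        gcongr
        have a1 : n i + j - k ≤ n i + j := by omega
        have a2 : n i ≤ n i + j - k + k := by omega
        have a1' : ((n i + j - k : ℕ) : ℝ) ≤ n i + j := by exact_mod_cast a1
        have a2' : (n i : ℝ) ≤ ((n i + j - k : ℕ) : ℝ) + k := by exact_mod_cast a2
        have a3 : (0 : ℝ) ≤ j := j.cast_nonneg
        have a4 : (0 : ℝ) ≤ k := k.cast_nonneg
        rw [abs_le]; constructor <;> linarith
      · exact hs.const_div_atTop _
    have := h2.add hn
    rw [zero_add] at this
    exact this.congr fun i => by ring
  have h3 : Tendsto (fun i => ∏ k ∈ Finset.range (2 * j + 1), ((n i + j - k : ℕ) : ℝ) / s i) l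
      (𝓝 (∏ k ∈ Finset.range (2 * j + 1), x)) := tendsto_finsetProd _ fun k _ => h1 k
  rw [Finset.prod_const, Finset.card_range] at h3
  refine (h3.div_const _).congr fun i => ?_
  rw [Finset.prod_div_distrib, Finset.prod_const, Finset.card_range, ← Nat.cast_prod,
    ← Nat.descFactorial_eq_prod_range, Nat.descFactorial_eq_factorial_mul_choose]
  push_cast
  field_simp

/-- Dominated convergence in the expansion at the edge. The point `τ` may move, which later yields
locally uniform convergence. -/
lemma tendsto_chebU_div {ι : Type*} {l : Filter ι} {s : ι → ℝ} (hs : Tendsto s l atTop) {x t : ℝ}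
    {n : ι → ℕ} (hn : Tendsto (fun i => n i / s i) l (𝓝 x)) {τ : ι → ℝ} (hτ : Tendsto τ l (𝓝 t)) :
    Tendsto (fun i => chebU (n i) (1 - τ i / (2 * s i ^ 2)) / s i) l (𝓝 (edgeSin x t)) := by
  have h1 : Tendsto (fun i => ∑' j : ℕ, (-τ i) ^ j *
      (((n i + j).choose (2 * j + 1) : ℝ) / s i ^ (2 * j + 1))) l (𝓝 (edgeSin x t)) := by
    apply tendsto_tsum_of_dominated_convergence (summable_pow_mul_odd (2 * (x + 1)) (|t| + 1))
    · intro j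
      exact (hτ.neg.pow j).mul (tendsto_choose_div hs hn j)
    · filter_upwards [hs.eventually_gt_atTop 0, hn.eventually_le_const (lt_add_one x),
        hτ.abs.eventually_le_const (lt_add_one |t|)] with i h1 h2 h3 j
      exact abs_chebU_div_le h1 h3 h2 j
  refine h1.congr' ?_
  filter_upwards [hs.eventually_gt_atTop 0] with i h1
  rw [chebU_div_eq_tsum h1]

lemma edgeSin_sq_mul (x k : ℝ) : edgeSin x (k ^ 2) * k = Real.sin (k * x) := by
  rw [edgeSin, ← tsum_mul_right]
  rw [← (Real.hasSum_sin (k * x)).tsum_eq]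
  refine tsum_congr fun j => ?_
  rw [mul_pow, neg_pow, ← pow_mul]
  ring

lemma edgeSin_neg_sq_mul (x k : ℝ) : edgeSin x (-k ^ 2) * k = Real.sinh (k * x) := by
  rw [edgeSin, ← tsum_mul_right]
  rw [← (Real.hasSum_sinh (k * x)).tsum_eq]
  refine tsum_congr fun j => ?_
  rw [mul_pow, neg_neg, ← pow_mul]
  ring

lemma edgeSin_zero (x : ℝ) : edgeSin x 0 = x := by
  rw [edgeSin, tsum_eq_single 0]
  · simp
  · intro j hj
    simp [hj]

lemma edgeSin_of_pos (x : ℝ) {k : ℝ} (hk : 0 < k) : edgeSin x (k ^ 2) = Real.sin (k * x) / k := by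
  rw [eq_div_iff hk.ne', edgeSin_sq_mul]

lemma edgeSin_of_neg (x : ℝ) {k : ℝ} (hk : 0 < k) : edgeSin x (-k ^ 2) = Real.sinh (k * x) / k := by
  rw [eq_div_iff hk.ne', edgeSin_neg_sq_mul]

/-! ### Polynomials attached to a test function and their limit -/

/-- The polynomial in `t` attached to a test function `a` and a scale `s`. -/
noncomputable def edgePoly (a : ℝ → ℝ) (s : ℝ) (m : ℕ) (t : ℝ) : ℝ :=
  (∑ n ∈ Finset.Icc 1 m, a (n / s) * chebU n (1 - t / (2 * s ^ 2))) / s ^ 2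

/-- The limit of `edgePoly`. -/
noncomputable def edgeTransform (a : ℝ → ℝ) (t : ℝ) : ℝ := ∫ x in Set.Ioi 0, a x * edgeSin x t

/-- Convergence along `atTop ×ˢ 𝓝 t` is continuous convergence: it contains both the continuity of
the limit and uniformity on compact sets. -/
lemma tendsto_edgePoly {a : ℝ → ℝ} {R : ℝ} (ha : EdgeTest a R) {s : ℕ → ℝ}
    (hs : Tendsto s atTop atTop) (t : ℝ) :
    Tendsto (fun p : ℕ × ℝ => edgePoly a (s p.1) (⌈R * s p.1⌉₊ + 2) p.2) (atTop ×ˢ 𝓝 t)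
      (𝓝 (edgeTransform a t)) := by
  have hs' : Tendsto (fun p : ℕ × ℝ => s p.1) (atTop ×ˢ 𝓝 t) atTop := hs.comp tendsto_fst
  have ht : Tendsto (fun p : ℕ × ℝ => p.2) ((atTop : Filter ℕ) ×ˢ 𝓝 t) (𝓝 t) := tendsto_snd
  obtain ⟨A, hA0, hA⟩ := ha.exists_bound
  have hz : ∀ᶠ p : ℕ × ℝ in atTop ×ˢ 𝓝 t, ∀ n : ℕ, R * s p.1 < n → a (n / s p.1) = 0 := by
    filter_upwards [hs'.eventually_gt_atTop 0] with p h1 n hn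
    apply ha.eq_zero
    rw [le_div_iff₀ h1]
    exact hn.le
  have key := tendsto_riemann_sum hs' (R := R) (m := fun p => ⌈R * s p.1⌉₊ + 2)
    (f := fun p n => a (n / s p.1) * (chebU n (1 - p.2 / (2 * s p.1 ^ 2)) / s p.1))
    (H := fun x => a x * edgeSin x t)
    (B := A * ∑' j : ℕ, |(|t| + 1)| ^ j * (|2 * R| ^ (2 * j + 1) / (2 * j + 1).factorial))
    ?_ ?_ ?_ ?_
  · refine key.congr' ?_
    filter_upwards [hs'.eventually_gt_atTop 0] with p h1
    rw [edgePoly, Finset.sum_div, Finset.sum_div]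
    refine Finset.sum_congr rfl fun n _ => ?_
    field_simp
  · refine Eventually.of_forall fun p => ?_
    push_cast
    linarith [Nat.le_ceil (R * s p.1)]
  · filter_upwards [hz, hs'.eventually_gt_atTop 0,
      ht.abs.eventually_le_const (lt_add_one |t|)] with p h1 h2 h3 n
    by_cases hn : R * s p.1 < n
    · rw [h1 n hn, zero_mul, abs_zero]
      exact mul_nonneg hA0 (tsum_nonneg fun j => by positivity)
    · push Not at hn
      rw [abs_mul]
      have := abs_chebU_div_le_tsum h2 h3 (n := n) (y := R) (by rwa [div_le_iff₀ h2])
      exact mul_le_mul (hA _) this (abs_nonneg _) hA0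
  · filter_upwards [hz] with p h1 n hn
    rw [h1 n hn, zero_mul]
  · refine Eventually.of_forall fun x hx n hn => ?_
    exact ((ha.continuous.tendsto x).comp hn).mul (tendsto_chebU_div hs' hn ht)

/-! ### Summation by parts and pointwise bounds -/

/-- Symmetric second difference. -/
noncomputable def secondDiff (h : ℝ) (f : ℝ → ℝ) (x : ℝ) : ℝ := f (x + h) - 2 * f x + f (x - h)

lemma abs_secondDiff_le {f : ℝ → ℝ} (hf : ContDiff ℝ 2 f) {B : ℝ}
    (hB : ∀ x, |deriv (deriv f) x| ≤ B) {h : ℝ} (hh : 0 ≤ h) (x : ℝ) :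
    |secondDiff h f x| ≤ 2 * B * h ^ 2 := by
  have hf1 : Differentiable ℝ f := hf.differentiable (by norm_num)
  have hf2 : ContDiff ℝ 1 (deriv f) := (contDiff_succ_iff_deriv (n := 1)).1 (by simpa using! hf) |>.2.2
  have hf3 : Differentiable ℝ (deriv f) := hf2.differentiable (by norm_num)
  have h1 : ∀ y z, |deriv f y - deriv f z| ≤ B * |y - z| := fun y z =>
    convex_univ.norm_image_sub_le_of_norm_deriv_le (fun w _ => hf3 w) (fun w _ => hB w)
      (Set.mem_univ z) (Set.mem_univ y)
  have h2 : ∀ t, HasDerivAt (fun t => f (x + t) + f (x - t)) (deriv f (x + t) - deriv f (x - t)) t := by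
    intro t
    have e1 := (hf1 (x + t)).hasDerivAt.comp_const_add x t
    have e2 := (hf1 (x - t)).hasDerivAt.comp_const_sub x t
    simpa [sub_eq_add_neg] using! e1.add e2
  have hB0 : 0 ≤ B := (abs_nonneg _).trans (hB 0)
  have h3 := (convex_Icc 0 h).norm_image_sub_le_of_norm_hasDerivWithin_le (C := B * (2 * h))
    (fun t _ => (h2 t).hasDerivWithinAt) (fun t ht => ?_) (Set.left_mem_Icc.2 hh)
    (Set.right_mem_Icc.2 hh)
  · simp only [add_zero, sub_zero, Real.norm_eq_abs, abs_of_nonneg hh] at h3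
    rw [secondDiff]
    refine (le_of_eq ?_).trans (h3.trans (le_of_eq ?_))
    · congr 1; ring
    · ring
  · refine (h1 _ _).trans ?_
    gcongr
    rw [show x + t - (x - t) = 2 * t by ring, abs_of_nonneg (by linarith [ht.1])]
    linarith [ht.2]

lemma deriv_secondDiff {f : ℝ → ℝ} (hf : Differentiable ℝ f) (h : ℝ) :
    deriv (secondDiff h f) = secondDiff h (deriv f) := by
  funext x
  have e1 := (hf (x + h)).hasDerivAt.comp_add_const x h
  have e2 := (hf (x - h)).hasDerivAt.comp_sub_const x h
  exact ((e1.sub ((hf x).hasDerivAt.const_mul 2)).add e2).deriv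

lemma EdgeTest.exists_deriv_bound {a : ℝ → ℝ} {R : ℝ} (ha : EdgeTest a R) :
    ∃ B, 0 ≤ B ∧ ∀ h, 0 ≤ h → ∀ x, |secondDiff h (secondDiff h a) x| ≤ B * h ^ 4 := by
  have c0 := ha.contDiff
  have c1 : ContDiff ℝ 3 (deriv a) := ((contDiff_succ_iff_deriv (n := 3)).1 (by simpa using! c0)).2.2
  have c2 : ContDiff ℝ 2 (deriv (deriv a)) :=
    ((contDiff_succ_iff_deriv (n := 2)).1 (by simpa using! c1)).2.2
  have c3 : ContDiff ℝ 1 (deriv (deriv (deriv a))) :=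
    ((contDiff_succ_iff_deriv (n := 1)).1 (by simpa using! c2)).2.2
  have c4 : Continuous (deriv (deriv (deriv (deriv a)))) := c3.continuous_deriv (by norm_num)
  have cs := ha.hasCompactSupport.deriv.deriv.deriv.deriv
  obtain ⟨B, hB⟩ := c4.bounded_above_of_compact_support cs
  refine ⟨4 * B, by linarith [(norm_nonneg _).trans (hB 0)], fun h hh x => ?_⟩
  have e1 : ∀ y, |secondDiff h (deriv (deriv a)) y| ≤ 2 * B * h ^ 2 := abs_secondDiff_le c2 hB hh
  have e2 : deriv (deriv (secondDiff h a)) = secondDiff h (deriv (deriv a)) := by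
    rw [deriv_secondDiff (c0.differentiable (by norm_num)),
      deriv_secondDiff (c1.differentiable (by norm_num))]
  have e3 : ContDiff ℝ 2 (secondDiff h a) := by
    have : ContDiff ℝ 2 a := c0.of_le (by norm_num)
    unfold secondDiff
    fun_prop
  have := abs_secondDiff_le e3 (B := 2 * B * h ^ 2) (by rw [e2]; exact e1) hh x
  refine this.trans (le_of_eq (by ring))

/-- Multiplication by `2 - 2α` is minus the second difference in the index; summation by parts moves
it onto the coefficients. -/
lemma two_sub_mul_sum (a : ℝ → ℝ) (h0 : a 0 = 0) (h α : ℝ) (m : ℕ) :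
    (2 - 2 * α) * ∑ n ∈ Finset.Icc 1 m, a (n * h) * chebU n α =
      -(∑ n ∈ Finset.Icc 1 m, secondDiff h a (n * h) * chebU n α) +
        a ((m + 1) * h) * chebU m α - a (m * h) * chebU (m + 1) α := by
  induction m with
  | zero => simp [h0]
  | succ m ih =>
    rw [Finset.sum_Icc_succ_top (by omega), Finset.sum_Icc_succ_top (by omega), mul_add, ih,
      secondDiff]
    have e1 : ((m + 1 : ℕ) : ℝ) * h + h = ((m + 1 : ℕ) + 1) * h := by push_cast; ring
    have e2 : ((m + 1 : ℕ) : ℝ) * h - h = m * h := by push_cast; ring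
    rw [e1, e2]
    push_cast
    linear_combination a ((m + 1) * h) * two_sub_mul_chebU m α

/-- Two summations by parts. At `0` the boundary terms vanish because both `a` and its second
difference are zero there by oddness; at the other end because `a` vanishes from `(m - 2)h` on.
Since `2 - 2α = t/s²` at the edge, this is where the decay `1/t²` comes from. -/
lemma EdgeTest.sq_mul_sum {a : ℝ → ℝ} {R : ℝ} (ha : EdgeTest a R) {h : ℝ} (hh : 0 ≤ h) (α : ℝ)
    {m : ℕ} (hm : R + 2 * h ≤ m * h) :
    (2 - 2 * α) ^ 2 * ∑ n ∈ Finset.Icc 1 m, a (n * h) * chebU n α =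
      ∑ n ∈ Finset.Icc 1 m, secondDiff h (secondDiff h a) (n * h) * chebU n α := by
  have z : ∀ x, R ≤ x → a x = 0 := ha.eq_zero
  rw [sq, mul_assoc, two_sub_mul_sum a ha.zero, z (m * h) (by linarith),
    z ((m + 1) * h) (by nlinarith), zero_mul, zero_mul, add_zero, sub_zero, mul_neg,
    two_sub_mul_sum (secondDiff h a)]
  · have z1 : secondDiff h a (m * h) = 0 := by
      rw [secondDiff, z _ (by linarith), z _ (by linarith), z _ (by linarith)]; ring
    have z2 : secondDiff h a ((m + 1) * h) = 0 := by
      rw [secondDiff, z _ (by linarith), z _ (by linarith), z _ (by linarith)]; ring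
    rw [z1, z2]; ring
  · rw [secondDiff, ha.zero, zero_add, zero_sub, ha.odd]; ring

/-- Pointwise bounds for `edgePoly`: in the bulk, to the left of both edges, and at the edge. -/
lemma EdgeTest.exists_edgePoly_le {a : ℝ → ℝ} {R : ℝ} (ha : EdgeTest a R) :
    ∃ C, 0 ≤ C ∧ ∀ s, 1 ≤ s →
      (∀ t, 0 ≤ t → t ≤ 4 * s ^ 2 → |edgePoly a s (⌈R * s⌉₊ + 2) t| ≤ C) ∧
      (∀ t, 0 < t → t ≤ 4 * s ^ 2 → |edgePoly a s (⌈R * s⌉₊ + 2) t| ≤ C / t ^ 2) ∧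
      (∀ t, t ≤ 0 → |edgePoly a s (⌈R * s⌉₊ + 2) t| ≤
        C * (chebU (⌈(R + 3) * s⌉₊) (1 - t / (2 * s ^ 2)) / (2 * ⌈(R + 3) * s⌉₊))) ∧
      (∀ t, 4 * s ^ 2 ≤ t → |edgePoly a s (⌈R * s⌉₊ + 2) t| ≤
        C / s ^ 4 * (chebU (⌈(R + 3) * s⌉₊) (-(1 - t / (2 * s ^ 2))) / (2 * ⌈(R + 3) * s⌉₊))) := by
  obtain ⟨A, hA0, hA⟩ := ha.exists_bound
  obtain ⟨B, hB0, hB⟩ := ha.exists_deriv_bound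
  have hR := ha.pos
  -- One factor `R + 3` counts the terms, as `m ≤ (R + 3)s`; the other and the `4` come from
  -- replacing `1/s` by `1/(2h)`, as `h ≤ 2(R + 3)s`. Since `m ≤ h`, monotonicity in the index
  -- bounds all terms by `chebU h` outside `[-1, 1]`.
  set K := (A + B) * (R + 3) ^ 2 * 4 with hK
  refine ⟨K, by positivity, fun s hs => ?_⟩
  have hs0 : 0 < s := by linarith
  set m := ⌈R * s⌉₊ + 2 with hm
  set h := ⌈(R + 3) * s⌉₊ with hh
  have m1 : R * s + 2 ≤ m := by
    rw [hm]; push_cast; linarith [Nat.le_ceil (R * s)]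
  have m2 : (m : ℝ) ≤ (R + 3) * s := by
    rw [hm]; push_cast
    linarith [Nat.ceil_lt_add_one (show 0 ≤ R * s by positivity)]
  have h1 : (R + 3) * s ≤ h := Nat.le_ceil _
  have h2 : (h : ℝ) ≤ 2 * ((R + 3) * s) := by
    have := Nat.ceil_lt_add_one (show 0 ≤ (R + 3) * s by positivity)
    nlinarith
  have hmh : m ≤ h := by exact_mod_cast m2.trans h1
  have hp : 0 < (h : ℝ) := lt_of_lt_of_le (by positivity) h1
  have gen1 : ∀ t W, (∀ n ∈ Finset.Icc 1 m, |chebU n (1 - t / (2 * s ^ 2))| ≤ W) → 0 ≤ W →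
      |edgePoly a s m t| ≤ A * (R + 3) * (W / s) := by
    intro t W hW hW0
    rw [edgePoly, abs_div, abs_of_pos (pow_pos hs0 2), div_le_iff₀ (by positivity)]
    calc _ ≤ ∑ n ∈ Finset.Icc 1 m, |a (n / s) * chebU n (1 - t / (2 * s ^ 2))| :=
          Finset.abs_sum_le_sum_abs _ _
      _ ≤ ∑ n ∈ Finset.Icc 1 m, A * W := by
          apply Finset.sum_le_sum
          intro n hn
          rw [abs_mul]
          exact mul_le_mul (hA _) (hW n hn) (abs_nonneg _) hA0
      _ = m * (A * W) := by simp
      _ ≤ ((R + 3) * s) * (A * W) := by gcongr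
      _ = _ := by field_simp
  have gen2 : ∀ t W, (∀ n ∈ Finset.Icc 1 m, |chebU n (1 - t / (2 * s ^ 2))| ≤ W) → 0 ≤ W →
      t ^ 2 * |edgePoly a s m t| ≤ B * (R + 3) * (W / s) := by
    intro t W hW hW0
    have e := ha.sq_mul_sum (h := 1 / s) (by positivity) (1 - t / (2 * s ^ 2)) (m := m) (by
      rw [← mul_le_mul_iff_left₀ hs0]; field_simp; linarith)
    simp only [mul_one_div] at e
    have e2 : t ^ 2 * edgePoly a s m t = s ^ 2 * ((2 - 2 * (1 - t / (2 * s ^ 2))) ^ 2 *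
        ∑ n ∈ Finset.Icc 1 m, a (n / s) * chebU n (1 - t / (2 * s ^ 2))) := by
      rw [edgePoly]
      field_simp
      ring
    rw [← abs_of_nonneg (sq_nonneg t), ← abs_mul, e2, e, abs_mul, abs_of_nonneg (sq_nonneg s)]
    calc _ ≤ s ^ 2 * ∑ n ∈ Finset.Icc 1 m, |secondDiff (1 / s) (secondDiff (1 / s) a) (n / s) *
            chebU n (1 - t / (2 * s ^ 2))| := by
          gcongr
          exact Finset.abs_sum_le_sum_abs _ _
      _ ≤ s ^ 2 * ∑ n ∈ Finset.Icc 1 m, B * (1 / s) ^ 4 * W := by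
          gcongr with n hn
          rw [abs_mul]
          exact mul_le_mul (hB _ (by positivity) _) (hW n hn) (abs_nonneg _) (by positivity)
      _ = s ^ 2 * (m * (B * (1 / s) ^ 4 * W)) := by simp
      _ ≤ s ^ 2 * (((R + 3) * s) * (B * (1 / s) ^ 4 * W)) := by gcongr
      _ = _ := by field_simp
  have bulk : ∀ t, 0 ≤ t → t ≤ 4 * s ^ 2 → ∀ n ∈ Finset.Icc 1 m,
      |chebU n (1 - t / (2 * s ^ 2))| ≤ (R + 3) * s := by
    intro t ht0 ht n hn
    have hn' : (n : ℝ) ≤ m := by exact_mod_cast (Finset.mem_Icc.1 hn).2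
    refine (abs_chebU_le ?_ n).trans (hn'.trans m2)
    have : t / (2 * s ^ 2) ≤ 2 := by rw [div_le_iff₀ (by positivity)]; linarith
    have : 0 ≤ t / (2 * s ^ 2) := by positivity
    rw [abs_le]; constructor <;> linarith
  refine ⟨fun t ht0 ht => ?_, fun t ht0 ht => ?_, fun t ht => ?_, fun t ht => ?_⟩
  · refine (gen1 t _ (bulk t ht0 ht) (by positivity)).trans ?_
    rw [hK]
    field_simp
    nlinarith
  · rw [le_div_iff₀ (by positivity), mul_comm]
    refine (gen2 t _ (bulk t ht0.le ht) (by positivity)).trans ?_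
    rw [hK]
    field_simp
    nlinarith
  · have hα : 1 ≤ 1 - t / (2 * s ^ 2) := by
      have : t / (2 * s ^ 2) ≤ 0 := div_nonpos_of_nonpos_of_nonneg ht (by positivity)
      linarith
    have hu := chebU_nonneg hα h
    refine (gen1 t (chebU h (1 - t / (2 * s ^ 2))) (fun n hn => ?_) hu).trans ?_
    · rw [abs_of_nonneg (chebU_nonneg hα n)]
      exact chebU_mono hα ((Finset.mem_Icc.1 hn).2.trans hmh)
    · set u := chebU h (1 - t / (2 * s ^ 2))
      have : u / s ≤ 4 * (R + 3) * (u / (2 * h)) := by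
        rw [← mul_div_assoc, div_le_div_iff₀ hs0 (by positivity)]
        nlinarith
      calc A * (R + 3) * (u / s) ≤ A * (R + 3) * (4 * (R + 3) * (u / (2 * h))) := by gcongr
        _ = A * (R + 3) ^ 2 * 4 * (u / (2 * h)) := by ring
        _ ≤ _ := by
          rw [hK]; gcongr; linarith
  · have hα : 1 ≤ -(1 - t / (2 * s ^ 2)) := by
      have : 2 ≤ t / (2 * s ^ 2) := by rw [le_div_iff₀ (by positivity)]; linarith
      linarith
    have hu := chebU_nonneg hα h
    have g := gen2 t (chebU h (-(1 - t / (2 * s ^ 2)))) (fun n hn => ?_) hu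
    · set u := chebU h (-(1 - t / (2 * s ^ 2)))
      have : u / s ≤ 4 * (R + 3) * (u / (2 * h)) := by
        rw [← mul_div_assoc, div_le_div_iff₀ hs0 (by positivity)]
        nlinarith
      have g2 : t ^ 2 * |edgePoly a s m t| ≤ K * (u / (2 * h)) := by
        calc _ ≤ B * (R + 3) * (4 * (R + 3) * (u / (2 * h))) := g.trans (by gcongr)
          _ = B * (R + 3) ^ 2 * 4 * (u / (2 * h)) := by ring
          _ ≤ _ := by
            rw [hK]; gcongr; linarith
      have g3 : s ^ 4 * |edgePoly a s m t| ≤ t ^ 2 * |edgePoly a s m t| := by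
        gcongr
        nlinarith [sq_nonneg s]
      rw [div_mul_eq_mul_div, le_div_iff₀ (by positivity), mul_comm]
      exact g3.trans g2
    · rw [abs_chebU_of_le_neg_one, abs_of_nonneg (chebU_nonneg hα n)]
      exact chebU_mono hα ((Finset.mem_Icc.1 hn).2.trans hmh)

/-! ### The rescaled measure -/

/-- The measure rescaled at the right edge, in the variable `t = 2 s² (1 - α)`. -/
noncomputable def edgeMeasure (μ : Measure ℝ) (s : ℝ) : Measure ℝ :=
  ENNReal.ofReal (s ^ 3) • μ.map (fun α => 2 * s ^ 2 * (1 - α))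

instance (μ : Measure ℝ) [IsFiniteMeasure μ] (s : ℝ) : IsFiniteMeasure (edgeMeasure μ s) := by
  unfold edgeMeasure
  have : IsFiniteMeasure (μ.map (fun α => 2 * s ^ 2 * (1 - α))) := inferInstance
  exact Measure.smul_finite _ ENNReal.ofReal_ne_top

section edgeMeasure

variable {μ : Measure ℝ} {s : ℝ}

lemma edgeMeasure_real (hs : 0 < s) {A : Set ℝ} (hA : MeasurableSet A) :
    (edgeMeasure μ s).real A = s ^ 3 * μ.real ((fun α => 2 * s ^ 2 * (1 - α)) ⁻¹' A) := by
  rw [edgeMeasure, measureReal_def, Measure.smul_apply, Measure.map_apply (by fun_prop) hA,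
    smul_eq_mul, ENNReal.toReal_mul, ENNReal.toReal_ofReal (by positivity), measureReal_def]

/-- The complement of a closed half-line is open, so the right edge leads to `Iio`, whereas the left
edge leads to `Iic`. The final squeeze accepts both. -/
lemma edgeRight_eq [IsProbabilityMeasure μ] (hs : 0 < s) (t : ℝ) :
    edgeRight μ s t = (edgeMeasure μ s).real (Set.Iio t) := by
  rw [edgeMeasure_real hs measurableSet_Iio, edgeRight, ← probReal_compl_eq_one_sub measurableSet_Iic]
  congr 2
  ext α
  simp only [Set.mem_compl_iff, Set.mem_Iic, not_le, Set.mem_preimage, Set.mem_Iio]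
  rw [sub_lt_comm, lt_div_iff₀ (by positivity)]
  constructor <;> intro h <;> linarith

lemma edgeLeft_eq (hs : 0 < s) (t : ℝ) :
    edgeLeft μ s t = (edgeMeasure (μ.map Neg.neg) s).real (Set.Iic t) := by
  rw [edgeMeasure_real hs measurableSet_Iic, edgeLeft, map_measureReal_apply measurable_neg
    (measurableSet_Iic.preimage (by fun_prop))]
  congr 2
  ext α
  simp only [Set.mem_Iic, Set.mem_preimage]
  rw [← sub_le_iff_le_add', le_div_iff₀ (by positivity)]
  constructor <;> intro h <;> linarith

lemma integrable_edgeMeasure (hs : 0 < s) {F : ℝ → ℝ} (hF : Integrable F μ) :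
    Integrable (fun t => F (1 - t / (2 * s ^ 2))) (edgeMeasure μ s) ∧
      ∫ t, F (1 - t / (2 * s ^ 2)) ∂(edgeMeasure μ s) = s ^ 3 * ∫ α, F α ∂μ := by
  have e : ∀ α, 1 - 2 * s ^ 2 * (1 - α) / (2 * s ^ 2) = α := fun α => by field_simp; ring
  have hme : MeasurableEmbedding (fun α : ℝ => 2 * s ^ 2 * (1 - α)) := by
    have h1 := ((Homeomorph.subLeft (1 : ℝ)).trans
      (Homeomorph.mulLeft₀ (2 * s ^ 2) (by positivity))).measurableEmbedding
    exact h1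
  constructor
  · refine Integrable.smul_measure ?_ ENNReal.ofReal_ne_top
    rw [hme.integrable_map_iff]
    simpa only [Function.comp_def, e] using hF
  · rw [edgeMeasure, integral_smul_measure, hme.integral_map,
      ENNReal.toReal_ofReal (by positivity)]
    simp only [e, smul_eq_mul]

lemma edgeMeasure_real_le [IsProbabilityMeasure μ] (hs : 0 < s) (A : Set ℝ) :
    (edgeMeasure μ s).real A ≤ s ^ 3 := by
  refine (measureReal_mono (Set.subset_univ A)).trans ?_
  rw [edgeMeasure_real hs MeasurableSet.univ]
  simp

/-- In the variable `t` the interval `[-1, 1]` is `[0, 4s²]`, and exchanging the edges is `t ↦ 4s² -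
t`. -/
lemma edgeMeasure_map_neg (μ : Measure ℝ) (s : ℝ) :
    edgeMeasure (μ.map Neg.neg) s = (edgeMeasure μ s).map (fun t => 4 * s ^ 2 - t) := by
  rw [edgeMeasure, edgeMeasure, Measure.map_smul, Measure.map_map (by fun_prop) (by fun_prop),
    Measure.map_map (by fun_prop) (by fun_prop)]
  congr 2
  funext α
  simp only [Function.comp]
  ring

end edgeMeasure

/-! ### Uniform bounds for the rescaled measures -/

lemma setIntegral_union_le {σ : Measure ℝ} {f : ℝ → ℝ} (h0 : ∀ x, 0 ≤ f x) {A B : Set ℝ}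
    (hA : IntegrableOn f A σ) (hB : IntegrableOn f B σ) :
    ∫ x in A ∪ B, f x ∂σ ≤ ∫ x in A, f x ∂σ + ∫ x in B, f x ∂σ := by
  rw [← integral_add_measure hA hB]
  exact integral_mono_measure (Measure.restrict_union_le A B) (Eventually.of_forall h0)
    (Integrable.add_measure hA hB)

namespace EdgeAsymptotics

variable {μ : ℕ → Measure ℝ} {s : ℕ → ℝ} {φR φL : ℝ → ℝ} {ε : ℕ → ℕ → ℝ}

lemma integrable_fejer (h : EdgeAsymptotics μ s φR φL ε) (N H : ℕ) :
    Integrable (fun t => (fejer (2 * H) (1 - t / (2 * s N ^ 2)) / (H : ℝ) ^ 3) ^ 2)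
      (edgeMeasure (μ N) (s N)) := by
  refine (integrable_edgeMeasure (h.scale_pos N)
    (F := fun α => (fejer (2 * H) α / (H : ℝ) ^ 3) ^ 2) ?_).1
  simp only [div_pow]
  exact (integrable_fejer_sq (h.integrable_chebU N) _).div_const _

lemma exists_fejer_edge_le (h : EdgeAsymptotics μ s φR φL ε) {δ : ℝ} (hδ : δ < 1)
    (hR : EdgeProfile δ φR) (hL : EdgeProfile δ φL) :
    ∃ C : ℝ, 0 ≤ C ∧ ∀ X : ℝ, 0 < X → ∀ᶠ N in atTop,
      ∫ t, (fejer (2 * ⌈X * s N⌉₊) (1 - t / (2 * s N ^ 2)) / (⌈X * s N⌉₊ : ℝ) ^ 3) ^ 2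
          ∂(edgeMeasure (μ N) (s N)) ≤
        C * ((1 + X ^ 2) / X ^ 3 * Real.exp ((12 * X + 1) ^ (2 - δ))) := by
  obtain ⟨C, hC0, hC⟩ := h.exists_fejer_le hδ hR hL
  refine ⟨C, hC0, fun X hX => ?_⟩
  filter_upwards [hC X hX] with N hN
  refine le_trans (le_of_eq ?_) hN
  refine (integrable_edgeMeasure (h.scale_pos N)
    (F := fun α => (fejer (2 * ⌈X * s N⌉₊) α / (⌈X * s N⌉₊ : ℝ) ^ 3) ^ 2) ?_).2
  simp only [div_pow]
  exact (integrable_fejer_sq (h.integrable_chebU N) _).div_const _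

lemma ceil_scale (h : EdgeAsymptotics μ s φR φL ε) {X : ℝ} (hX : 0 < X) :
    ∀ᶠ N in atTop, 1 ≤ ⌈X * s N⌉₊ ∧ X * s N ≤ ⌈X * s N⌉₊ ∧ (⌈X * s N⌉₊ : ℝ) ≤ 2 * X * s N := by
  filter_upwards [h.scale_tendsto.eventually_ge_atTop (1 / X)] with N h3
  have hXs : 1 ≤ X * s N := by rwa [div_le_iff₀' hX] at h3
  refine ⟨Nat.one_le_ceil_iff.2 (by linarith), Nat.le_ceil _, ?_⟩
  have := Nat.ceil_lt_add_one (show 0 ≤ X * s N by linarith)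
  linarith

lemma one_le_arg {s t : ℝ} (ht : t ≤ 0) : 1 ≤ 1 - t / (2 * s ^ 2) := by
  have : t / (2 * s ^ 2) ≤ 0 := div_nonpos_of_nonpos_of_nonneg ht (by positivity)
  linarith

lemma half_le_chebU_div {α : ℝ} (hα : 1 ≤ α) {H : ℕ} (hH : 1 ≤ H) :
    1 / 2 ≤ chebU H α / (2 * H) := by
  have hH' : (0 : ℝ) < H := by exact_mod_cast hH
  rw [div_le_div_iff₀ (by norm_num) (by positivity)]
  linarith [le_chebU hα H]

lemma chebU_div_le_fejer {α : ℝ} (hα : 1 ≤ α) {H : ℕ} (hH : 1 ≤ H) :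
    chebU H α / (2 * H) ≤ fejer (2 * H) α / (H : ℝ) ^ 3 := by
  have hH' : (0 : ℝ) < H := by exact_mod_cast hH
  rw [div_le_div_iff₀ (by positivity) (by positivity)]
  have := fejer_lower_of_one_le hα H
  nlinarith

lemma fejer_lower_edge {s t X : ℝ} (hs : 0 < s) {H : ℕ} (hH : 1 ≤ H)
    (hH2 : (H : ℝ) ≤ 2 * X * s) (ht : t ≤ 2 * s ^ 2) (ht0 : 0 < t) :
    2 / 5 / (1 + 4 * X ^ 2 * t) ≤ fejer (2 * H) (1 - t / (2 * s ^ 2)) / (H : ℝ) ^ 3 := by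
  have hH' : (0 : ℝ) < H := by exact_mod_cast hH
  have h1 : t / (2 * s ^ 2) ≤ 1 := by rw [div_le_one (by positivity)]; exact ht
  have h2 : 0 < t / (2 * s ^ 2) := by positivity
  have := fejer_lower (α := 1 - t / (2 * s ^ 2)) (by linarith) (by linarith) hH
  rw [le_div_iff₀ (by positivity)]
  refine le_trans ?_ this
  rw [div_mul_eq_mul_div]
  have e : (H : ℝ) ^ 2 * (2 - 2 * (1 - t / (2 * s ^ 2))) = (H / s) ^ 2 * t := by field_simp; ring
  rw [e]
  have h3 : (H / s) ^ 2 ≤ 4 * X ^ 2 := by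
    rw [show 4 * X ^ 2 = (2 * X) ^ 2 by ring]
    gcongr
    rw [div_le_iff₀ hs]; exact hH2
  gcongr

lemma exists_mass_le (h : EdgeAsymptotics μ s φR φL ε) {δ : ℝ} (hδ : δ < 1)
    (hR : EdgeProfile δ φR) (hL : EdgeProfile δ φL) (T : ℝ) :
    ∃ C, ∀ᶠ N in atTop, (edgeMeasure (μ N) (s N)).real (Set.Iic T) ≤ C := by
  wlog hT : 0 ≤ T generalizing T with H
  · obtain ⟨C, hC⟩ := H 0 le_rfl
    refine ⟨C, ?_⟩
    filter_upwards [hC] with N hN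
    have := h.prob N
    exact (measureReal_mono (Set.Iic_subset_Iic.2 (by linarith))).trans hN
  obtain ⟨C, hC0, hC⟩ := h.exists_fejer_edge_le hδ hR hL
  -- Lower bound for the kernel with `X = 1` on `(0, T]`; for `t ≤ 0` the kernel is at least `1/2`,
  -- which is larger.
  set c := 2 / 5 / (1 + 4 * 1 ^ 2 * T) with hc
  have hc0 : 0 < c := by positivity
  have hc1 : c ≤ 1 / 2 := by
    rw [hc, div_le_iff₀ (by positivity)]; linarith
  refine ⟨C * ((1 + 1 ^ 2) / 1 ^ 3 * Real.exp ((12 * 1 + 1) ^ (2 - δ))) / c ^ 2, ?_⟩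
  filter_upwards [hC 1 one_pos, h.ceil_scale one_pos,
    (tendsto_pow_atTop (two_ne_zero)).comp h.scale_tendsto |>.eventually_ge_atTop T] with N h1 h2 h3
  have := h.prob N
  have hs := h.scale_pos N
  set H := ⌈1 * s N⌉₊
  rw [le_div_iff₀ (by positivity)]
  refine le_trans ?_ h1
  have h4 : ∀ t ∈ Set.Iic T, c ^ 2 ≤ (fejer (2 * H) (1 - t / (2 * s N ^ 2)) / (H : ℝ) ^ 3) ^ 2 := by
    intro t ht
    rw [Set.mem_Iic] at ht
    simp only [Function.comp] at h3
    apply pow_le_pow_left₀ hc0.le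
    rcases le_or_gt t 0 with h5 | h5
    · exact hc1.trans ((half_le_chebU_div (one_le_arg h5) h2.1).trans
        (chebU_div_le_fejer (one_le_arg h5) h2.1))
    · refine le_trans ?_ (fejer_lower_edge hs h2.1 h2.2.2 (by nlinarith) h5)
      rw [hc]
      gcongr
  calc _ = ∫ t in Set.Iic T, c ^ 2 ∂(edgeMeasure (μ N) (s N)) := by simp
    _ ≤ ∫ t in Set.Iic T, (fejer (2 * H) (1 - t / (2 * s N ^ 2)) / (H : ℝ) ^ 3) ^ 2
          ∂(edgeMeasure (μ N) (s N)) :=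
        setIntegral_mono_on (integrable_const _) (h.integrable_fejer N H).integrableOn
          measurableSet_Iic h4
    _ ≤ _ := setIntegral_le_integral (h.integrable_fejer N H)
        (Eventually.of_forall fun t => sq_nonneg _)

/-- With `X = 1/√T` the normalised kernel is at least `(2/25) T/t` for `t > T`, so `1/t²` is at most
`T⁻²` times its square up to a constant. The square has integral of order `X⁻³ = T^(3/2)`, which
leaves `T^(-1/2)`. -/
lemma exists_right_tail_le (h : EdgeAsymptotics μ s φR φL ε) {δ : ℝ} (hδ : δ < 1)
    (hR : EdgeProfile δ φR) (hL : EdgeProfile δ φL) :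
    ∃ C, 0 ≤ C ∧ ∀ T, 1 ≤ T → ∀ᶠ N in atTop,
      IntegrableOn (fun t => 1 / t ^ 2) (Set.Ioc T (2 * s N ^ 2)) (edgeMeasure (μ N) (s N)) ∧
      ∫ t in Set.Ioc T (2 * s N ^ 2), 1 / t ^ 2 ∂(edgeMeasure (μ N) (s N)) ≤ C / √T := by
  obtain ⟨C, hC0, hC⟩ := h.exists_fejer_edge_le hδ hR hL
  set E := Real.exp ((12 * 1 + 1) ^ (2 - δ)) with hE
  refine ⟨C * 2 * E * (625 / 4), by positivity, fun T hT => ?_⟩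
  have hT0 : 0 < T := by linarith
  have hsT : 0 < √T := Real.sqrt_pos.2 hT0
  have hsT1 : 1 ≤ √T := Real.one_le_sqrt.2 hT
  have hsT2 : √T ^ 2 = T := Real.sq_sqrt hT0.le
  set X := 1 / √T with hXdef
  have hX : 0 < X := by positivity
  have hX1 : X ≤ 1 := by rw [hXdef, div_le_one hsT]; exact hsT1
  have hX2 : X ^ 2 = 1 / T := by rw [hXdef, div_pow, hsT2, one_pow]
  filter_upwards [hC X hX, h.ceil_scale hX] with N h1 h2
  have := h.prob N
  have hs := h.scale_pos N
  set H := ⌈X * s N⌉₊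
  have h4 : ∀ t ∈ Set.Ioc T (2 * s N ^ 2), 1 / t ^ 2 ≤ 625 / 4 / T ^ 2 *
      (fejer (2 * H) (1 - t / (2 * s N ^ 2)) / (H : ℝ) ^ 3) ^ 2 := by
    intro t ht
    have ht0 : 0 < t := hT0.trans ht.1
    have h5 := fejer_lower_edge hs h2.1 h2.2.2 ht.2 ht0
    have h6 : 2 / 25 * (T / t) ≤ 2 / 5 / (1 + 4 * X ^ 2 * t) := by
      rw [hX2, ← mul_div_assoc, div_le_div_iff₀ ht0 (by positivity)]
      have : 4 * (1 / T) * t = 4 * t / T := by ring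
      rw [this]
      have h7 : T * (4 * t / T) = 4 * t := by field_simp
      nlinarith [ht.1]
    have h8 := pow_le_pow_left₀ (by positivity) (h6.trans h5) 2
    calc 1 / t ^ 2 = 625 / 4 / T ^ 2 * (2 / 25 * (T / t)) ^ 2 := by field_simp; norm_num
      _ ≤ _ := by gcongr
  have hint := (h.integrable_fejer N H).const_mul (625 / 4 / T ^ 2)
  have hmeas : AEStronglyMeasurable (fun t : ℝ => 1 / t ^ 2)
      ((edgeMeasure (μ N) (s N)).restrict (Set.Ioc T (2 * s N ^ 2))) := by
    have : Measurable (fun t : ℝ => 1 / t ^ 2) := by fun_prop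
    exact this.aestronglyMeasurable
  have hi : IntegrableOn (fun t : ℝ => 1 / t ^ 2) (Set.Ioc T (2 * s N ^ 2))
      (edgeMeasure (μ N) (s N)) := by
    refine Integrable.mono' hint.integrableOn hmeas ?_
    filter_upwards [ae_restrict_mem measurableSet_Ioc] with t ht
    rw [Real.norm_eq_abs, abs_of_nonneg (by positivity)]
    exact h4 t ht
  refine ⟨hi, ?_⟩
  calc _ ≤ ∫ t in Set.Ioc T (2 * s N ^ 2), 625 / 4 / T ^ 2 *
        (fejer (2 * H) (1 - t / (2 * s N ^ 2)) / (H : ℝ) ^ 3) ^ 2 ∂(edgeMeasure (μ N) (s N)) :=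
        setIntegral_mono_on hi hint.integrableOn measurableSet_Ioc h4
    _ ≤ _ := setIntegral_le_integral hint (Eventually.of_forall fun t => by positivity)
    _ ≤ 625 / 4 / T ^ 2 * (C * ((1 + X ^ 2) / X ^ 3 * Real.exp ((12 * X + 1) ^ (2 - δ)))) := by
        rw [integral_const_mul]; gcongr
    _ ≤ 625 / 4 / T ^ 2 * (C * ((1 + 1 ^ 2) / X ^ 3 * E)) := by
        have : Real.exp ((12 * X + 1) ^ (2 - δ)) ≤ E := by
          rw [hE]
          apply Real.exp_le_exp.2
          apply Real.rpow_le_rpow (by positivity) (by linarith) (by linarith)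
        gcongr
    _ = _ := by
        have : X ^ 3 = 1 / (T * √T) := by rw [pow_succ, hX2, hXdef]; field_simp
        rw [this, ← hsT2]
        field_simp
        norm_num
        ring

/-- To the left of the edge the kernel dominates a single polynomial of half the degree; its square
controls integrands of exponential growth in `√(-t)`. -/
lemma exists_left_le (h : EdgeAsymptotics μ s φR φL ε) {δ : ℝ} (hδ : δ < 1)
    (hR : EdgeProfile δ φR) (hL : EdgeProfile δ φL) :
    ∃ C : ℝ, 0 ≤ C ∧ ∀ X : ℝ, 0 < X → ∀ᶠ N in atTop,
      IntegrableOn (fun t => (chebU ⌈X * s N⌉₊ (1 - t / (2 * s N ^ 2)) / (2 * ⌈X * s N⌉₊)) ^ 2)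
        (Set.Iic 0) (edgeMeasure (μ N) (s N)) ∧
      ∫ t in Set.Iic 0, (chebU ⌈X * s N⌉₊ (1 - t / (2 * s N ^ 2)) / (2 * ⌈X * s N⌉₊)) ^ 2
        ∂(edgeMeasure (μ N) (s N)) ≤
        C * ((1 + X ^ 2) / X ^ 3 * Real.exp ((12 * X + 1) ^ (2 - δ))) := by
  obtain ⟨C, hC0, hC⟩ := h.exists_fejer_edge_le hδ hR hL
  refine ⟨C, hC0, fun X hX => ?_⟩
  filter_upwards [hC X hX, h.ceil_scale hX] with N h1 h2
  have hs := h.scale_pos N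
  set H := ⌈X * s N⌉₊
  have hb : ∀ t ∈ Set.Iic (0 : ℝ), (chebU H (1 - t / (2 * s N ^ 2)) / (2 * H)) ^ 2 ≤
      (fejer (2 * H) (1 - t / (2 * s N ^ 2)) / (H : ℝ) ^ 3) ^ 2 := by
    intro t ht
    have ha := one_le_arg (s := s N) (Set.mem_Iic.1 ht)
    exact pow_le_pow_left₀ (by linarith [half_le_chebU_div ha h2.1]) (chebU_div_le_fejer ha h2.1) 2
  have hi : IntegrableOn (fun t => (chebU H (1 - t / (2 * s N ^ 2)) / (2 * H)) ^ 2)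
        (Set.Iic 0) (edgeMeasure (μ N) (s N)) := by
    refine Integrable.mono' (h.integrable_fejer N H).integrableOn ?_ ?_
    · have : Continuous (fun t => (chebU H (1 - t / (2 * s N ^ 2)) / (2 * H)) ^ 2) := by
        have := continuous_chebU H
        fun_prop
      exact this.aestronglyMeasurable
    · filter_upwards [ae_restrict_mem measurableSet_Iic] with t ht
      rw [Real.norm_eq_abs, abs_of_nonneg (sq_nonneg _)]
      exact hb t ht
  refine ⟨hi, le_trans ?_ h1⟩
  exact (setIntegral_mono_on hi (h.integrable_fejer N H).integrableOn measurableSet_Iic hb).trans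
    (setIntegral_le_integral (h.integrable_fejer N H) (Eventually.of_forall fun t => sq_nonneg _))

/-- Mass at `α ≤ -1` is mass beyond the right edge of the reflected measures. -/
lemma exists_far_le (h : EdgeAsymptotics μ s φR φL ε) {δ : ℝ} (hδ : δ < 1)
    (hR : EdgeProfile δ φR) (hL : EdgeProfile δ φL) {X : ℝ} (hX : 0 < X) :
    ∃ C, 0 ≤ C ∧ ∀ᶠ N in atTop,
      IntegrableOn (fun t => (chebU ⌈X * s N⌉₊ (-(1 - t / (2 * s N ^ 2))) / (2 * ⌈X * s N⌉₊)) ^ 2)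
        (Set.Ici (4 * s N ^ 2)) (edgeMeasure (μ N) (s N)) ∧
      ∫ t in Set.Ici (4 * s N ^ 2),
        (chebU ⌈X * s N⌉₊ (-(1 - t / (2 * s N ^ 2))) / (2 * ⌈X * s N⌉₊)) ^ 2
        ∂(edgeMeasure (μ N) (s N)) ≤ C := by
  obtain ⟨C, hC0, hC⟩ := h.reflect.exists_left_le hδ hL hR
  refine ⟨C * ((1 + X ^ 2) / X ^ 3 * Real.exp ((12 * X + 1) ^ (2 - δ))), by positivity, ?_⟩
  filter_upwards [hC X hX] with N h1
  have hs := h.scale_pos N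
  rw [edgeMeasure_map_neg] at h1
  have hme : MeasurableEmbedding (fun t : ℝ => 4 * s N ^ 2 - t) :=
    (Homeomorph.subLeft (4 * s N ^ 2)).measurableEmbedding
  have hpre : (fun t : ℝ => 4 * s N ^ 2 - t) ⁻¹' Set.Iic 0 = Set.Ici (4 * s N ^ 2) := by
    ext t; simp
  have e : ∀ t : ℝ, 1 - (4 * s N ^ 2 - t) / (2 * s N ^ 2) = -(1 - t / (2 * s N ^ 2)) := by
    intro t; field_simp; ring
  rw [hme.setIntegral_map, hme.integrableOn_map_iff, hpre] at h1
  simpa only [Function.comp_def, e] using h1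

end EdgeAsymptotics

/-! ### Vague compactness and convergence of integrals -/

lemma integrable_of_continuous_compact {f : ℝ → ℝ} (hf : Continuous f) (hc : HasCompactSupport f)
    (σ : Measure ℝ) [IsFiniteMeasureOnCompacts σ] : Integrable f σ :=
  hf.integrable_of_hasCompactSupport hc

/-- Vague convergence of measures on the line. -/
def VagueTendsto (σ : ℕ → Measure ℝ) (l : Filter ℕ) (ν : Measure ℝ) : Prop :=
  ∀ f : ℝ → ℝ, Continuous f → HasCompactSupport f →
    Tendsto (fun N => ∫ t, f t ∂(σ N)) l (𝓝 (∫ t, f t ∂ν))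

-- Along an ultrafilter every bounded sequence of integrals converges, without extraction of
-- subsequences; the limit is a positive functional, and Riesz representation gives the measure.
open scoped CompactlySupported in
lemma exists_vagueTendsto (𝒰 : Ultrafilter ℕ) (σ : ℕ → Measure ℝ) [∀ N, IsFiniteMeasure (σ N)]
    (hb : ∀ T, ∃ C, ∀ᶠ N in 𝒰, (σ N).real (Set.Iic T) ≤ C) :
    ∃ ν : Measure ℝ, ν.Regular ∧ VagueTendsto σ 𝒰 ν := by
  have L (g : C_c(ℝ, ℝ)) : ∃ x, Tendsto (fun N => ∫ t, g t ∂(σ N)) 𝒰 (𝓝 x) := by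
    obtain ⟨T, hT⟩ := g.hasCompactSupport.isCompact.isBounded.subset_closedBall 0
    obtain ⟨C, hC⟩ := hb T
    obtain ⟨B, hB⟩ := g.continuous.bounded_above_of_compact_support g.hasCompactSupport
    have hB0 : 0 ≤ B := (norm_nonneg _).trans (hB 0)
    have hmem : Set.Icc (-(B * C)) (B * C) ∈ 𝒰.map (fun N => ∫ t, g t ∂(σ N)) := by
      rw [Ultrafilter.mem_map]
      filter_upwards [hC] with N hN
      rw [Set.mem_preimage, Set.mem_Icc, ← abs_le]
      have h1 : ∫ t in Set.Iic T, g t ∂(σ N) = ∫ t, g t ∂(σ N) := by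
        apply setIntegral_eq_integral_of_forall_compl_eq_zero
        intro t ht
        by_contra h0
        have := hT (subset_tsupport _ (Function.mem_support.2 h0))
        rw [Metric.mem_closedBall, dist_zero_right, Real.norm_eq_abs] at this
        exact ht ((le_abs_self t).trans this)
      rw [← h1]
      refine (norm_setIntegral_le_of_norm_le_const (C := B) (by finiteness) fun t _ => hB t).trans ?_
      gcongr
    obtain ⟨x, -, hx⟩ := isCompact_Icc.ultrafilter_le_nhds' _ hmem
    exact ⟨x, hx⟩
  choose Λ hΛ using L
  let Λ' : C_c(ℝ, ℝ) →ₚ[ℝ] ℝ :=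
  { toFun := Λ
    map_add' g g' := by
      have : Tendsto (fun N => ∫ x, g x + g' x ∂(σ N)) 𝒰 (𝓝 (Λ g + Λ g')) := by
        refine ((hΛ g).add (hΛ g')).congr fun N => ?_
        rw [integral_add]
        · exact g.continuous.integrable_of_hasCompactSupport g.hasCompactSupport
        · exact g'.continuous.integrable_of_hasCompactSupport g'.hasCompactSupport
      exact tendsto_nhds_unique (hΛ (g + g')) this
    map_smul' c g := by
      have : Tendsto (fun N => ∫ x, c • g x ∂(σ N)) 𝒰 (𝓝 (c • Λ g)) := by
        refine ((hΛ g).const_smul c).congr fun N => ?_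
        rw [integral_smul]
      exact tendsto_nhds_unique (hΛ (c • g)) this
    monotone' g g' hgg' := by
      apply le_of_tendsto_of_tendsto' (hΛ g) (hΛ g') (fun N ↦ ?_)
      apply integral_mono _ _ hgg'
      · exact g.continuous.integrable_of_hasCompactSupport g.hasCompactSupport
      · exact g'.continuous.integrable_of_hasCompactSupport g'.hasCompactSupport }
  refine ⟨RealRMK.rieszMeasure Λ', inferInstance, fun f hf hc => ?_⟩
  have := RealRMK.integral_rieszMeasure Λ' ⟨⟨f, hf⟩, hc⟩
  have h2 := hΛ ⟨⟨f, hf⟩, hc⟩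
  have h3 : ∫ t, f t ∂(RealRMK.rieszMeasure Λ') = Λ ⟨⟨f, hf⟩, hc⟩ := this
  rw [h3]
  exact h2

/-- Piecewise linear cutoff, `1` on `[-T, T]` and `0` off `[-T-1, T+1]`. -/
noncomputable def cutoff (T t : ℝ) : ℝ := max 0 (min 1 (T + 1 - |t|))

@[fun_prop] lemma continuous_cutoff (T : ℝ) : Continuous (cutoff T) := by
  unfold cutoff; fun_prop

lemma cutoff_nonneg (T t : ℝ) : 0 ≤ cutoff T t := le_max_left _ _

lemma cutoff_le_one (T t : ℝ) : cutoff T t ≤ 1 := max_le zero_le_one (min_le_left _ _)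

lemma cutoff_eq_one {T t : ℝ} (h : |t| ≤ T) : cutoff T t = 1 := by
  rw [cutoff, min_eq_left (by linarith), max_eq_right zero_le_one]

lemma cutoff_eq_zero {T t : ℝ} (h : T + 1 ≤ |t|) : cutoff T t = 0 := by
  rw [cutoff, max_eq_left]
  exact (min_le_right _ _).trans (by linarith)

lemma hasCompactSupport_cutoff (T : ℝ) : HasCompactSupport (cutoff T) := by
  apply HasCompactSupport.of_support_subset_isCompact (isCompact_Icc (a := -(T + 1)) (b := T + 1))
  intro t ht
  rw [Set.mem_Icc, ← abs_le]
  by_contra h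
  exact ht (cutoff_eq_zero (le_of_not_ge h))

section conv

variable {l : Filter ℕ} [l.NeBot] {σ : ℕ → Measure ℝ} [∀ N, IsFiniteMeasure (σ N)] {ν : Measure ℝ}
  [IsFiniteMeasureOnCompacts ν]

/-- The truncated integral of `|G|` is a limit of integrals at most `∫ |g N| + 1`. Here `∫ |g N|` is
bounded on a core interval by the bounds for `G` and for the mass, and off it by `htail`; the bound
does not depend on the truncation. -/
lemma integrable_of_vagueTendsto (hν : VagueTendsto σ l ν)
    (hb : ∀ T, ∃ C, ∀ᶠ N in l, (σ N).real (Set.Iic T) ≤ C) {g : ℕ → ℝ → ℝ} {G : ℝ → ℝ}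
    (hg : ∀ᶠ N in l, Integrable (g N) (σ N)) (hG : Continuous G)
    (hloc : ∀ T η : ℝ, 0 < η → ∀ᶠ N in l, ∀ t ∈ Set.Icc (-T) T, |g N t - G t| ≤ η)
    (htail : ∃ T, ∀ᶠ N in l, ∫ t in (Set.Icc (-T) T)ᶜ, |g N t| ∂(σ N) ≤ 1) :
    Integrable G ν := by
  obtain ⟨T, hT⟩ := htail
  obtain ⟨C, hC⟩ := hb T
  obtain ⟨B, hB⟩ := (isCompact_Icc (a := -T) (b := T)).exists_bound_of_continuousOn hG.continuousOn
  have hcov : AECover ν atTop fun n : ℕ => Set.Icc (-(n : ℝ)) n :=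
    aecover_Icc (tendsto_neg_atTop_atBot.comp tendsto_natCast_atTop_atTop)
      tendsto_natCast_atTop_atTop
  refine hcov.integrable_of_integral_norm_bounded ((|B| + 1) * |C| + 1 + 1)
    (fun n => hG.integrableOn_Icc) (Eventually.of_forall fun n => ?_)
  have hcs : HasCompactSupport fun t => |G t| * cutoff n t := (hasCompactSupport_cutoff n).mul_left
  have hcc : Continuous fun t => |G t| * cutoff n t := by fun_prop
  have h1 : ∫ t, |G t| * cutoff n t ∂ν ≤ (|B| + 1) * |C| + 1 + 1 := by
    refine le_of_tendsto (hν _ hcc hcs) ?_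
    obtain ⟨D, hD⟩ := hb (n + 1)
    have hη : 0 < 1 / (|D| + 1) := by positivity
    filter_upwards [hg, hloc (n + 1) _ hη, hloc T 1 one_pos, hT, hC, hD] with N k1 k2 k3 k4 k5 k6
    have kk1 : Integrable (fun t => |g N t|) (σ N) := k1.abs
    have p1 : ∀ t, |G t| * cutoff n t ≤ |g N t| +
        (Set.Icc (-((n : ℝ) + 1)) (n + 1)).indicator (fun _ => 1 / (|D| + 1)) t := by
      intro t
      by_cases ht : t ∈ Set.Icc (-((n : ℝ) + 1)) (n + 1)
      · rw [Set.indicator_of_mem ht]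
        have q1 := k2 t ht
        have q2 : |G t| ≤ |g N t| + 1 / (|D| + 1) := by
          have := abs_sub_abs_le_abs_sub (G t) (g N t)
          rw [abs_sub_comm] at this
          linarith
        exact (mul_le_of_le_one_right (abs_nonneg _) (cutoff_le_one _ _)).trans q2
      · rw [Set.indicator_of_notMem ht, cutoff_eq_zero]
        · simp
        · rw [Set.mem_Icc, ← abs_le] at ht
          exact le_of_not_ge ht
    have hind : Integrable ((Set.Icc (-((n : ℝ) + 1)) (n + 1)).indicator
        (fun _ => 1 / (|D| + 1))) (σ N) := (integrable_const _).indicator measurableSet_Icc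
    calc ∫ t, |G t| * cutoff n t ∂(σ N) ≤ ∫ t, (|g N t| +
          (Set.Icc (-((n : ℝ) + 1)) (n + 1)).indicator (fun _ => 1 / (|D| + 1)) t) ∂(σ N) :=
          integral_mono (integrable_of_continuous_compact hcc hcs _) (kk1.add hind) p1
      _ = ∫ t, |g N t| ∂(σ N) + (σ N).real (Set.Icc (-((n : ℝ) + 1)) (n + 1)) * (1 / (|D| + 1)) := by
          rw [integral_add kk1 hind, integral_indicator measurableSet_Icc, setIntegral_const,
            smul_eq_mul]
      _ ≤ ((|B| + 1) * |C| + 1) + 1 := by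
          gcongr
          · rw [← integral_add_compl (measurableSet_Icc (a := -T) (b := T)) kk1]
            gcongr
            have p2 : ∀ t ∈ Set.Icc (-T) T, |g N t| ≤ |B| + 1 := by
              intro t ht
              have q1 := k3 t ht
              have q2 := (hB t ht).trans (le_abs_self B)
              rw [Real.norm_eq_abs] at q2
              have := abs_sub_abs_le_abs_sub (g N t) (G t)
              linarith
            calc ∫ t in Set.Icc (-T) T, |g N t| ∂(σ N)
                ≤ ∫ t in Set.Icc (-T) T, (|B| + 1) ∂(σ N) :=
                  setIntegral_mono_on kk1.integrableOn (integrable_const _) measurableSet_Icc p2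
              _ = (σ N).real (Set.Icc (-T) T) * (|B| + 1) := by simp
              _ ≤ |C| * (|B| + 1) := by
                  gcongr
                  exact (measureReal_mono Set.Icc_subset_Iic_self).trans (k5.trans (le_abs_self C))
              _ = _ := mul_comm _ _
          · rw [mul_one_div, div_le_one (by positivity)]
            refine (measureReal_mono Set.Icc_subset_Iic_self).trans (k6.trans ?_)
            linarith [le_abs_self D]
  refine le_trans ?_ h1
  calc ∫ t in Set.Icc (-(n : ℝ)) n, ‖G t‖ ∂ν
      = ∫ t in Set.Icc (-(n : ℝ)) n, |G t| * cutoff n t ∂ν := by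
        refine setIntegral_congr_fun measurableSet_Icc fun t ht => ?_
        rw [Set.mem_Icc, ← abs_le] at ht
        rw [cutoff_eq_one ht, mul_one, Real.norm_eq_abs]
    _ ≤ _ := setIntegral_le_integral (integrable_of_continuous_compact hcc hcs ν)
        (Eventually.of_forall fun t => mul_nonneg (abs_nonneg _) (cutoff_nonneg _ _))

/-- Convergence of integrals under vague convergence, locally uniform convergence of the integrands
and uniform smallness of the tails. -/
lemma tendsto_integral_of_vagueTendsto (hν : VagueTendsto σ l ν)
    (hb : ∀ T, ∃ C, ∀ᶠ N in l, (σ N).real (Set.Iic T) ≤ C) {g : ℕ → ℝ → ℝ} {G : ℝ → ℝ}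
    (hg : ∀ᶠ N in l, Integrable (g N) (σ N)) (hG : Continuous G)
    (hloc : ∀ T η : ℝ, 0 < η → ∀ᶠ N in l, ∀ t ∈ Set.Icc (-T) T, |g N t - G t| ≤ η)
    (htail : ∀ η : ℝ, 0 < η → ∃ T, ∀ᶠ N in l, ∫ t in (Set.Icc (-T) T)ᶜ, |g N t| ∂(σ N) ≤ η) :
    Integrable G ν ∧ Tendsto (fun N => ∫ t, g N t ∂(σ N)) l (𝓝 (∫ t, G t ∂ν)) := by
  have hGi := integrable_of_vagueTendsto hν hb hg hG hloc (htail 1 one_pos)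
  refine ⟨hGi, ?_⟩
  have hcut : Tendsto (fun n : ℕ => ∫ t, G t * cutoff n t ∂ν) atTop (𝓝 (∫ t, G t ∂ν)) := by
    apply tendsto_integral_of_dominated_convergence (fun t => |G t|)
    · intro n
      exact (by fun_prop : Continuous fun t => G t * cutoff n t).aestronglyMeasurable
    · exact hGi.abs
    · intro n
      refine Eventually.of_forall fun t => ?_
      rw [norm_mul, Real.norm_eq_abs, Real.norm_of_nonneg (cutoff_nonneg _ _)]
      exact mul_le_of_le_one_right (abs_nonneg _) (cutoff_le_one _ _)
    · refine Eventually.of_forall fun t => ?_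
      apply tendsto_const_nhds.congr'
      filter_upwards [tendsto_natCast_atTop_atTop.eventually_ge_atTop |t|] with n hn
      rw [cutoff_eq_one hn, mul_one]
  rw [Metric.tendsto_nhds]
  intro θ hθ
  obtain ⟨T, hT⟩ := htail (θ / 5) (by linarith)
  obtain ⟨n, hn1, hn2⟩ := ((Metric.tendsto_nhds.1 hcut (θ / 5) (by linarith)).and
    (tendsto_natCast_atTop_atTop.eventually_ge_atTop T)).exists
  have hcs : HasCompactSupport fun t => G t * cutoff n t := (hasCompactSupport_cutoff n).mul_left
  have hcc : Continuous fun t => G t * cutoff n t := by fun_prop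
  obtain ⟨D, hD⟩ := hb (n + 1)
  have hη : 0 < θ / 5 / (|D| + 1) := by positivity
  filter_upwards [hT, Metric.tendsto_nhds.1 (hν _ hcc hcs) (θ / 5) (by linarith),
    hloc (n + 1) _ hη, hD, hg] with N k1 k2 k3 k4 k5
  have i1 : Integrable (fun t => G t * cutoff n t) (σ N) :=
    integrable_of_continuous_compact hcc hcs _
  have p1 : ∀ t, |g N t - G t * cutoff n t| ≤ (Set.Icc (-T) T)ᶜ.indicator (fun t => |g N t|) t +
      (Set.Icc (-((n : ℝ) + 1)) (n + 1)).indicator (fun _ => θ / 5 / (|D| + 1)) t := by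
    intro t
    have c0 := cutoff_nonneg n t
    have c1 := cutoff_le_one n t
    have e : g N t - G t * cutoff n t = g N t * (1 - cutoff n t) + (g N t - G t) * cutoff n t := by
      ring
    rw [e]
    refine (abs_add_le _ _).trans (add_le_add ?_ ?_)
    · by_cases ht : t ∈ Set.Icc (-T) T
      · rw [cutoff_eq_one ((abs_le.2 (Set.mem_Icc.1 ht)).trans hn2)]
        simpa using Set.indicator_nonneg (fun x _ => abs_nonneg (g N x)) t
      · rw [Set.indicator_of_mem (show t ∈ (Set.Icc (-T) T)ᶜ from ht), abs_mul]
        apply mul_le_of_le_one_right (abs_nonneg _)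
        rw [abs_of_nonneg (by linarith)]; linarith
    · by_cases ht : t ∈ Set.Icc (-((n : ℝ) + 1)) (n + 1)
      · rw [Set.indicator_of_mem ht, abs_mul, abs_of_nonneg c0]
        exact (mul_le_of_le_one_right (abs_nonneg _) c1).trans (k3 t ht)
      · rw [Set.indicator_of_notMem ht, cutoff_eq_zero]
        · simp
        · rw [Set.mem_Icc, ← abs_le] at ht
          exact le_of_not_ge ht
  have j1 : Integrable ((Set.Icc (-T) T)ᶜ.indicator (fun t => |g N t|)) (σ N) :=
    k5.abs.indicator measurableSet_Icc.compl
  have j2 : Integrable ((Set.Icc (-((n : ℝ) + 1)) (n + 1)).indicator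
      (fun _ => θ / 5 / (|D| + 1))) (σ N) := (integrable_const _).indicator measurableSet_Icc
  have p2 : |∫ t, g N t ∂(σ N) - ∫ t, G t * cutoff n t ∂(σ N)| ≤ θ / 5 + θ / 5 := by
    rw [← integral_sub k5 i1]
    refine (abs_integral_le_integral_abs).trans
      ((integral_mono (k5.sub i1).abs (j1.add j2) p1).trans ?_)
    simp only [Pi.add_apply]
    rw [integral_add j1 j2, integral_indicator measurableSet_Icc.compl,
      integral_indicator measurableSet_Icc, setIntegral_const, smul_eq_mul]
    gcongr
    rw [← mul_div_assoc, div_le_iff₀ (by positivity), mul_comm]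
    gcongr
    exact (measureReal_mono Set.Icc_subset_Iic_self).trans (k4.trans (by linarith [le_abs_self D]))
  rw [Real.dist_eq] at *
  rw [abs_le] at p2
  rw [abs_lt] at *
  constructor <;> linarith

end conv

/-- Portmanteau for an open set: inner regularity and a continuous function between a compact subset
and the half-line. -/
lemma measure_Iio_le_of_vagueTendsto {l : Filter ℕ} [l.NeBot] {σ : ℕ → Measure ℝ}
    [∀ N, IsFiniteMeasure (σ N)] {ν : Measure ℝ} [ν.Regular] (hν : VagueTendsto σ l ν) {a c : ℝ}
    (h : ∀ᶠ N in l, (σ N).real (Set.Iio a) ≤ c) : ν (Set.Iio a) ≤ ENNReal.ofReal c := by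
  rw [isOpen_Iio.measure_eq_iSup_isCompact]
  refine iSup₂_le fun K hK => iSup_le fun hKc => ?_
  obtain ⟨f, hf1, hf0, hfc, hf⟩ := exists_continuous_one_zero_of_isCompact hKc
    isOpen_Iio.isClosed_compl (by rwa [Set.disjoint_compl_right_iff_subset])
  have h1 : ∫ t, f t ∂ν ≤ c := by
    refine le_of_tendsto (hν f f.continuous hfc) ?_
    filter_upwards [h] with N hN
    refine le_trans ?_ hN
    rw [← integral_indicator_one measurableSet_Iio]
    refine integral_mono (integrable_of_continuous_compact f.continuous hfc _)
      ((integrable_const _).indicator measurableSet_Iio) fun t => ?_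
    by_cases ht : t ∈ Set.Iio a
    · rw [Set.indicator_of_mem ht]
      exact (hf t).2
    · rw [Set.indicator_of_notMem ht]
      exact (hf0 ht).le
  have hfin : ν K < ⊤ := hKc.measure_lt_top
  rw [← ENNReal.ofReal_toReal hfin.ne]
  apply ENNReal.ofReal_le_ofReal
  refine le_trans ?_ h1
  change ν.real K ≤ _
  rw [← integral_indicator_one hKc.measurableSet]
  refine integral_mono ((integrable_indicator_iff hKc.measurableSet).2 ?_)
    (integrable_of_continuous_compact f.continuous hfc _) fun t => ?_
  · exact integrableOn_const hfin.ne
  · by_cases ht : t ∈ K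
    · rw [Set.indicator_of_mem ht, hf1 ht, Pi.one_apply]
    · rw [Set.indicator_of_notMem ht]
      exact (hf t).1

lemma continuous_of_tendsto_prod {F : ℕ → ℝ → ℝ} {G : ℝ → ℝ}
    (h : ∀ t, Tendsto (fun p : ℕ × ℝ => F p.1 p.2) (atTop ×ˢ 𝓝 t) (𝓝 (G t))) : Continuous G := by
  rw [continuous_iff_continuousAt]
  intro t
  rw [ContinuousAt, Metric.tendsto_nhds]
  intro η hη
  obtain ⟨A, hA, B, hB, hAB⟩ := eventually_prod_iff.1 (Metric.tendsto_nhds.1 (h t) (η / 2) (by linarith))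
  filter_upwards [hB] with t' ht'
  have h1 : Tendsto (fun N => F N t') atTop (𝓝 (G t')) :=
    (h t').comp (tendsto_id.prodMk tendsto_const_pure |>.mono_right (prod_mono le_rfl (pure_le_nhds t')))
  have h2 : dist (G t') (G t) ≤ η / 2 := by
    refine le_of_tendsto (h1.dist tendsto_const_nhds) ?_
    filter_upwards [hA] with N hN
    exact (hAB hN ht').le
  linarith

lemma eventually_abs_sub_le_of_tendsto_prod {F : ℕ → ℝ → ℝ} {G : ℝ → ℝ}
    (h : ∀ t, Tendsto (fun p : ℕ × ℝ => F p.1 p.2) (atTop ×ˢ 𝓝 t) (𝓝 (G t))) (T η : ℝ)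
    (hη : 0 < η) : ∀ᶠ N in atTop, ∀ t ∈ Set.Icc (-T) T, |F N t - G t| ≤ η := by
  have hG := continuous_of_tendsto_prod h
  have h1 : TendstoLocallyUniformly F G atTop := by
    rw [tendstoLocallyUniformly_iff_forall_tendsto]
    intro t
    rw [uniformity_eq_comap_nhds_zero, tendsto_comap_iff]
    have := (h t).sub ((hG.tendsto t).comp (tendsto_snd (f := (atTop : Filter ℕ)) (g := 𝓝 t)))
    simpa [Function.comp_def] using this
  have h2 := tendstoLocallyUniformly_iff_forall_isCompact.1 h1 (Set.Icc (-T) T) isCompact_Icc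
  filter_upwards [Metric.tendstoUniformlyOn_iff.1 h2 η hη] with N hN t ht
  have := hN t ht
  rw [dist_comm, Real.dist_eq] at this
  exact this.le

/-! ### Tightness and the identity for limit measures -/

/-- The bound grows with `T`, so the first power of the normalised polynomial is at most `16/(T X²)`
times its square, whose integral is bounded: this is tightness at `-∞`. -/
lemma chebU_div_lower {s t T X : ℝ} (hs : 0 < s) (hX : 0 < X) (hT : 0 ≤ T) (ht : t ≤ -T) {H : ℕ}
    (hH : 2 ≤ H) (hH2 : X * s ≤ H) :
    T * X ^ 2 / 16 ≤ chebU H (1 - t / (2 * s ^ 2)) / (2 * H) := by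
  obtain ⟨k, rfl⟩ : ∃ k, H = k + 2 := ⟨H - 2, by omega⟩
  have hHp : (0 : ℝ) < ((k + 2 : ℕ) : ℝ) := by positivity
  have h1 := chebU_lower (y := T / s ^ 2) (by positivity) (k + 2)
  have h2 : 1 + T / s ^ 2 / 2 ≤ 1 - t / (2 * s ^ 2) := by
    rw [div_div, mul_comm (s ^ 2), sub_eq_add_neg, ← neg_div]
    gcongr
    linarith
  have h3 := chebU_mono_arg (by have : 0 ≤ T / s ^ 2 / 2 := by positivity
                                linarith) h2 (k + 2)
  have h4 : ((k + 2 + 1).choose 3 : ℝ) = (k + 3) * (k + 2) * (k + 1) / 6 := by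
    rw [Nat.cast_choose_eq_descPochhammer_div]
    simp [descPochhammer, Nat.factorial]
    ring
  rw [h4] at h1
  rw [le_div_iff₀ (by positivity)]
  refine le_trans ?_ (h1.trans h3)
  have h5 : T * X ^ 2 ≤ T / s ^ 2 * ((k + 2 : ℕ) : ℝ) ^ 2 := by
    rw [div_mul_eq_mul_div, le_div_iff₀ (by positivity), mul_assoc, ← mul_pow]
    gcongr
  push_cast at h5 hHp ⊢
  set y := T / s ^ 2 with hy
  have hy0 : 0 ≤ y := by positivity
  have h6 : (k + 2 : ℝ) ^ 2 * 3 / 4 ≤ (k + 3) * (k + 1) := by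
    have : (0 : ℝ) ≤ k := by positivity
    nlinarith
  have h7 : T * X ^ 2 / 16 * (2 * (k + 2)) ≤ y * ((k + 2) ^ 2 * 3 / 4) * (k + 2) / 6 := by
    nlinarith
  have h8 : y * ((k + 2) ^ 2 * 3 / 4) * (k + 2) / 6 ≤ y * ((k + 3) * (k + 1)) * (k + 2) / 6 := by
    gcongr
  linarith

namespace EdgeAsymptotics

variable {μ : ℕ → Measure ℝ} {s : ℕ → ℝ} {φR φL : ℝ → ℝ} {ε : ℕ → ℕ → ℝ}

/-- Tightness: functions dominated by the kernels are uniformly small off large intervals. -/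
lemma exists_tail_le (h : EdgeAsymptotics μ s φR φL ε) {δ : ℝ} (hδ : δ < 1)
    (hR : EdgeProfile δ φR) (hL : EdgeProfile δ φL) {X : ℝ} (hX : 0 < X) {f : ℕ → ℝ → ℝ} {C : ℝ}
    (hC : 0 ≤ C) (hf : ∀ᶠ N in atTop, Integrable (f N) (edgeMeasure (μ N) (s N)))
    (h1 : ∀ᶠ N in atTop, ∀ t, t ≤ 0 →
      |f N t| ≤ C * (chebU ⌈X * s N⌉₊ (1 - t / (2 * s N ^ 2)) / (2 * ⌈X * s N⌉₊)))
    (h2 : ∀ᶠ N in atTop, ∀ t, 0 < t → t ≤ 4 * s N ^ 2 → |f N t| ≤ C / t ^ 2)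
    (h3 : ∀ᶠ N in atTop, ∀ t, 4 * s N ^ 2 ≤ t → |f N t| ≤
      C / s N ^ 4 * (chebU ⌈X * s N⌉₊ (-(1 - t / (2 * s N ^ 2))) / (2 * ⌈X * s N⌉₊)))
    (η : ℝ) (hη : 0 < η) :
    ∃ T, ∀ᶠ N in atTop, ∫ t in (Set.Icc (-T) T)ᶜ, |f N t| ∂(edgeMeasure (μ N) (s N)) ≤ η := by
  obtain ⟨C1, hC1, k1⟩ := h.exists_left_le hδ hR hL
  obtain ⟨C2, hC2, k2⟩ := h.exists_right_tail_le hδ hR hL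
  obtain ⟨C3, hC3, k3⟩ := h.exists_far_le hδ hR hL hX
  have k1 := k1 X hX
  set B := C1 * ((1 + X ^ 2) / X ^ 3 * Real.exp ((12 * X + 1) ^ (2 - δ))) with hB
  have hB0 : 0 ≤ B := by positivity
  have ht1 : Tendsto (fun T : ℝ => C * (16 * B / X ^ 2) / T + C * C2 / √T) atTop (𝓝 (0 + 0)) :=
    (tendsto_const_nhds.div_atTop tendsto_id).add
      (tendsto_const_nhds.div_atTop Real.tendsto_sqrt_atTop)
  rw [add_zero] at ht1
  obtain ⟨T, hT1, hT2⟩ := ((ht1.eventually_le_const (show 0 < η / 2 by linarith)).and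
    (eventually_ge_atTop 1)).exists
  have hT0 : 0 < T := by linarith
  refine ⟨T, ?_⟩
  have ht2 : Tendsto (fun N => C / 4 / s N + 2 * C * C3 / s N ^ 4) atTop (𝓝 (0 + 0)) :=
    (tendsto_const_nhds.div_atTop h.scale_tendsto).add
      (tendsto_const_nhds.div_atTop ((tendsto_pow_atTop (by norm_num)).comp h.scale_tendsto))
  rw [add_zero] at ht2
  filter_upwards [hf, h1, h2, h3, k1, k2 T hT2, k3, ht2.eventually_le_const (show 0 < η / 2 by linarith),
    h.ceil_scale hX, h.scale_tendsto.eventually_ge_atTop (2 / X)]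
    with N f0 f1 f2 f3 a1 a2 a3 a4 a5 a6
  have hs := h.scale_pos N
  have := h.prob N
  set σ := edgeMeasure (μ N) (s N) with hσ
  set H := ⌈X * s N⌉₊ with hH
  have hH2 : 2 ≤ H := by
    have : (2 : ℝ) ≤ H := by
      refine le_trans ?_ a5.2.1
      rwa [div_le_iff₀' hX] at a6
    exact_mod_cast this
  have f0' : Integrable (fun t => |f N t|) σ := f0.abs
  have hnn : ∀ t, 0 ≤ |f N t| := fun t => abs_nonneg _
  -- left part
  have b1 : ∫ t in Set.Iic (-T), |f N t| ∂σ ≤ C * (16 * B / X ^ 2) / T := by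
    have i1 : IntegrableOn (fun t => C * (16 / (T * X ^ 2)) *
        (chebU H (1 - t / (2 * s N ^ 2)) / (2 * H)) ^ 2) (Set.Iic 0) σ := a1.1.const_mul _
    calc ∫ t in Set.Iic (-T), |f N t| ∂σ ≤ ∫ t in Set.Iic (-T), C * (16 / (T * X ^ 2)) *
        (chebU H (1 - t / (2 * s N ^ 2)) / (2 * H)) ^ 2 ∂σ := by
          refine setIntegral_mono_on f0'.integrableOn (i1.mono_set (Set.Iic_subset_Iic.2 (by linarith)))
            measurableSet_Iic fun t ht => ?_
          have c1 := chebU_div_lower hs hX hT0.le ht hH2 a5.2.1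
          refine (f1 t (by linarith [Set.mem_Iic.1 ht])).trans ?_
          rw [mul_assoc]
          gcongr
          rw [div_mul_eq_mul_div, le_div_iff₀ (by positivity)]
          have c0 : 0 ≤ chebU H (1 - t / (2 * s N ^ 2)) / (2 * H) := le_trans (by positivity) c1
          nlinarith
      _ ≤ ∫ t in Set.Iic 0, C * (16 / (T * X ^ 2)) *
        (chebU H (1 - t / (2 * s N ^ 2)) / (2 * H)) ^ 2 ∂σ :=
          setIntegral_mono_set i1 (Eventually.of_forall fun t => by positivity)
            (Set.Iic_subset_Iic.2 (by linarith)).eventuallyLE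
      _ = C * (16 / (T * X ^ 2)) * ∫ t in Set.Iic 0,
        (chebU H (1 - t / (2 * s N ^ 2)) / (2 * H)) ^ 2 ∂σ := integral_const_mul _ _
      _ ≤ C * (16 / (T * X ^ 2)) * B := by gcongr; exact a1.2
      _ = _ := by field_simp
  have b2 : ∫ t in Set.Ioc T (2 * s N ^ 2), |f N t| ∂σ ≤ C * C2 / √T := by
    calc ∫ t in Set.Ioc T (2 * s N ^ 2), |f N t| ∂σ
        ≤ ∫ t in Set.Ioc T (2 * s N ^ 2), C * (1 / t ^ 2) ∂σ := by
          refine setIntegral_mono_on f0'.integrableOn (a2.1.const_mul C) measurableSet_Ioc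
            fun t ht => ?_
          rw [mul_one_div]
          exact f2 t (hT0.trans ht.1) (ht.2.trans (by nlinarith [sq_nonneg (s N)]))
      _ = C * ∫ t in Set.Ioc T (2 * s N ^ 2), 1 / t ^ 2 ∂σ := integral_const_mul _ _
      _ ≤ C * (C2 / √T) := by gcongr; exact a2.2
      _ = _ := by ring
  -- In the half of the spectrum near the other edge `1/t²` is of order `s⁻⁴`, which beats the total
  -- mass `s³`.
  have b3 : ∫ t in Set.Ioc (2 * s N ^ 2) (4 * s N ^ 2), |f N t| ∂σ ≤ C / 4 / s N := by
    calc ∫ t in Set.Ioc (2 * s N ^ 2) (4 * s N ^ 2), |f N t| ∂σ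
        ≤ ∫ t in Set.Ioc (2 * s N ^ 2) (4 * s N ^ 2), C / (2 * s N ^ 2) ^ 2 ∂σ := by
          refine setIntegral_mono_on f0'.integrableOn (integrable_const _) measurableSet_Ioc
            fun t ht => ?_
          have : 0 < 2 * s N ^ 2 := by positivity
          refine (f2 t (this.trans ht.1) ht.2).trans ?_
          gcongr
          exact ht.1.le
      _ = σ.real (Set.Ioc (2 * s N ^ 2) (4 * s N ^ 2)) * (C / (2 * s N ^ 2) ^ 2) := by simp
      _ ≤ s N ^ 3 * (C / (2 * s N ^ 2) ^ 2) := by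
          gcongr
          exact edgeMeasure_real_le hs _
      _ = _ := by field_simp; norm_num
  -- Beyond the other edge the prefactor `s⁻⁴` suffices. The normalised polynomial is at least
  -- `1/2`, hence at most twice its square.
  have b4 : ∫ t in Set.Ici (4 * s N ^ 2), |f N t| ∂σ ≤ 2 * C * C3 / s N ^ 4 := by
    calc ∫ t in Set.Ici (4 * s N ^ 2), |f N t| ∂σ
        ≤ ∫ t in Set.Ici (4 * s N ^ 2), C / s N ^ 4 * 2 *
          (chebU H (-(1 - t / (2 * s N ^ 2))) / (2 * H)) ^ 2 ∂σ := by
          refine setIntegral_mono_on f0'.integrableOn (a3.1.const_mul _) measurableSet_Ici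
            fun t ht => ?_
          refine (f3 t ht).trans ?_
          rw [mul_assoc]
          gcongr
          have c1 : 1 ≤ -(1 - t / (2 * s N ^ 2)) := by
            have : 2 ≤ t / (2 * s N ^ 2) := by
              rw [le_div_iff₀ (by positivity)]; linarith [Set.mem_Ici.1 ht]
            linarith
          have := half_le_chebU_div c1 a5.1
          nlinarith
      _ = C / s N ^ 4 * 2 * ∫ t in Set.Ici (4 * s N ^ 2),
          (chebU H (-(1 - t / (2 * s N ^ 2))) / (2 * H)) ^ 2 ∂σ := integral_const_mul _ _
      _ ≤ C / s N ^ 4 * 2 * C3 := by gcongr; exact a3.2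
      _ = _ := by ring
  have hsub : (Set.Icc (-T) T)ᶜ ⊆ (Set.Iic (-T) ∪ Set.Ioc T (2 * s N ^ 2)) ∪
      (Set.Ioc (2 * s N ^ 2) (4 * s N ^ 2) ∪ Set.Ici (4 * s N ^ 2)) := by
    intro t ht
    simp only [Set.mem_compl_iff, Set.mem_Icc, not_and_or, not_le, Set.mem_union, Set.mem_Iic,
      Set.mem_Ioc, Set.mem_Ici] at ht ⊢
    by_cases q1 : t ≤ -T
    · exact Or.inl (Or.inl q1)
    · have q2 : T < t := by rcases ht with q | q <;> [linarith; exact q]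
      by_cases q3 : t ≤ 2 * s N ^ 2
      · exact Or.inl (Or.inr ⟨q2, q3⟩)
      · by_cases q4 : t ≤ 4 * s N ^ 2
        · exact Or.inr (Or.inl ⟨not_le.1 q3, q4⟩)
        · exact Or.inr (Or.inr (not_le.1 q4).le)
  have b5 := setIntegral_mono_set (μ := σ) f0'.integrableOn (Eventually.of_forall hnn) hsub.eventuallyLE
  have b6 := setIntegral_union_le hnn (A := Set.Iic (-T) ∪ Set.Ioc T (2 * s N ^ 2))
    (B := Set.Ioc (2 * s N ^ 2) (4 * s N ^ 2) ∪ Set.Ici (4 * s N ^ 2))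
    f0'.integrableOn f0'.integrableOn
  have b7 := setIntegral_union_le hnn (A := Set.Iic (-T)) (B := Set.Ioc T (2 * s N ^ 2))
    f0'.integrableOn f0'.integrableOn
  have b8 := setIntegral_union_le hnn (A := Set.Ioc (2 * s N ^ 2) (4 * s N ^ 2))
    (B := Set.Ici (4 * s N ^ 2)) f0'.integrableOn f0'.integrableOn
  linarith

lemma integrable_edgePoly (h : EdgeAsymptotics μ s φR φL ε) (a : ℝ → ℝ) (N m : ℕ) :
    Integrable (edgePoly a (s N) m) (edgeMeasure (μ N) (s N)) ∧
    ∫ t, edgePoly a (s N) m t ∂(edgeMeasure (μ N) (s N)) =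
      s N * ∑ n ∈ Finset.Icc 1 m, a (n / s N) * ∫ α, chebU n α ∂(μ N) := by
  have hi : ∀ n ∈ Finset.Icc 1 m, Integrable (fun α => a (n / s N) * chebU n α) (μ N) :=
    fun n _ => (h.integrable_chebU N n).const_mul _
  have := integrable_edgeMeasure (h.scale_pos N)
    (F := fun α => (∑ n ∈ Finset.Icc 1 m, a (n / s N) * chebU n α) / s N ^ 2)
    ((integrable_finsetSum _ hi).div_const _)
  refine ⟨this.1, this.2.trans ?_⟩
  rw [integral_div, integral_finsetSum _ hi]
  simp only [integral_const_mul]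
  have := (h.scale_pos N).ne'
  field_simp

variable {𝒰 : Ultrafilter ℕ} {ν : Measure ℝ}

/-- Both sides are limits of the integral of `edgePoly`: one by locally uniform convergence and
tightness, the other by the asymptotics of the coefficients. -/
lemma integral_edgeTransform (h : EdgeAsymptotics μ s φR φL ε) {δ : ℝ} (hδ : δ < 1)
    (hR : EdgeProfile δ φR) (hL : EdgeProfile δ φL) (hU : (𝒰 : Filter ℕ) ≤ atTop)
    [IsFiniteMeasureOnCompacts ν]
    (hν : VagueTendsto (fun N => edgeMeasure (μ N) (s N)) 𝒰 ν) {a : ℝ → ℝ} {R : ℝ}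
    (ha : EdgeTest a R) (hi : IntegrableOn (fun x => a x * x * φR x) (Set.Ioi 0)) :
    Integrable (edgeTransform a) ν ∧
      ∫ t, edgeTransform a t ∂ν = deriv a 0 + ∫ x in Set.Ioi 0, a x * x * φR x := by
  have := h.prob
  have hb : ∀ T, ∃ C, ∀ᶠ N in (𝒰 : Filter ℕ), (edgeMeasure (μ N) (s N)).real (Set.Iic T) ≤ C := by
    intro T
    obtain ⟨C, hC⟩ := h.exists_mass_le hδ hR hL T
    exact ⟨C, hC.filter_mono hU⟩
  have hp := tendsto_edgePoly ha h.scale_tendsto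
  obtain ⟨C, hC, hbd⟩ := ha.exists_edgePoly_le
  have hRp := ha.pos
  have hint : ∀ N, Integrable (edgePoly a (s N) (⌈R * s N⌉₊ + 2)) (edgeMeasure (μ N) (s N)) :=
    fun N => (h.integrable_edgePoly a N _).1
  have s1 := h.scale_tendsto.eventually_ge_atTop 1
  have key := tendsto_integral_of_vagueTendsto hν hb
    (g := fun N => edgePoly a (s N) (⌈R * s N⌉₊ + 2)) (G := edgeTransform a)
    (Eventually.of_forall hint)
    (continuous_of_tendsto_prod (F := fun N => edgePoly a (s N) (⌈R * s N⌉₊ + 2)) hp)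
    (fun T η hη => (eventually_abs_sub_le_of_tendsto_prod
      (F := fun N => edgePoly a (s N) (⌈R * s N⌉₊ + 2)) hp T η hη).filter_mono hU)
    (fun η hη => by
      obtain ⟨T, hT⟩ := h.exists_tail_le hδ hR hL (show 0 < R + 3 by linarith)
        (f := fun N => edgePoly a (s N) (⌈R * s N⌉₊ + 2)) hC (Eventually.of_forall hint)
        (s1.mono fun N hN => (hbd _ hN).2.2.1) (s1.mono fun N hN => (hbd _ hN).2.1)
        (s1.mono fun N hN => (hbd _ hN).2.2.2) η hη
      exact ⟨T, hT.filter_mono hU⟩)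
  refine ⟨key.1, tendsto_nhds_unique key.2 ?_⟩
  refine ((h.tendsto_functional hR.continuousOn hL.continuousOn ha hi).mono_left hU).congr fun N => ?_
  exact (h.integrable_edgePoly a N _).2.symm

/-- Convergence of integrals of a fixed function which decays on the right. -/
lemma tendsto_integral_of_decay (h : EdgeAsymptotics μ s φR φL ε) {δ : ℝ} (hδ : δ < 1)
    (hR : EdgeProfile δ φR) (hL : EdgeProfile δ φL) (hU : (𝒰 : Filter ℕ) ≤ atTop)
    [IsFiniteMeasureOnCompacts ν]
    (hν : VagueTendsto (fun N => edgeMeasure (μ N) (s N)) 𝒰 ν) {f : ℝ → ℝ} (hf : Continuous f)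
    {C : ℝ} (hC1 : ∀ t, |f t| ≤ C) (hC2 : ∀ t, 0 < t → |f t| ≤ C / t ^ 2) :
    Integrable f ν ∧
      Tendsto (fun N => ∫ t, f t ∂(edgeMeasure (μ N) (s N))) 𝒰 (𝓝 (∫ t, f t ∂ν)) := by
  have := h.prob
  have hC : 0 ≤ C := (abs_nonneg _).trans (hC1 0)
  have hb : ∀ T, ∃ C, ∀ᶠ N in (𝒰 : Filter ℕ), (edgeMeasure (μ N) (s N)).real (Set.Iic T) ≤ C := by
    intro T
    obtain ⟨C, hC⟩ := h.exists_mass_le hδ hR hL T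
    exact ⟨C, hC.filter_mono hU⟩
  have hint : ∀ N, Integrable f (edgeMeasure (μ N) (s N)) := fun N =>
    Integrable.of_bound hf.aestronglyMeasurable C (Eventually.of_forall hC1)
  refine tendsto_integral_of_vagueTendsto hν hb (g := fun _ => f) (Eventually.of_forall hint) hf
    (fun T η hη => Eventually.of_forall fun N t _ => by simpa using hη.le) fun η hη => ?_
  have d1 : ∀ᶠ N in atTop, ∀ t, t ≤ 0 →
      |f t| ≤ 2 * C * (chebU ⌈1 * s N⌉₊ (1 - t / (2 * s N ^ 2)) / (2 * ⌈1 * s N⌉₊)) := by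
    filter_upwards [h.ceil_scale one_pos] with N hN t ht
    have := half_le_chebU_div (one_le_arg (s := s N) ht) hN.1
    nlinarith [hC1 t]
  have d2 : ∀ᶠ N in atTop, ∀ t, 0 < t → t ≤ 4 * s N ^ 2 → |f t| ≤ 2 * C / t ^ 2 := by
    refine Eventually.of_forall fun N t ht _ => (hC2 t ht).trans ?_
    gcongr
    linarith
  have d3 : ∀ᶠ N in atTop, ∀ t, 4 * s N ^ 2 ≤ t → |f t| ≤ 2 * C / s N ^ 4 *
      (chebU ⌈1 * s N⌉₊ (-(1 - t / (2 * s N ^ 2))) / (2 * ⌈1 * s N⌉₊)) := by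
    filter_upwards [h.ceil_scale one_pos] with N hN t ht
    have hs := h.scale_pos N
    have ht0 : 0 < t := lt_of_lt_of_le (by positivity) ht
    have c1 : 1 ≤ -(1 - t / (2 * s N ^ 2)) := by
      have : 2 ≤ t / (2 * s N ^ 2) := by rw [le_div_iff₀ (by positivity)]; linarith
      linarith
    have c2 := half_le_chebU_div c1 hN.1
    calc |f t| ≤ C / t ^ 2 := hC2 t ht0
      _ ≤ C / (4 * s N ^ 2) ^ 2 := by gcongr
      _ = C / s N ^ 4 * (1 / 16) := by field_simp; norm_num
      _ ≤ C / s N ^ 4 * 1 := by gcongr; norm_num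
      _ = 2 * C / s N ^ 4 * (1 / 2) := by ring
      _ ≤ _ := by gcongr
  obtain ⟨T, hT⟩ := h.exists_tail_le hδ hR hL one_pos (f := fun _ => f) (C := 2 * C) (by positivity)
    (Eventually.of_forall hint) d1 d2 d3 η hη
  exact ⟨T, hT.filter_mono hU⟩

/-! ### Decay of the limit at `-∞` -/

/-- Markov's inequality for the square of the normalised polynomial, which increases to the left and
at `-k²` tends to `sinh(kX)/(2kX)`; half of this limit serves as threshold. The parameter `X` stays
free for optimisation. -/
lemma exists_limit_tail_le (h : EdgeAsymptotics μ s φR φL ε) {δ : ℝ} (hδ : δ < 1)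
    (hR : EdgeProfile δ φR) (hL : EdgeProfile δ φL) (hU : (𝒰 : Filter ℕ) ≤ atTop) [ν.Regular]
    (hν : VagueTendsto (fun N => edgeMeasure (μ N) (s N)) 𝒰 ν) :
    ∃ C, 0 ≤ C ∧ ∀ X k, 0 < X → 0 < k → ν (Set.Iio (-k ^ 2)) ≤ ENNReal.ofReal
      (C * ((1 + X ^ 2) / X ^ 3 * Real.exp ((12 * X + 1) ^ (2 - δ))) *
        (16 * X ^ 2 * k ^ 2 / Real.sinh (k * X) ^ 2)) := by
  have := h.prob
  obtain ⟨C, hC, hl⟩ := h.exists_left_le hδ hR hL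
  refine ⟨C, hC, fun X k hX hk => ?_⟩
  set B := C * ((1 + X ^ 2) / X ^ 3 * Real.exp ((12 * X + 1) ^ (2 - δ))) with hB
  have hB0 : 0 ≤ B := by positivity
  set S := Real.sinh (k * X) / k with hS
  have hS0 : 0 < S := div_pos (Real.sinh_pos_iff.2 (by positivity)) hk
  refine measure_Iio_le_of_vagueTendsto hν (Eventually.filter_mono hU ?_)
  have hn : Tendsto (fun N => (⌈X * s N⌉₊ : ℝ) / s N) atTop (𝓝 X) :=
    (tendsto_nat_ceil_mul_div_atTop hX.le).comp h.scale_tendsto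
  have hp := tendsto_chebU_div h.scale_tendsto hn (tendsto_const_nhds (x := -k ^ 2))
  rw [edgeSin_of_neg X hk] at hp
  have hq : Tendsto (fun N => chebU ⌈X * s N⌉₊ (1 - -k ^ 2 / (2 * s N ^ 2)) / (2 * ⌈X * s N⌉₊))
      atTop (𝓝 (S / (2 * X))) := by
    refine (hp.div (hn.const_mul 2) (by positivity)).congr fun N => ?_
    have := (h.scale_pos N).ne'
    simp only [Pi.div_apply]
    field_simp
  filter_upwards [hl X hX, h.ceil_scale hX,
    hq.eventually_const_le (show S / (4 * X) < S / (2 * X) by gcongr; norm_num)] with N h1 h2 h3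
  set H := ⌈X * s N⌉₊ with hH
  have hsub : ∀ t ∈ Set.Iio (-k ^ 2), S / (4 * X) ≤
      chebU H (1 - t / (2 * s N ^ 2)) / (2 * H) := by
    intro t ht
    refine h3.trans ?_
    have : 0 ≤ k ^ 2 := by positivity
    have h5 := chebU_mono_arg (one_le_arg (s := s N) (t := -k ^ 2) (by linarith))
      (β := 1 - t / (2 * s N ^ 2)) (by gcongr; exact (Set.mem_Iio.1 ht).le) H
    gcongr
  have h6 : (edgeMeasure (μ N) (s N)).real (Set.Iio (-k ^ 2)) * (S / (4 * X)) ^ 2 ≤ B := by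
    have hk2 : Set.Iio (-k ^ 2) ⊆ Set.Iic 0 := fun t ht => by
      have : 0 ≤ k ^ 2 := by positivity
      rw [Set.mem_Iic]; linarith [Set.mem_Iio.1 ht]
    calc (edgeMeasure (μ N) (s N)).real (Set.Iio (-k ^ 2)) * (S / (4 * X)) ^ 2
        = ∫ t in Set.Iio (-k ^ 2), (S / (4 * X)) ^ 2 ∂(edgeMeasure (μ N) (s N)) := by simp
      _ ≤ ∫ t in Set.Iio (-k ^ 2), (chebU H (1 - t / (2 * s N ^ 2)) / (2 * H)) ^ 2
            ∂(edgeMeasure (μ N) (s N)) := by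
          refine setIntegral_mono_on (integrable_const _) (h1.1.mono_set hk2) measurableSet_Iio
            fun t ht => ?_
          have := hsub t ht
          gcongr
      _ ≤ _ := (setIntegral_mono_set h1.1 (Eventually.of_forall fun t => by positivity)
            hk2.eventuallyLE).trans h1.2
  rw [← le_div_iff₀ (by positivity)] at h6
  refine h6.trans (le_of_eq ?_)
  rw [hS]
  have := (Real.sinh_pos_iff.2 (show 0 < k * X by positivity)).ne'
  field_simp
  norm_num

end EdgeAsymptotics

/-- The choice `X^(1-δ) = k/13²` gives `(12X + 1)^(2-δ) ≤ 13² X^(2-δ) = kX`, while `sinh(kX)²` is at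
least `exp(2kX)/16`; half of the surplus `exp(-kX)` absorbs the powers. -/
lemma gaussian_tail_bound {δ : ℝ} (hδ0 : 0 < δ) (hδ : δ < 1) {k X : ℝ} (hk : 169 ≤ k)
    (hX : X = (k / 169) ^ (1 / (1 - δ))) :
    (1 + X ^ 2) / X ^ 3 * Real.exp ((12 * X + 1) ^ (2 - δ)) *
      (16 * X ^ 2 * k ^ 2 / Real.sinh (k * X) ^ 2) ≤ 4096 * Real.exp (-(k * X / 2)) := by
  have h1 : 0 < 1 - δ := by linarith
  have hk1 : 1 ≤ k / 169 := by rw [le_div_iff₀ (by norm_num)]; linarith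
  have hX1 : 1 ≤ X := by rw [hX]; exact Real.one_le_rpow hk1 (by positivity)
  have hX0 : 0 < X := by linarith
  have hXp : X ^ (1 - δ) = k / 169 := by
    rw [hX, ← Real.rpow_mul (by linarith), one_div_mul_cancel h1.ne', Real.rpow_one]
  have e1 : (12 * X + 1) ^ (2 - δ) ≤ k * X := by
    calc (12 * X + 1) ^ (2 - δ) ≤ (13 * X) ^ (2 - δ) :=
          Real.rpow_le_rpow (by positivity) (by linarith) (by linarith)
      _ = 13 ^ (2 - δ) * X ^ (2 - δ) := Real.mul_rpow (by norm_num) hX0.le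
      _ ≤ 13 ^ (2 : ℝ) * X ^ (2 - δ) := by
          gcongr
          · norm_num
          · linarith
      _ = 169 * (X ^ (1 - δ) * X) := by
          rw [show 2 - δ = (1 - δ) + 1 by ring, Real.rpow_add_one hX0.ne']
          norm_num
      _ = k * X := by rw [hXp]; ring
  set Y := k * X with hY
  have hY1 : 1 ≤ Y := by nlinarith
  have e2 : Real.exp Y / 4 ≤ Real.sinh Y := by
    rw [Real.sinh_eq]
    have : Real.exp (-Y) ≤ 1 := Real.exp_le_one_iff.2 (by linarith)
    have := Real.add_one_le_exp Y
    linarith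
  have e3 : Y ^ 2 ≤ 8 * Real.exp (Y / 2) := by
    have := Real.quadratic_le_exp_of_nonneg (show 0 ≤ Y / 2 by linarith)
    nlinarith
  calc (1 + X ^ 2) / X ^ 3 * Real.exp ((12 * X + 1) ^ (2 - δ)) *
      (16 * X ^ 2 * k ^ 2 / Real.sinh Y ^ 2)
      ≤ (1 + X ^ 2) / X ^ 3 * Real.exp Y * (16 * X ^ 2 * k ^ 2 / (Real.exp Y / 4) ^ 2) := by gcongr
    _ = 256 * ((1 + X ^ 2) / X * k ^ 2) * (Real.exp Y)⁻¹ := by field_simp; ring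
    _ ≤ 256 * (2 * Y ^ 2) * (Real.exp Y)⁻¹ := by
        have : (1 + X ^ 2) / X * k ^ 2 ≤ 2 * Y ^ 2 := by
          rw [div_mul_eq_mul_div, div_le_iff₀ hX0, hY]
          have : 1 + X ^ 2 ≤ 2 * X ^ 2 * X := by nlinarith
          nlinarith [sq_nonneg k]
        gcongr
    _ ≤ 256 * (2 * (8 * Real.exp (Y / 2))) * (Real.exp Y)⁻¹ := by gcongr
    _ = 4096 * Real.exp (-(Y / 2)) := by
        rw [← Real.exp_neg, show -(Y / 2) = Y / 2 + -Y by ring, Real.exp_add]; ring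

lemma isBigO_exp_rpow {γ C : ℝ} (hγ : 1 < γ) (hC : 0 < C) (c : ℝ) :
    (fun t : ℝ => Real.exp (-C * |t| ^ γ)) =O[atBot] fun t : ℝ => Real.exp (c * t) := by
  apply IsBigO.of_bound 1
  have h1 : Tendsto (fun t : ℝ => |t| ^ (γ - 1)) atBot atTop :=
    (tendsto_rpow_atTop (by linarith)).comp tendsto_abs_atBot_atTop
  filter_upwards [h1.eventually_ge_atTop (|c| / C), eventually_lt_atBot 0] with t ht ht0
  rw [Real.norm_of_nonneg (Real.exp_nonneg _), Real.norm_of_nonneg (Real.exp_nonneg _), one_mul]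
  apply Real.exp_le_exp.2
  have ha : 0 < |t| := abs_pos.2 ht0.ne
  rw [div_le_iff₀ hC] at ht
  have : |t| ^ γ = |t| ^ (γ - 1) * |t| := by
    rw [← Real.rpow_add_one ha.ne']; congr 1; ring
  rw [this]
  have h3 : |c * t| ≤ |t| ^ (γ - 1) * C * |t| := by rw [abs_mul]; gcongr
  have := neg_abs_le (c * t)
  nlinarith

/-- On a unit step the exponential is at most `exp(c(n + 1))`; compare with the mass of `Iic (-n)`,
which decays at rate `c + 1`. -/
lemma integrableOn_exp_of_tail {ν : Measure ℝ} (hfin : ∀ t, ν (Set.Iic t) < ⊤)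
    (hO : ∀ c, (fun t : ℝ => ν.real (Set.Iic t)) =O[atBot] fun t : ℝ => Real.exp (c * t)) (c : ℝ) :
    IntegrableOn (fun t => Real.exp (-(c * t))) (Set.Iic 0) ν := by
  wlog hc : 0 ≤ c generalizing c
  · have h0 := this 0 le_rfl
    simp only [zero_mul, neg_zero, Real.exp_zero] at h0
    refine h0.mono' (by fun_prop) ((ae_restrict_iff' measurableSet_Iic).2
      (Eventually.of_forall fun t ht => ?_))
    rw [Real.norm_of_nonneg (Real.exp_nonneg _), Real.exp_le_one_iff]
    rw [Set.mem_Iic] at ht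
    nlinarith
  refine ⟨by fun_prop, ?_⟩
  rw [hasFiniteIntegral_iff_ofReal (Eventually.of_forall fun t => Real.exp_nonneg _)]
  have hs : Summable fun n : ℕ => Real.exp (c * (n + 1)) * ν.real (Set.Iic (-(n : ℝ))) := by
    have h1 : (fun n : ℕ => ν.real (Set.Iic (-(n : ℝ)))) =O[atTop]
        fun n : ℕ => Real.exp ((c + 1) * -(n : ℝ)) :=
      (hO (c + 1)).comp_tendsto (tendsto_neg_atTop_atBot.comp tendsto_natCast_atTop_atTop)
    refine summable_of_isBigO_nat ((Real.summable_exp_neg_nat).mul_left (Real.exp c)) ?_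
    refine ((isBigO_refl (fun n : ℕ => Real.exp (c * (n + 1))) atTop).mul h1).congr_right fun n => ?_
    rw [← Real.exp_add, ← Real.exp_add]
    ring_nf
  calc ∫⁻ t in Set.Iic 0, ENNReal.ofReal (Real.exp (-(c * t))) ∂ν
      ≤ ∫⁻ t in Set.Iic 0, ∑' n : ℕ, (Set.Iic (-(n : ℝ))).indicator
          (fun _ => ENNReal.ofReal (Real.exp (c * (n + 1)))) t ∂ν := by
        refine setLIntegral_mono' measurableSet_Iic fun t ht => ?_
        rw [Set.mem_Iic] at ht
        have hf : (⌊-t⌋₊ : ℝ) ≤ -t := Nat.floor_le (by linarith)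
        refine le_trans ?_ (ENNReal.le_tsum ⌊-t⌋₊)
        rw [Set.indicator_of_mem (by rw [Set.mem_Iic]; linarith)]
        gcongr
        have := (Nat.lt_floor_add_one (-t)).le
        nlinarith
    _ ≤ ∫⁻ t, ∑' n : ℕ, (Set.Iic (-(n : ℝ))).indicator
          (fun _ => ENNReal.ofReal (Real.exp (c * (n + 1)))) t ∂ν := setLIntegral_le_lintegral _ _
    _ = ∑' n : ℕ, ENNReal.ofReal (Real.exp (c * (n + 1)) * ν.real (Set.Iic (-(n : ℝ)))) := by
        rw [lintegral_tsum fun n => (measurable_const.indicator measurableSet_Iic).aemeasurable]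
        refine tsum_congr fun n => ?_
        rw [lintegral_indicator measurableSet_Iic, setLIntegral_const,
          ENNReal.ofReal_mul (Real.exp_nonneg _), ofReal_measureReal (hfin _).ne]
    _ < ⊤ := by
        rw [← ENNReal.ofReal_tsum_of_nonneg (fun n => by positivity) hs]
        exact ENNReal.ofReal_lt_top

namespace EdgeAsymptotics

variable {μ : ℕ → Measure ℝ} {s : ℕ → ℝ} {φR φL : ℝ → ℝ} {ε : ℕ → ℕ → ℝ}
  {𝒰 : Ultrafilter ℕ} {ν : Measure ℝ}

lemma limit_left_tail (h : EdgeAsymptotics μ s φR φL ε) {δ : ℝ} (hδ0 : 0 < δ) (hδ : δ < 1)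
    (hR : EdgeProfile δ φR) (hL : EdgeProfile δ φL) (hU : (𝒰 : Filter ℕ) ≤ atTop) [ν.Regular]
    (hν : VagueTendsto (fun N => edgeMeasure (μ N) (s N)) 𝒰 ν) :
    (∀ t, ν (Set.Iic t) < ⊤) ∧
    ∃ C' : ℝ, 0 < C' ∧ (fun t : ℝ => ν.real (Set.Iic t)) =O[atBot]
      (fun t : ℝ => Real.exp (-C' * |t| ^ ((1 - δ / 2) / (1 - δ)))) := by
  obtain ⟨C, hC, hb⟩ := h.exists_limit_tail_le hδ hR hL hU hν
  have h1 : 0 < 1 - δ := by linarith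
  set γ := (1 - δ / 2) / (1 - δ) with hγ
  have hγ0 : 0 < γ := div_pos (by linarith) h1
  have key : ∀ k, 169 ≤ k → ν (Set.Iio (-k ^ 2)) ≤ ENNReal.ofReal
      (4096 * C * Real.exp (-(k * (k / 169) ^ (1 / (1 - δ)) / 2))) := by
    intro k hk
    have hX : 0 < (k / 169) ^ (1 / (1 - δ)) := Real.rpow_pos_of_pos (by linarith) _
    refine (hb _ k hX (by linarith)).trans (ENNReal.ofReal_le_ofReal ?_)
    rw [mul_assoc C]
    have := mul_le_mul_of_nonneg_left (gaussian_tail_bound hδ0 hδ hk rfl) hC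
    refine this.trans (le_of_eq ?_)
    ring
  have hfin : ∀ t, ν (Set.Iic t) < ⊤ := by
    intro t
    have hsub : Set.Iic t ⊆ Set.Iio (-169 ^ 2) ∪ Set.Icc (-169 ^ 2) t := by
      intro x hx
      rcases lt_or_ge x (-169 ^ 2) with q | q
      · exact Or.inl q
      · exact Or.inr ⟨q, hx⟩
    refine (measure_mono hsub).trans_lt ((measure_union_le _ _).trans_lt ?_)
    exact ENNReal.add_lt_top.2 ⟨(key 169 le_rfl).trans_lt ENNReal.ofReal_lt_top,
      isCompact_Icc.measure_lt_top⟩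
  refine ⟨hfin, (1 / 2 : ℝ) ^ γ * (1 / 169) ^ (1 / (1 - δ)) / 2, by positivity, ?_⟩
  apply IsBigO.of_bound (4096 * C)
  filter_upwards [eventually_le_atBot (-(2 * 169 ^ 2 : ℝ))] with t ht
  rw [Real.norm_of_nonneg measureReal_nonneg, Real.norm_of_nonneg (Real.exp_nonneg _)]
  have ht0 : 0 < -t / 2 := by linarith
  -- Half of `-t`, so that the closed half-line `Iic t` lies in the open one `Iio (-k²)`. Then `k ·
  -- k^(1/(1-δ)) = k^(2γ)` is a multiple of `|t|^γ`.
  set k := √(-t / 2) with hk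
  have hk2 : k ^ 2 = -t / 2 := Real.sq_sqrt ht0.le
  have hk0 : 169 ≤ k := Real.le_sqrt_of_sq_le (by linarith)
  have hkp : 0 < k := by linarith
  have e : k * (k / 169) ^ (1 / (1 - δ)) = (1 / 2 : ℝ) ^ γ * (1 / 169) ^ (1 / (1 - δ)) * |t| ^ γ := by
    have e1 : |t| = 2 * k ^ 2 := by rw [abs_of_neg (by linarith), hk2]; ring
    have e2 : 1 + 1 / (1 - δ) = 2 * γ := by rw [hγ]; field_simp; ring
    rw [e1, Real.mul_rpow (by norm_num) (by positivity), ← Real.rpow_natCast k 2,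
      ← Real.rpow_mul hkp.le, Nat.cast_ofNat, ← e2, Real.rpow_add hkp, Real.rpow_one,
      div_eq_mul_one_div k, Real.mul_rpow hkp.le (by norm_num), Real.div_rpow (by norm_num) (by norm_num),
      Real.one_rpow]
    have : (2 : ℝ) ^ γ ≠ 0 := by positivity
    field_simp
    rw [← Real.mul_rpow (by norm_num) (by norm_num)]
    norm_num
  have k1 : ν (Set.Iic t) ≤ ENNReal.ofReal
      (4096 * C * Real.exp (-(k * (k / 169) ^ (1 / (1 - δ)) / 2))) := by
    refine (measure_mono fun x hx => ?_).trans (key k hk0)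
    rw [Set.mem_Iio, hk2]
    linarith [Set.mem_Iic.1 hx]
  have k2 := ENNReal.toReal_mono ENNReal.ofReal_ne_top k1
  rw [ENNReal.toReal_ofReal (by positivity)] at k2
  refine k2.trans (le_of_eq ?_)
  congr 2
  rw [e]
  ring

lemma limit_integrableOn_exp (h : EdgeAsymptotics μ s φR φL ε) {δ : ℝ} (hδ0 : 0 < δ) (hδ : δ < 1)
    (hR : EdgeProfile δ φR) (hL : EdgeProfile δ φL) (hU : (𝒰 : Filter ℕ) ≤ atTop) [ν.Regular]
    (hν : VagueTendsto (fun N => edgeMeasure (μ N) (s N)) 𝒰 ν) (c : ℝ) :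
    IntegrableOn (fun t => Real.exp (-(c * t))) (Set.Iic 0) ν := by
  obtain ⟨h1, C, hC, h2⟩ := h.limit_left_tail hδ0 hδ hR hL hU hν
  refine integrableOn_exp_of_tail h1 (fun c => h2.trans (isBigO_exp_rpow ?_ hC c)) c
  rw [lt_div_iff₀ (by linarith)]
  linarith

end EdgeAsymptotics

/-! ### Modulated Gaussians and smooth cutoffs -/

lemma Polynomial.exists_abs_eval_le_exp_sq (p : Polynomial ℝ) {c : ℝ} (hc : 0 < c) :
    ∃ C, 0 ≤ C ∧ ∀ x : ℝ, |p.eval x| ≤ C * Real.exp (c * x ^ 2) := by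
  induction p using Polynomial.induction_on' with
  | add p q hp hq =>
    obtain ⟨C, hC, h1⟩ := hp
    obtain ⟨D, hD, h2⟩ := hq
    refine ⟨C + D, by positivity, fun x => ?_⟩
    rw [Polynomial.eval_add, add_mul]
    exact (abs_add_le _ _).trans (add_le_add (h1 x) (h2 x))
  | monomial n a =>
    refine ⟨|a| * (1 + n.factorial / c ^ n), by positivity, fun x => ?_⟩
    rw [Polynomial.eval_monomial, abs_mul, mul_assoc]
    gcongr
    have h1 : |x ^ n| ≤ 1 + (x ^ 2) ^ n := by
      rw [← pow_mul, mul_comm, pow_mul]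
      nlinarith [sq_nonneg (|x ^ n| - 1), sq_abs (x ^ n)]
    have h2 := Real.pow_div_factorial_le_exp (c * x ^ 2) (by positivity) n
    have h3 : (x ^ 2) ^ n ≤ n.factorial / c ^ n * Real.exp (c * x ^ 2) := by
      rw [div_mul_eq_mul_div, le_div_iff₀ (by positivity)]
      rw [div_le_iff₀ (by positivity), mul_pow] at h2
      linarith
    have h4 : 1 ≤ Real.exp (c * x ^ 2) := Real.one_le_exp (by positivity)
    linarith

/-- Polynomial multiples of modulated Gaussians. -/
noncomputable def gaussTrig (b u : ℝ) (p q : Polynomial ℝ) (x : ℝ) : ℝ :=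
  Real.exp (-b * x ^ 2) * (p.eval x * Real.cos (u * x) + q.eval x * Real.sin (u * x))

section gaussTrig

variable (b u : ℝ) (p q : Polynomial ℝ)

/-- The class is closed under differentiation, so all derivatives have Gaussian bounds. -/
lemma hasDerivAt_gaussTrig (x : ℝ) : HasDerivAt (gaussTrig b u p q)
    (gaussTrig b u (p.derivative - Polynomial.C (2 * b) * Polynomial.X * p + Polynomial.C u * q)
      (q.derivative - Polynomial.C (2 * b) * Polynomial.X * q - Polynomial.C u * p) x) x := by
  have h1 : HasDerivAt (fun x : ℝ => Real.exp (-b * x ^ 2)) (Real.exp (-b * x ^ 2) * (-b * (2 * x))) x := by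
    have := ((hasDerivAt_pow 2 x).const_mul (-b)).exp
    simpa using this
  have h2 : HasDerivAt (fun x : ℝ => Real.cos (u * x)) (-Real.sin (u * x) * u) x := by
    have := ((hasDerivAt_id x).const_mul u).cos
    simpa using this
  have h3 : HasDerivAt (fun x : ℝ => Real.sin (u * x)) (Real.cos (u * x) * u) x := by
    have := ((hasDerivAt_id x).const_mul u).sin
    simpa using this
  refine (h1.mul (((p.hasDerivAt x).mul h2).add ((q.hasDerivAt x).mul h3))).congr_deriv ?_
  simp only [gaussTrig, Pi.add_apply, Pi.mul_apply, Polynomial.eval_sub, Polynomial.eval_add,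
    Polynomial.eval_mul, Polynomial.eval_C, Polynomial.eval_X]
  ring

lemma exists_iteratedDeriv_gaussTrig (n : ℕ) :
    ∃ p' q', iteratedDeriv n (gaussTrig b u p q) = gaussTrig b u p' q' := by
  induction n with
  | zero => exact ⟨p, q, iteratedDeriv_zero⟩
  | succ n ih =>
    obtain ⟨p', q', h⟩ := ih
    exact ⟨_, _, by rw [iteratedDeriv_succ, h]; exact funext fun x => (hasDerivAt_gaussTrig b u p' q' x).deriv⟩

lemma contDiff_gaussTrig {n : ℕ∞} : ContDiff ℝ n (gaussTrig b u p q) := by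
  apply contDiff_of_differentiable_iteratedDeriv
  intro m _
  obtain ⟨p', q', h⟩ := exists_iteratedDeriv_gaussTrig b u p q m
  rw [h]
  exact fun x => (hasDerivAt_gaussTrig b u p' q' x).differentiableAt

variable {b} in
lemma exists_gaussTrig_le (hb : 0 < b) :
    ∃ C, 0 ≤ C ∧ ∀ x, |gaussTrig b u p q x| ≤ C * Real.exp (-(b / 2) * x ^ 2) := by
  obtain ⟨C, hC, h1⟩ := p.exists_abs_eval_le_exp_sq (show 0 < b / 2 by positivity)
  obtain ⟨D, hD, h2⟩ := q.exists_abs_eval_le_exp_sq (show 0 < b / 2 by positivity)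
  refine ⟨C + D, by positivity, fun x => ?_⟩
  have e : Real.exp (-(b / 2) * x ^ 2) = Real.exp (-b * x ^ 2) * Real.exp (b / 2 * x ^ 2) := by
    rw [← Real.exp_add]; ring_nf
  rw [gaussTrig, abs_mul, Real.abs_exp, e]
  have h3 : |p.eval x * Real.cos (u * x) + q.eval x * Real.sin (u * x)| ≤
      (C + D) * Real.exp (b / 2 * x ^ 2) := by
    refine (abs_add_le _ _).trans ?_
    rw [abs_mul, abs_mul, add_mul]
    exact add_le_add ((mul_le_of_le_one_right (abs_nonneg _) (Real.abs_cos_le_one _)).trans (h1 x))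
      ((mul_le_of_le_one_right (abs_nonneg _) (Real.abs_sin_le_one _)).trans (h2 x))
  calc _ ≤ Real.exp (-b * x ^ 2) * ((C + D) * Real.exp (b / 2 * x ^ 2)) := by gcongr
    _ = _ := by ring

end gaussTrig

/-- Even smooth cutoff, `1` on `[-1, 1]` and `0` off `[-2, 2]`. -/
noncomputable def smoothCutoff (x : ℝ) : ℝ := Real.smoothTransition (2 - x ^ 2)

lemma contDiff_smoothCutoff {n : ℕ∞} : ContDiff ℝ n smoothCutoff :=
  Real.smoothTransition.contDiff.comp (contDiff_const.sub (contDiff_id.pow 2))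

lemma smoothCutoff_neg (x : ℝ) : smoothCutoff (-x) = smoothCutoff x := by
  rw [smoothCutoff, neg_sq, smoothCutoff]

lemma smoothCutoff_eq_one {x : ℝ} (hx : |x| ≤ 1) : smoothCutoff x = 1 := by
  apply Real.smoothTransition.one_of_one_le
  have := (sq_le_one_iff_abs_le_one x).2 hx
  linarith

lemma smoothCutoff_eq_zero {x : ℝ} (hx : 2 ≤ |x|) : smoothCutoff x = 0 := by
  apply Real.smoothTransition.zero_of_nonpos
  rw [← sq_abs]
  nlinarith

lemma exists_iteratedDeriv_smoothCutoff_le (n : ℕ) :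
    ∃ M, 0 ≤ M ∧ ∀ x, |iteratedDeriv n smoothCutoff x| ≤ M := by
  have hc : HasCompactSupport smoothCutoff := by
    apply HasCompactSupport.of_support_subset_isCompact (isCompact_Icc (a := -2) (b := 2))
    intro x hx
    rw [Set.mem_Icc, ← abs_le]
    by_contra h
    exact hx (smoothCutoff_eq_zero (le_of_not_ge h))
  obtain ⟨M, hM⟩ := ((contDiff_smoothCutoff (n := n)).continuous_iteratedFDeriv le_rfl).bounded_above_of_compact_support
    (hc.iteratedFDeriv (𝕜 := ℝ) n)
  refine ⟨M, (norm_nonneg _).trans (hM 0), fun x => ?_⟩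
  rw [← Real.norm_eq_abs, ← norm_iteratedFDeriv_eq_norm_iteratedDeriv]
  exact hM x

section cut

variable {b u : ℝ} {p q : Polynomial ℝ}

lemma edgeTest_gaussTrig_mul (hodd : ∀ x, gaussTrig b u p q (-x) = -gaussTrig b u p q x) {R : ℝ}
    (hR : 0 < R) : EdgeTest (fun x => gaussTrig b u p q x * smoothCutoff (R⁻¹ * x)) (2 * R) where
  pos := by positivity
  contDiff := (contDiff_gaussTrig b u p q (n := 4)).mul
    ((contDiff_smoothCutoff (n := 4)).comp (contDiff_const.mul contDiff_id))
  odd x := by rw [hodd, mul_neg, smoothCutoff_neg, neg_mul]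
  eq_zero x hx := by
    rw [smoothCutoff_eq_zero, mul_zero]
    refine le_trans ?_ (le_abs_self _)
    rw [← div_eq_inv_mul, le_div_iff₀ hR]
    exact hx

/-- Leibniz rule; for `R ≥ 1` the powers of `R⁻¹` from the cutoff are at most `1`, so the bound is
uniform in `R`. -/
lemma exists_iteratedDeriv_gaussTrig_mul_le (u : ℝ) (p q : Polynomial ℝ) (hb : 0 < b) (n : ℕ) :
    ∃ C, 0 ≤ C ∧ ∀ R, 1 ≤ R → ∀ x,
      |iteratedDeriv n (fun x => gaussTrig b u p q x * smoothCutoff (R⁻¹ * x)) x| ≤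
        C * Real.exp (-(b / 2) * x ^ 2) := by
  have h1 : ∀ i, ∃ C, 0 ≤ C ∧ ∀ x, |iteratedDeriv i (gaussTrig b u p q) x| ≤
      C * Real.exp (-(b / 2) * x ^ 2) := by
    intro i
    obtain ⟨p', q', h⟩ := exists_iteratedDeriv_gaussTrig b u p q i
    rw [h]
    exact exists_gaussTrig_le u p' q' hb
  choose C hC h1 using h1
  choose M hM h2 using exists_iteratedDeriv_smoothCutoff_le
  refine ⟨∑ i ∈ Finset.range (n + 1), (n.choose i : ℝ) * C i * M (n - i),
    Finset.sum_nonneg fun i _ => by have := hC i; have := hM (n - i); positivity, fun R hR x => ?_⟩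
  have hcut : ContDiff ℝ n fun x : ℝ => smoothCutoff (R⁻¹ * x) :=
    (contDiff_smoothCutoff (n := n)).comp (contDiff_const.mul contDiff_id)
  have h3 := norm_iteratedFDeriv_mul_le (𝕜 := ℝ) (contDiff_gaussTrig b u p q (n := n)) hcut x le_rfl
  rw [norm_iteratedFDeriv_eq_norm_iteratedDeriv, Real.norm_eq_abs] at h3
  refine h3.trans ?_
  rw [Finset.sum_mul]
  refine Finset.sum_le_sum fun i _ => ?_
  rw [norm_iteratedFDeriv_eq_norm_iteratedDeriv, norm_iteratedFDeriv_eq_norm_iteratedDeriv,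
    iteratedDeriv_comp_const_mul contDiff_smoothCutoff, norm_mul, norm_pow, Real.norm_eq_abs,
    Real.norm_eq_abs, Real.norm_eq_abs]
  have h4 : |R⁻¹| ^ (n - i) ≤ 1 := by
    apply pow_le_one₀ (abs_nonneg _)
    rw [abs_of_nonneg (by positivity)]
    exact inv_le_one_of_one_le₀ hR
  have k1 := h1 i x
  have k2 := h2 (n - i) (R⁻¹ * x)
  have k3 : |R⁻¹| ^ (n - i) * |iteratedDeriv (n - i) smoothCutoff (R⁻¹ * x)| ≤ 1 * M (n - i) := by
    gcongr
  calc _ ≤ (n.choose i : ℝ) * (C i * Real.exp (-(b / 2) * x ^ 2)) * (1 * M (n - i)) := by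
        gcongr
        have := hC i
        positivity
    _ = _ := by ring

end cut

/-! ### The transform: integration by parts and domination -/

/-- The `x`-derivative of `edgeSin x t`: `cos (√t x)` or `cosh (√(-t) x)`. -/
noncomputable def edgeCos (x t : ℝ) : ℝ :=
  if 0 ≤ t then Real.cos (√t * x) else Real.cosh (√(-t) * x)

lemma edgeCos_sq (x : ℝ) {k : ℝ} (hk : 0 ≤ k) : edgeCos x (k ^ 2) = Real.cos (k * x) := by
  rw [edgeCos, if_pos (by positivity), Real.sqrt_sq hk]

lemma edgeCos_neg_sq (x : ℝ) {k : ℝ} (hk : 0 < k) : edgeCos x (-k ^ 2) = Real.cosh (k * x) := by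
  rw [edgeCos, if_neg (by rw [not_le]; exact neg_neg_of_pos (by positivity)), neg_neg,
    Real.sqrt_sq hk.le]

lemma eq_sq_or_neg_sq (t : ℝ) : (∃ k, 0 ≤ k ∧ t = k ^ 2) ∨ ∃ k, 0 < k ∧ t = -k ^ 2 := by
  rcases le_or_gt 0 t with h | h
  · exact Or.inl ⟨√t, Real.sqrt_nonneg _, (Real.sq_sqrt h).symm⟩
  · exact Or.inr ⟨√(-t), Real.sqrt_pos.2 (by linarith), by rw [Real.sq_sqrt (by linarith)]; ring⟩

lemma hasDerivAt_edgeSin (x t : ℝ) : HasDerivAt (fun x => edgeSin x t) (edgeCos x t) x := by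
  rcases eq_sq_or_neg_sq t with ⟨k, hk, rfl⟩ | ⟨k, hk, rfl⟩
  · rcases hk.eq_or_lt with rfl | hk'
    · rw [edgeCos_sq x le_rfl, zero_mul, Real.cos_zero]
      simpa [edgeSin_zero] using hasDerivAt_id' x
    · simp only [edgeSin_of_pos _ hk', edgeCos_sq x hk]
      have := (((hasDerivAt_id x).const_mul k).sin).div_const k
      simpa [hk'.ne'] using this
  · simp only [edgeSin_of_neg _ hk, edgeCos_neg_sq x hk]
    have := (((hasDerivAt_id x).const_mul k).sinh).div_const k
    simpa [hk.ne'] using this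

lemma hasDerivAt_edgeCos (x t : ℝ) : HasDerivAt (fun x => edgeCos x t) (-t * edgeSin x t) x := by
  rcases eq_sq_or_neg_sq t with ⟨k, hk, rfl⟩ | ⟨k, hk, rfl⟩
  · simp only [edgeCos_sq _ hk]
    have := ((hasDerivAt_id x).const_mul k).cos
    refine this.congr_deriv ?_
    simp only [id, mul_one]
    linear_combination k * edgeSin_sq_mul x k
  · simp only [edgeCos_neg_sq _ hk]
    have := ((hasDerivAt_id x).const_mul k).cosh
    refine this.congr_deriv ?_
    simp only [id, mul_one]
    linear_combination (-k) * edgeSin_neg_sq_mul x k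

lemma continuous_edgeSin_left (t : ℝ) : Continuous fun x => edgeSin x t :=
  continuous_iff_continuousAt.2 fun x => (hasDerivAt_edgeSin x t).continuousAt

lemma continuous_edgeCos_left (t : ℝ) : Continuous fun x => edgeCos x t :=
  continuous_iff_continuousAt.2 fun x => (hasDerivAt_edgeCos x t).continuousAt

lemma edgeSin_zero_left (t : ℝ) : edgeSin 0 t = 0 := by
  simp [edgeSin]

lemma abs_edgeCos_le {x : ℝ} (hx : 0 ≤ x) (t : ℝ) : |edgeCos x t| ≤ Real.exp (√(-t) * x) := by
  rw [edgeCos]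
  split_ifs with h
  · exact (Real.abs_cos_le_one _).trans (Real.one_le_exp (by positivity))
  · rw [abs_of_pos (Real.cosh_pos _), Real.cosh_eq]
    have : Real.exp (-(√(-t) * x)) ≤ Real.exp (√(-t) * x) := by
      apply Real.exp_le_exp.2
      have : 0 ≤ √(-t) * x := by positivity
      linarith
    linarith

lemma abs_edgeSin_le_mul_exp {x : ℝ} (hx : 0 ≤ x) (t : ℝ) :
    |edgeSin x t| ≤ x * Real.exp (√(-t) * x) := by
  have h := Convex.norm_image_sub_le_of_norm_hasDerivWithin_le (s := Set.Icc 0 x)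
    (f := fun y => edgeSin y t) (f' := fun y => edgeCos y t) (C := Real.exp (√(-t) * x))
    (fun y _ => (hasDerivAt_edgeSin y t).hasDerivWithinAt)
    (fun y hy => (abs_edgeCos_le hy.1 t).trans (by gcongr; exact hy.2)) (convex_Icc 0 x)
    (Set.left_mem_Icc.2 hx) (Set.right_mem_Icc.2 hx)
  rw [edgeSin_zero_left, sub_zero, sub_zero, Real.norm_eq_abs, Real.norm_of_nonneg hx] at h
  linarith

/-- Integration by parts twice. -/
lemma integral_mul_edgeSin {g g' g'' : ℝ → ℝ} {R : ℝ} (t : ℝ)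
    (h1 : ∀ x, HasDerivAt g (g' x) x) (h2 : ∀ x, HasDerivAt g' (g'' x) x) (h3 : Continuous g'')
    (h0 : g 0 = 0) (hR : g R = 0) (hR' : g' R = 0) :
    t * ∫ x in (0 : ℝ)..R, g x * edgeSin x t = -∫ x in (0 : ℝ)..R, g'' x * edgeSin x t := by
  have c1 : Continuous g := continuous_iff_continuousAt.2 fun x => (h1 x).continuousAt
  have c2 := continuous_edgeSin_left t
  have hd : ∀ x ∈ Set.uIcc 0 R, HasDerivAt (fun x => g' x * edgeSin x t - g x * edgeCos x t)
      (g'' x * edgeSin x t + t * (g x * edgeSin x t)) x := fun x _ => by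
    refine (((h2 x).mul (hasDerivAt_edgeSin x t)).sub
      ((h1 x).mul (hasDerivAt_edgeCos x t))).congr_deriv ?_
    ring
  have := intervalIntegral.integral_eq_sub_of_hasDerivAt hd
    ((by fun_prop : Continuous fun x => g'' x * edgeSin x t + t * (g x * edgeSin x t)).intervalIntegrable _ _)
  rw [intervalIntegral.integral_add ((by fun_prop : Continuous fun x => g'' x * edgeSin x t).intervalIntegrable _ _)
    ((by fun_prop : Continuous fun x => t * (g x * edgeSin x t)).intervalIntegrable _ _),
    intervalIntegral.integral_const_mul, h0, hR, hR', edgeSin_zero_left] at this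
  linarith

/-- `edgeSin` solves `y'' = -t y`, so each factor `t` becomes two derivatives on `a`. At `0` the
function and its second derivative vanish by oddness; the endpoint `R + 1` has a neighbourhood where
`a` is zero, so all derivatives vanish there. -/
lemma EdgeTest.sq_mul_edgeTransform {a : ℝ → ℝ} {R : ℝ} (ha : EdgeTest a R) (t : ℝ) :
    t ^ 2 * edgeTransform a t = ∫ x in (0 : ℝ)..R + 1, iteratedDeriv 4 a x * edgeSin x t := by
  have hd : ∀ n : ℕ, n < 4 → ∀ x, HasDerivAt (iteratedDeriv n a) (iteratedDeriv (n + 1) a x) x := by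
    intro n hn x
    have := (ha.contDiff.differentiable_iteratedDeriv n (by exact_mod_cast hn)) x
    rw [iteratedDeriv_succ]
    exact this.hasDerivAt
  have hc : ∀ n : ℕ, n ≤ 4 → Continuous (iteratedDeriv n a) := fun n hn =>
    ha.contDiff.continuous_iteratedDeriv n (by exact_mod_cast hn)
  have hz : ∀ n : ℕ, iteratedDeriv n a (R + 1) = 0 := by
    intro n
    have : a =ᶠ[𝓝 (R + 1)] fun _ => 0 := by
      filter_upwards [eventually_gt_nhds (show R < R + 1 by linarith)] with x hx
      exact ha.eq_zero x hx.le
    rw [this.iteratedDeriv_eq]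
    simp
  have h20 : iteratedDeriv 2 a 0 = 0 := by
    have h := iteratedDeriv_comp_neg 2 a 0
    have e : (fun x => a (-x)) = fun x => -a x := funext ha.odd
    rw [e, iteratedDeriv_fun_neg] at h
    simp at h
    linarith
  have e1 := integral_mul_edgeSin (R := R + 1) t (g := a) (g' := iteratedDeriv 1 a)
    (g'' := iteratedDeriv 2 a) (by simpa using hd 0 (by norm_num)) (hd 1 (by norm_num))
    (hc 2 (by norm_num)) ha.zero (by simpa using hz 0) (hz 1)
  have e2 := integral_mul_edgeSin (R := R + 1) t (hd 2 (by norm_num)) (hd 3 (by norm_num))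
    (hc 4 (by norm_num)) h20 (hz 2) (hz 3)
  have e3 : edgeTransform a t = ∫ x in (0 : ℝ)..R + 1, a x * edgeSin x t := by
    have := ha.pos
    rw [edgeTransform, intervalIntegral.integral_of_le (by linarith)]
    apply setIntegral_eq_of_subset_of_forall_sdiff_eq_zero measurableSet_Ioi Set.Ioc_subset_Ioi_self
    intro x hx
    have : R ≤ x := by
      have h1 := hx.2
      simp only [Set.mem_Ioc, not_and, not_le] at h1
      linarith [h1 hx.1]
    rw [ha.eq_zero x this, zero_mul]
  rw [e3, sq, mul_assoc, e1, mul_neg, e2, neg_neg]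

/-- Since `δ > 0`, `x^(2-δ)` is at most a constant plus `(β/2) x²`, for every `β > 0`: all Gaussian
tests are admissible. -/
lemma EdgeProfile.integrableOn_gaussian {δ : ℝ} (hδ0 : 0 < δ) (hδ : δ < 1) {φ : ℝ → ℝ}
    (h : EdgeProfile δ φ) {β : ℝ} (hβ : 0 < β) :
    IntegrableOn (fun x => Real.exp (-β * x ^ 2) * x * φ x) (Set.Ioi 0) := by
  obtain ⟨C, hC⟩ : ∃ C, ∀ x : ℝ, 0 < x → Real.exp (-β * x ^ 2) * x ≤ C * Real.exp (-x ^ (2 - δ)) := by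
    set x0 := (2 / β) ^ (1 / δ) with hx0
    have hx00 : 0 < x0 := by positivity
    obtain ⟨D, hD, h1⟩ := (Polynomial.X : Polynomial ℝ).exists_abs_eval_le_exp_sq
      (show 0 < β / 2 by positivity)
    refine ⟨D * Real.exp (x0 ^ (2 - δ)), fun x hx => ?_⟩
    have h2 := h1 x
    rw [Polynomial.eval_X, abs_of_pos hx] at h2
    have h3 : x ^ (2 - δ) ≤ x0 ^ (2 - δ) + β / 2 * x ^ 2 := by
      rcases le_total x x0 with q | q
      · have := Real.rpow_le_rpow hx.le q (show 0 ≤ 2 - δ by linarith)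
        have : 0 ≤ β / 2 * x ^ 2 := by positivity
        linarith
      · have k1 : 2 / β ≤ x ^ δ := by
          calc 2 / β = x0 ^ δ := by
                rw [hx0, ← Real.rpow_mul (by positivity), one_div_mul_cancel hδ0.ne', Real.rpow_one]
            _ ≤ x ^ δ := Real.rpow_le_rpow hx00.le q hδ0.le
        have k2 : x ^ (2 - δ) * x ^ δ = x ^ 2 := by
          rw [← Real.rpow_add hx, ← Real.rpow_natCast]; norm_num
        have k3 : 0 < x ^ (2 - δ) := by positivity
        have k4 : x ^ (2 - δ) * (2 / β) ≤ x ^ 2 := by rw [← k2]; gcongr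
        have k5 : x ^ (2 - δ) ≤ β / 2 * x ^ 2 := by
          rw [mul_div_assoc', div_le_iff₀ hβ] at k4; linarith
        have : 0 < x0 ^ (2 - δ) := by positivity
        linarith
    calc Real.exp (-β * x ^ 2) * x ≤ Real.exp (-β * x ^ 2) * (D * Real.exp (β / 2 * x ^ 2)) := by gcongr
      _ = D * Real.exp (-(β / 2 * x ^ 2)) := by
          rw [mul_left_comm, ← Real.exp_add]; ring_nf
      _ ≤ D * Real.exp (x0 ^ (2 - δ) + -x ^ (2 - δ)) := by gcongr; linarith
      _ = _ := by rw [Real.exp_add]; ring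
  have hm : AEStronglyMeasurable φ (volume.restrict (Set.Ioi 0)) :=
    h.continuousOn.aestronglyMeasurable measurableSet_Ioi
  refine (h.integrableOn.const_mul C).mono (by fun_prop) ?_
  refine (ae_restrict_iff' measurableSet_Ioi).2 (Eventually.of_forall fun x hx => ?_)
  have hx' : 0 < x := hx
  have := hC x hx
  rw [norm_mul, Real.norm_of_nonneg (by positivity), norm_mul, norm_mul,
    Real.norm_of_nonneg (Real.exp_nonneg _)]
  calc _ ≤ C * Real.exp (-x ^ (2 - δ)) * ‖φ x‖ := by gcongr
    _ ≤ ‖C‖ * Real.exp (-x ^ (2 - δ)) * ‖φ x‖ := by gcongr; exact le_abs_self C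
    _ = _ := by ring

/-- Completing the square in `√(-t) x` leaves growth only exponential in `-t`, which the limit
measure integrates. -/
lemma mul_exp_mul_edgeSin_le {β x : ℝ} (hβ : 0 < β) (hx : 0 ≤ x) (t : ℝ) :
    Real.exp (-β * x ^ 2) * |edgeSin x t| ≤
      Real.exp (max (-t) 0 / (2 * β)) * (x * Real.exp (-(β / 2) * x ^ 2)) := by
  have h1 := abs_edgeSin_le_mul_exp hx t
  have h2 : √(-t) ^ 2 = max (-t) 0 := Real.sq_sqrt' 
  have h3 : √(-t) * x ≤ max (-t) 0 / (2 * β) + β / 2 * x ^ 2 := by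
    rw [← h2]
    have : 0 ≤ (√(-t) - β * x) ^ 2 / (2 * β) := by positivity
    have e : (√(-t) - β * x) ^ 2 / (2 * β) = √(-t) ^ 2 / (2 * β) + β / 2 * x ^ 2 - √(-t) * x := by
      field_simp; ring
    linarith
  calc _ ≤ Real.exp (-β * x ^ 2) * (x * Real.exp (√(-t) * x)) := by gcongr
    _ ≤ Real.exp (-β * x ^ 2) * (x * Real.exp (max (-t) 0 / (2 * β) + β / 2 * x ^ 2)) := by gcongr
    _ = _ := by
      rw [mul_left_comm, ← Real.exp_add, mul_left_comm, ← Real.exp_add]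
      ring_nf

section domination

variable {β : ℝ} {t : ℝ}

lemma integrableOn_mul_edgeSin (hβ : 0 < β) {a : ℝ → ℝ} (ha : Continuous a) {C : ℝ}
    (hC : ∀ x, |a x| ≤ C * Real.exp (-β * x ^ 2)) :
    IntegrableOn (fun x => a x * edgeSin x t) (Set.Ioi 0) := by
  have c2 := continuous_edgeSin_left t
  have hi := ((integrable_mul_exp_neg_mul_sq (show 0 < β / 2 by positivity)).const_mul
    (C * Real.exp (max (-t) 0 / (2 * β)))).integrableOn (s := Set.Ioi 0)
  refine hi.mono' (by fun_prop) ((ae_restrict_iff' measurableSet_Ioi).2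
    (Eventually.of_forall fun x hx => ?_))
  have hx' : 0 < x := hx
  have hC0 : 0 ≤ C := nonneg_of_mul_nonneg_left ((abs_nonneg _).trans (hC 0)) (Real.exp_pos _)
  rw [norm_mul, Real.norm_eq_abs, Real.norm_eq_abs]
  calc _ ≤ C * Real.exp (-β * x ^ 2) * |edgeSin x t| := by gcongr; exact hC x
    _ ≤ C * (Real.exp (max (-t) 0 / (2 * β)) * (x * Real.exp (-(β / 2) * x ^ 2))) := by
        rw [mul_assoc]; exact mul_le_mul_of_nonneg_left (mul_exp_mul_edgeSin_le hβ hx'.le t) hC0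
    _ = _ := by ring

/-- First moment of a Gaussian on the half-line. -/
noncomputable def gaussMoment (β : ℝ) : ℝ := ∫ x in Set.Ioi 0, x * Real.exp (-β * x ^ 2)

lemma gaussMoment_nonneg (β : ℝ) : 0 ≤ gaussMoment β :=
  setIntegral_nonneg measurableSet_Ioi fun _ hx => mul_nonneg (Set.mem_Ioi.1 hx).le (Real.exp_nonneg _)

lemma setIntegral_abs_mul_edgeSin_le (hβ : 0 < β) {a : ℝ → ℝ} (ha : Continuous a) {C : ℝ}
    (hC : ∀ x, |a x| ≤ C * Real.exp (-β * x ^ 2)) :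
    ∫ x in Set.Ioi 0, |a x * edgeSin x t| ≤
      C * gaussMoment (β / 2) * Real.exp (max (-t) 0 / (2 * β)) := by
  have hi := ((integrable_mul_exp_neg_mul_sq (show 0 < β / 2 by positivity)).const_mul
    (C * Real.exp (max (-t) 0 / (2 * β)))).integrableOn (s := Set.Ioi 0)
  have hC0 : 0 ≤ C := nonneg_of_mul_nonneg_left ((abs_nonneg _).trans (hC 0)) (Real.exp_pos _)
  calc ∫ x in Set.Ioi 0, |a x * edgeSin x t|
      ≤ ∫ x in Set.Ioi 0, C * Real.exp (max (-t) 0 / (2 * β)) * (x * Real.exp (-(β / 2) * x ^ 2)) := by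
        refine setIntegral_mono_on (integrableOn_mul_edgeSin hβ ha hC).abs hi measurableSet_Ioi
          fun x hx => ?_
        have hx' : 0 < x := hx
        rw [abs_mul]
        calc _ ≤ C * Real.exp (-β * x ^ 2) * |edgeSin x t| := by gcongr; exact hC x
          _ ≤ C * (Real.exp (max (-t) 0 / (2 * β)) * (x * Real.exp (-(β / 2) * x ^ 2))) := by
              rw [mul_assoc]; exact mul_le_mul_of_nonneg_left (mul_exp_mul_edgeSin_le hβ hx'.le t) hC0
          _ = _ := by ring
    _ = C * Real.exp (max (-t) 0 / (2 * β)) * gaussMoment (β / 2) := integral_const_mul _ _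
    _ = _ := by ring

lemma abs_edgeTransform_le (hβ : 0 < β) {a : ℝ → ℝ} (ha : Continuous a) {C : ℝ}
    (hC : ∀ x, |a x| ≤ C * Real.exp (-β * x ^ 2)) :
    |edgeTransform a t| ≤ C * gaussMoment (β / 2) * Real.exp (max (-t) 0 / (2 * β)) :=
  (abs_integral_le_integral_abs).trans (setIntegral_abs_mul_edgeSin_le hβ ha hC)

lemma EdgeTest.abs_edgeTransform_le_div (hβ : 0 < β) {a : ℝ → ℝ} {R : ℝ} (ha : EdgeTest a R)
    {C D : ℝ} (hC : ∀ x, |a x| ≤ C * Real.exp (-β * x ^ 2))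
    (hD : ∀ x, |iteratedDeriv 4 a x| ≤ D * Real.exp (-β * x ^ 2)) (ht : 0 ≤ t) :
    |edgeTransform a t| ≤ 2 * (C + D) * gaussMoment (β / 2) * (1 / (1 + max t 0) ^ 2) := by
  have hc4 : Continuous (iteratedDeriv 4 a) := ha.contDiff.continuous_iteratedDeriv 4 le_rfl
  have e : Real.exp (max (-t) 0 / (2 * β)) = 1 := by
    rw [max_eq_right (by linarith), zero_div, Real.exp_zero]
  have h1 := abs_edgeTransform_le hβ ha.continuous hC (t := t)
  have h2 := setIntegral_abs_mul_edgeSin_le hβ hc4 hD (t := t)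
  rw [e, mul_one] at h1 h2
  have h3 : t ^ 2 * |edgeTransform a t| ≤ D * gaussMoment (β / 2) := by
    have hRp := ha.pos
    rw [← abs_of_nonneg (sq_nonneg t), ← abs_mul, ha.sq_mul_edgeTransform t,
      intervalIntegral.integral_of_le (by linarith)]
    refine (abs_integral_le_integral_abs).trans (le_trans ?_ h2)
    exact setIntegral_mono_set (integrableOn_mul_edgeSin hβ hc4 hD).abs
      (Eventually.of_forall fun x => abs_nonneg _) Set.Ioc_subset_Ioi_self.eventuallyLE
  rw [max_eq_left ht, mul_one_div, le_div_iff₀ (by positivity)]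
  have h4 : (1 + t) ^ 2 ≤ 2 + 2 * t ^ 2 := by nlinarith [sq_nonneg (1 - t)]
  have := mul_le_mul_of_nonneg_left h4 (abs_nonneg (edgeTransform a t))
  nlinarith

end domination

/-! ### Extension of the identity to Gaussian tests -/

/-- The properties of the limiting edge measure from which everything else follows. -/
structure EdgeLimit (φ : ℝ → ℝ) (ν : Measure ℝ) : Prop where
  decay : Integrable (fun t => 1 / (1 + max t 0) ^ 2) ν
  exp : ∀ c : ℝ, IntegrableOn (fun t => Real.exp (-(c * t))) (Set.Iic 0) ν
  test : ∀ (a : ℝ → ℝ) (R : ℝ), EdgeTest a R → IntegrableOn (fun x => a x * x * φ x) (Set.Ioi 0) →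
    Integrable (edgeTransform a) ν ∧
      ∫ t, edgeTransform a t ∂ν = deriv a 0 + ∫ x in Set.Ioi 0, a x * x * φ x

namespace EdgeLimit

variable {φ : ℝ → ℝ} {ν : Measure ℝ}

/-- Cut off at radius `n + 1` and let `n → ∞`. Gaussian bounds on the cut functions and their fourth
derivatives, uniform in `n`, dominate the transforms by `(1 + t)⁻²` on the right and by `exp(-t/b)`
on the left. -/
lemma integral_gaussTrig (h : EdgeLimit φ ν) {δ : ℝ} (hδ0 : 0 < δ) (hδ : δ < 1)
    (hφ : EdgeProfile δ φ) {b u : ℝ} (hb : 0 < b) {p q : Polynomial ℝ}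
    (hodd : ∀ x, gaussTrig b u p q (-x) = -gaussTrig b u p q x) :
    Integrable (edgeTransform (gaussTrig b u p q)) ν ∧
      ∫ t, edgeTransform (gaussTrig b u p q) t ∂ν = deriv (gaussTrig b u p q) 0 +
        ∫ x in Set.Ioi 0, gaussTrig b u p q x * x * φ x := by
  set f := gaussTrig b u p q with hf
  set a : ℕ → ℝ → ℝ := fun n x => f x * smoothCutoff (((n : ℝ) + 1)⁻¹ * x) with ha
  have hβ : 0 < b / 2 := by positivity
  have hpos : ∀ n : ℕ, (0 : ℝ) < n + 1 := fun n => by positivity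
  have hat : ∀ n, EdgeTest (a n) (2 * (n + 1)) := fun n => edgeTest_gaussTrig_mul hodd (hpos n)
  obtain ⟨C, hC0, hC⟩ := exists_iteratedDeriv_gaussTrig_mul_le u p q hb 0
  obtain ⟨D, hD0, hD⟩ := exists_iteratedDeriv_gaussTrig_mul_le u p q hb 4
  have hC' : ∀ n x, |a n x| ≤ C * Real.exp (-(b / 2) * x ^ 2) := fun n x => by
    have := hC (n + 1) (by linarith [n.cast_nonneg (α := ℝ)]) x
    rwa [iteratedDeriv_zero] at this
  have hD' : ∀ n x, |iteratedDeriv 4 (a n) x| ≤ D * Real.exp (-(b / 2) * x ^ 2) := fun n x =>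
    hD (n + 1) (by linarith [n.cast_nonneg (α := ℝ)]) x
  have hlim : ∀ x, Tendsto (fun n => a n x) atTop (𝓝 (f x)) := by
    intro x
    apply tendsto_const_nhds.congr'
    filter_upwards [tendsto_natCast_atTop_atTop.eventually_ge_atTop |x|] with n hn
    rw [ha]
    simp only
    rw [smoothCutoff_eq_one, mul_one]
    rw [abs_mul, abs_of_pos (inv_pos.2 (hpos n)), ← div_eq_inv_mul, div_le_one (hpos n)]
    linarith
  have hmφ : AEStronglyMeasurable φ (volume.restrict (Set.Ioi 0)) :=
    hφ.continuousOn.aestronglyMeasurable measurableSet_Ioi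
  have hmul : ∀ n, AEStronglyMeasurable (fun x => a n x * x * φ x) (volume.restrict (Set.Ioi 0)) :=
    fun n => (((hat n).continuous.aestronglyMeasurable.mul continuous_id.aestronglyMeasurable)).mul hmφ
  have hdom := ((hφ.integrableOn_gaussian hδ0 hδ hβ).norm.const_mul C)
  have hle : ∀ n, ∀ᵐ x ∂(volume.restrict (Set.Ioi 0)), ‖a n x * x * φ x‖ ≤
      C * ‖Real.exp (-(b / 2) * x ^ 2) * x * φ x‖ := by
    intro n
    refine Eventually.of_forall fun x => ?_
    rw [norm_mul _ (φ x), norm_mul (a n x), norm_mul _ (φ x), norm_mul (Real.exp _),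
      Real.norm_of_nonneg (Real.exp_nonneg _), ← mul_assoc, ← mul_assoc]
    gcongr
    exact hC' n x
  have hint : ∀ n, IntegrableOn (fun x => a n x * x * φ x) (Set.Ioi 0) := fun n =>
    Integrable.mono' hdom (hmul n) (hle n)
  have hid := fun n => h.test (a n) _ (hat n) (hint n)
  -- the transforms
  have htr : ∀ t, Tendsto (fun n => edgeTransform (a n) t) atTop (𝓝 (edgeTransform f t)) := by
    intro t
    have c2 := continuous_edgeSin_left t
    have hi := ((integrable_mul_exp_neg_mul_sq (show 0 < b / 2 / 2 by positivity)).const_mul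
      (C * Real.exp (max (-t) 0 / (2 * (b / 2))))).integrableOn (s := Set.Ioi 0)
    refine tendsto_integral_of_dominated_convergence _
      (fun n => ((hat n).continuous.mul c2).aestronglyMeasurable) hi (fun n => ?_) ?_
    · refine (ae_restrict_iff' measurableSet_Ioi).2 (Eventually.of_forall fun x hx => ?_)
      have hx' : 0 < x := hx
      rw [norm_mul, Real.norm_eq_abs, Real.norm_eq_abs]
      calc _ ≤ C * Real.exp (-(b / 2) * x ^ 2) * |edgeSin x t| := by gcongr; exact hC' n x
        _ ≤ C * (Real.exp (max (-t) 0 / (2 * (b / 2))) * (x * Real.exp (-(b / 2 / 2) * x ^ 2))) := by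
            rw [mul_assoc]; exact mul_le_mul_of_nonneg_left (mul_exp_mul_edgeSin_le hβ hx'.le t) hC0
        _ = _ := by ring
    · exact Eventually.of_forall fun x => (hlim x).mul_const _
  set E := C * gaussMoment (b / 2 / 2) with hE
  have hE0 : 0 ≤ E := mul_nonneg hC0 (gaussMoment_nonneg _)
  set F := 2 * (C + D) * gaussMoment (b / 2 / 2) with hF
  have hF0 : 0 ≤ F := mul_nonneg (by positivity) (gaussMoment_nonneg _)
  have hBint : Integrable (fun t => F * (1 / (1 + max t 0) ^ 2) +
      E * (Set.Iic 0).indicator (fun t => Real.exp (-(1 / b * t))) t) ν :=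
    (h.decay.const_mul F).add (((integrable_indicator_iff measurableSet_Iic).2 (h.exp _)).const_mul E)
  have hB : ∀ n, ∀ t, ‖edgeTransform (a n) t‖ ≤ F * (1 / (1 + max t 0) ^ 2) +
      E * (Set.Iic 0).indicator (fun t => Real.exp (-(1 / b * t))) t := by
    intro n t
    rw [Real.norm_eq_abs]
    rcases le_or_gt t 0 with ht | ht
    · have h1 := abs_edgeTransform_le hβ (hat n).continuous (hC' n) (t := t)
      rw [Set.indicator_of_mem (show t ∈ Set.Iic 0 from ht)]
      have e : max (-t) 0 / (2 * (b / 2)) = -(1 / b * t) := by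
        rw [max_eq_left (by linarith)]; field_simp
      rw [e] at h1
      have : 0 ≤ F * (1 / (1 + max t 0) ^ 2) := by positivity
      linarith
    · have h1 := (hat n).abs_edgeTransform_le_div hβ (hC' n) (hD' n) ht.le
      rw [Set.indicator_of_notMem (by simpa using ht), mul_zero, add_zero]
      exact h1
  have hmt : AEStronglyMeasurable (edgeTransform f) ν :=
    aestronglyMeasurable_of_tendsto_ae atTop (fun n => (hid n).1.aestronglyMeasurable)
      (Eventually.of_forall htr)
  have hI : Integrable (edgeTransform f) ν := hBint.mono' hmt
    (Eventually.of_forall fun t => le_of_tendsto (htr t).norm (Eventually.of_forall fun n => hB n t))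
  refine ⟨hI, ?_⟩
  have l1 : Tendsto (fun n => ∫ t, edgeTransform (a n) t ∂ν) atTop (𝓝 (∫ t, edgeTransform f t ∂ν)) :=
    tendsto_integral_of_dominated_convergence _ (fun n => (hid n).1.aestronglyMeasurable) hBint
      (fun n => Eventually.of_forall (hB n)) (Eventually.of_forall htr)
  have l2 : Tendsto (fun n => ∫ x in Set.Ioi 0, a n x * x * φ x) atTop
      (𝓝 (∫ x in Set.Ioi 0, f x * x * φ x)) :=
    tendsto_integral_of_dominated_convergence _ hmul hdom hle
      (Eventually.of_forall fun x => ((hlim x).mul_const _).mul_const _)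
  have hder : ∀ n, deriv (a n) 0 = deriv f 0 := by
    intro n
    apply EventuallyEq.deriv_eq
    filter_upwards [eventually_abs_sub_lt 0 (hpos n)] with x hx
    rw [sub_zero] at hx
    simp only [ha]
    rw [smoothCutoff_eq_one, mul_one]
    rw [abs_mul, abs_of_pos (inv_pos.2 (hpos n)), ← div_eq_inv_mul, div_le_one (hpos n)]
    exact hx.le
  refine tendsto_nhds_unique l1 ((l2.const_add (deriv f 0)).congr fun n => ?_)
  rw [(hid n).2, hder]

end EdgeLimit

/-! ### Gaussian integrals and explicit transforms -/

lemma integral_even {f : ℝ → ℝ} (hf : ∀ x, f (-x) = f x) :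
    ∫ x, f x = 2 * ∫ x in Set.Ioi 0, f x := by
  rw [← integral_comp_abs]
  congr 1
  funext x
  rcases abs_choice x with h | h <;> rw [h]
  exact (hf x).symm

lemma cpow_half_pi_div {b : ℝ} (hb : 0 < b) :
    ((Real.pi : ℂ) / -(-(b : ℂ))) ^ (1 / 2 : ℂ) = ((√(Real.pi / b) : ℝ) : ℂ) := by
  rw [neg_neg, Real.sqrt_eq_rpow, Complex.ofReal_cpow (by positivity)]
  push_cast
  rfl

lemma setIntegral_gaussian_cos {b : ℝ} (hb : 0 < b) (c : ℝ) :
    ∫ x in Set.Ioi (0 : ℝ), Real.exp (-b * x ^ 2) * Real.cos (c * x) =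
      √(Real.pi / b) / 2 * Real.exp (-c ^ 2 / (4 * b)) := by
  have hbre : (-(b : ℂ)).re < 0 := by simpa using hb
  have h1 := integral_cexp_quadratic hbre (c * Complex.I) 0
  have h2 := integrable_cexp_quadratic' hbre (c * Complex.I) 0
  rw [cpow_half_pi_div hb] at h1
  have h3 : ∫ x : ℝ, Real.exp (-b * x ^ 2) * Real.cos (c * x) =
      √(Real.pi / b) * Real.exp (-c ^ 2 / (4 * b)) := by
    have h4 := congrArg Complex.re h1
    have h5 := integral_re h2
    simp only [RCLike.re_to_complex] at h5
    rw [← h5] at h4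
    have e1 : ∀ x : ℝ, (Complex.exp (-(b : ℂ) * (x : ℂ) ^ 2 + c * Complex.I * x + 0)).re =
        Real.exp (-b * x ^ 2) * Real.cos (c * x) := by
      intro x
      have : -(b : ℂ) * (x : ℂ) ^ 2 + c * Complex.I * x + 0 =
        ((-b * x ^ 2 : ℝ) : ℂ) + ((c * x : ℝ) : ℂ) * Complex.I := by push_cast; ring
      rw [this, Complex.exp_re]
      simp only [Complex.add_re, Complex.add_im, Complex.ofReal_re, Complex.ofReal_im,
        Complex.re_ofReal_mul, Complex.im_ofReal_mul, Complex.I_re, Complex.I_im, mul_zero, mul_one,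
        add_zero, zero_add]
    simp only [e1] at h4
    rw [h4]
    have e2 : (0 : ℂ) - (c * Complex.I) ^ 2 / (4 * -(b : ℂ)) = ((-c ^ 2 / (4 * b) : ℝ) : ℂ) := by
      have : (b : ℂ) ≠ 0 := by exact_mod_cast hb.ne'
      push_cast
      rw [mul_pow, Complex.I_sq]
      field_simp
      ring
    rw [e2, ← Complex.ofReal_exp, ← Complex.ofReal_mul, Complex.ofReal_re]
  rw [integral_even (fun x => by rw [neg_sq, mul_neg, Real.cos_neg])] at h3
  linarith

lemma integral_gaussian_exp {b : ℝ} (hb : 0 < b) (k : ℝ) :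
    Integrable (fun x : ℝ => Real.exp (-b * x ^ 2 + k * x)) ∧
    ∫ x : ℝ, Real.exp (-b * x ^ 2 + k * x) = √(Real.pi / b) * Real.exp (k ^ 2 / (4 * b)) := by
  have hbre : (-(b : ℂ)).re < 0 := by simpa using hb
  have h1 := integral_cexp_quadratic hbre k 0
  have h2 := integrable_cexp_quadratic' hbre k 0
  rw [cpow_half_pi_div hb] at h1
  have e1 : ∀ x : ℝ, Complex.exp (-(b : ℂ) * (x : ℂ) ^ 2 + k * x + 0) =
      ((Real.exp (-b * x ^ 2 + k * x) : ℝ) : ℂ) := by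
    intro x; push_cast; rw [add_zero]
  simp only [e1] at h1 h2
  have h3 := h2.re
  simp only [RCLike.re_to_complex, Complex.ofReal_re] at h3
  refine ⟨h3, ?_⟩
  rw [integral_complex_ofReal] at h1
  have e2 : (0 : ℂ) - (k : ℂ) ^ 2 / (4 * -(b : ℂ)) = ((k ^ 2 / (4 * b) : ℝ) : ℂ) := by
    push_cast
    rw [mul_neg, div_neg]
    ring
  rw [e2, ← Complex.ofReal_exp, ← Complex.ofReal_mul] at h1
  exact_mod_cast h1

lemma setIntegral_gaussian_cosh {b : ℝ} (hb : 0 < b) (k : ℝ) :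
    ∫ x in Set.Ioi (0 : ℝ), Real.exp (-b * x ^ 2) * Real.cosh (k * x) =
      √(Real.pi / b) / 2 * Real.exp (k ^ 2 / (4 * b)) := by
  obtain ⟨i1, h1⟩ := integral_gaussian_exp hb k
  obtain ⟨i2, h2⟩ := integral_gaussian_exp hb (-k)
  have h3 : ∫ x : ℝ, Real.exp (-b * x ^ 2) * Real.cosh (k * x) =
      √(Real.pi / b) * Real.exp (k ^ 2 / (4 * b)) := by
    have e : ∀ x : ℝ, Real.exp (-b * x ^ 2) * Real.cosh (k * x) =
        (Real.exp (-b * x ^ 2 + k * x) + Real.exp (-b * x ^ 2 + -k * x)) / 2 := by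
      intro x
      rw [Real.exp_add, Real.exp_add, Real.cosh_eq, neg_mul k]
      ring
    simp only [e]
    rw [integral_div, integral_add i1 i2, h1, h2, neg_sq]
    ring
  rw [integral_even (fun x => by rw [neg_sq, mul_neg, Real.cosh_neg])] at h3
  linarith

/-- Minus the derivative of `exp (-b x²) cos (u x)`. -/
noncomputable def gaussTest (b u : ℝ) : ℝ → ℝ :=
  gaussTrig b u (Polynomial.C (2 * b) * Polynomial.X) (Polynomial.C u)

section gaussTest

variable {b : ℝ} (u : ℝ)

lemma gaussTest_apply (x : ℝ) : gaussTest b u x =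
    Real.exp (-b * x ^ 2) * (2 * b * x * Real.cos (u * x) + u * Real.sin (u * x)) := by
  simp [gaussTest, gaussTrig]

lemma gaussTest_neg (x : ℝ) : gaussTest b u (-x) = -gaussTest b u x := by
  rw [gaussTest_apply, gaussTest_apply, neg_sq, mul_neg u, Real.cos_neg, Real.sin_neg]
  ring

lemma deriv_gaussTest_zero : deriv (gaussTest b u) 0 = 2 * b + u ^ 2 := by
  rw [gaussTest, (hasDerivAt_gaussTrig _ _ _ _ 0).deriv]
  simp [gaussTrig]
  ring

lemma hasDerivAt_gaussian_cos (x : ℝ) :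
    HasDerivAt (fun x => Real.exp (-b * x ^ 2) * Real.cos (u * x)) (-gaussTest b u x) x := by
  have := hasDerivAt_gaussTrig b u 1 0 x
  have e : gaussTrig b u 1 0 = fun x => Real.exp (-b * x ^ 2) * Real.cos (u * x) := by
    funext x; simp [gaussTrig]
  rw [e] at this
  refine this.congr_deriv ?_
  rw [gaussTest_apply]
  simp [gaussTrig]
  ring

lemma integrableOn_gaussian_mul_edgeCos (hb : 0 < b) (t : ℝ) :
    IntegrableOn (fun x => Real.exp (-b * x ^ 2) * Real.cos (u * x) * edgeCos x t) (Set.Ioi 0) := by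
  have c := continuous_edgeCos_left t
  refine (integral_gaussian_exp hb (√(-t))).1.integrableOn.mono' (by fun_prop)
    ((ae_restrict_iff' measurableSet_Ioi).2 (Eventually.of_forall fun x hx => ?_))
  have hx' : 0 < x := hx
  rw [norm_mul, norm_mul, Real.norm_of_nonneg (Real.exp_nonneg _), Real.exp_add]
  calc _ ≤ Real.exp (-b * x ^ 2) * 1 * Real.exp (√(-t) * x) := by
        gcongr
        · exact Real.abs_cos_le_one _
        · exact abs_edgeCos_le hx'.le t
    _ = _ := by ring

/-- Integration by parts exchanges `edgeSin` for `edgeCos`; the boundary terms vanish by `edgeSin 0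
t = 0` and by Gaussian decay. -/
lemma edgeTransform_gaussTest (hb : 0 < b) (t : ℝ) : edgeTransform (gaussTest b u) t =
    ∫ x in Set.Ioi 0, Real.exp (-b * x ^ 2) * Real.cos (u * x) * edgeCos x t := by
  obtain ⟨C, hC0, hC⟩ := exists_gaussTrig_le u (Polynomial.C (2 * b) * Polynomial.X)
    (Polynomial.C u) hb
  have hcont : Continuous (gaussTest b u) := (contDiff_gaussTrig b u _ _ (n := 0)).continuous
  have i1 : IntegrableOn (fun x => gaussTest b u x * edgeSin x t) (Set.Ioi 0) :=
    integrableOn_mul_edgeSin (show 0 < b / 2 by positivity) hcont hC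
  have i2 := integrableOn_gaussian_mul_edgeCos u hb t
  have i3 : IntegrableOn (fun x => Real.exp (-b * x ^ 2) * Real.cos (u * x) * edgeSin x t)
      (Set.Ioi 0) := by
    refine integrableOn_mul_edgeSin hb (by fun_prop) (C := 1) fun x => ?_
    rw [abs_mul, Real.abs_exp, mul_comm]
    gcongr
    exact Real.abs_cos_le_one _
  have hd : ∀ x ∈ Set.Ici (0 : ℝ), HasDerivAt
      (fun x => Real.exp (-b * x ^ 2) * Real.cos (u * x) * edgeSin x t)
      (Real.exp (-b * x ^ 2) * Real.cos (u * x) * edgeCos x t - gaussTest b u x * edgeSin x t) x := by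
    intro x _
    refine ((hasDerivAt_gaussian_cos u x).mul (hasDerivAt_edgeSin x t)).congr_deriv ?_
    ring
  have i4 := i2.sub i1
  have hz := tendsto_zero_of_hasDerivAt_of_integrableOn_Ioi
    (fun x hx => hd x (Set.mem_Ici.2 (Set.mem_Ioi.1 hx).le)) i4 i3
  have := integral_Ioi_of_hasDerivAt_of_tendsto' hd i4 hz
  rw [integral_sub i2 i1, edgeSin_zero_left, mul_zero, sub_zero] at this
  rw [edgeTransform]
  linarith

lemma edgeTransform_gaussTest_sq (hb : 0 < b) {k : ℝ} (hk : 0 ≤ k) :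
    edgeTransform (gaussTest b u) (k ^ 2) = √(Real.pi / b) / 4 *
      (Real.exp (-(k - u) ^ 2 / (4 * b)) + Real.exp (-(k + u) ^ 2 / (4 * b))) := by
  have i : ∀ c : ℝ, IntegrableOn (fun x => Real.exp (-b * x ^ 2) * Real.cos (c * x)) (Set.Ioi 0) := by
    intro c
    have := integrableOn_gaussian_mul_edgeCos c hb 0
    simpa [edgeCos] using this
  rw [edgeTransform_gaussTest u hb]
  have e : ∀ x, Real.exp (-b * x ^ 2) * Real.cos (u * x) * edgeCos x (k ^ 2) =
      (Real.exp (-b * x ^ 2) * Real.cos ((k - u) * x) +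
        Real.exp (-b * x ^ 2) * Real.cos ((k + u) * x)) / 2 := by
    intro x
    rw [edgeCos_sq x hk, sub_mul, add_mul, Real.cos_sub, Real.cos_add]
    ring
  simp only [e]
  rw [integral_div, integral_add (i _) (i _), setIntegral_gaussian_cos hb, setIntegral_gaussian_cos hb]
  ring

lemma abs_edgeTransform_gaussTest_le (hb : 0 < b) {k : ℝ} (hk : 0 < k) :
    |edgeTransform (gaussTest b u) (-k ^ 2)| ≤ √(Real.pi / b) / 2 * Real.exp (k ^ 2 / (4 * b)) := by
  rw [edgeTransform_gaussTest u hb, ← setIntegral_gaussian_cosh hb]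
  have i0 := integrableOn_gaussian_mul_edgeCos 0 hb (-k ^ 2)
  simp only [zero_mul, Real.cos_zero, mul_one, edgeCos_neg_sq _ hk] at i0
  refine (abs_integral_le_integral_abs).trans (setIntegral_mono_on
    (integrableOn_gaussian_mul_edgeCos u hb _).abs i0 measurableSet_Ioi fun x _ => ?_)
  rw [edgeCos_neg_sq _ hk, abs_mul, abs_mul, Real.abs_exp, abs_of_pos (Real.cosh_pos _)]
  gcongr
  exact mul_le_of_le_one_right (Real.exp_nonneg _) (Real.abs_cos_le_one _)

/-- Without modulation the transform is the same exponential for both signs of `t`: the integral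
against the limit becomes a Laplace transform. -/
lemma edgeTransform_gaussTest_zero (hb : 0 < b) (t : ℝ) :
    edgeTransform (gaussTest b 0) t = √(Real.pi / b) / 2 * Real.exp (-(1 / (4 * b) * t)) := by
  rcases eq_sq_or_neg_sq t with ⟨k, hk, rfl⟩ | ⟨k, hk, rfl⟩
  · rw [edgeTransform_gaussTest_sq 0 hb hk, sub_zero, add_zero]
    have : -k ^ 2 / (4 * b) = -(1 / (4 * b) * k ^ 2) := by ring
    rw [this]
    ring
  · rw [edgeTransform_gaussTest 0 hb]
    simp only [edgeCos_neg_sq _ hk, zero_mul, Real.cos_zero, mul_one]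
    rw [setIntegral_gaussian_cosh hb]
    ring_nf

end gaussTest

/-! ### Uniqueness by the Laplace transform -/

/-- The Laplace transform of the limiting edge measure, in terms of the profile. -/
def IsEdgeSolution (φ : ℝ → ℝ) (ν : Measure ℝ) : Prop :=
  ∀ b : ℝ, 0 < b → Integrable (fun t => Real.exp (-(1 / (4 * b) * t))) ν ∧
    √(Real.pi / b) / 2 * ∫ t, Real.exp (-(1 / (4 * b) * t)) ∂ν =
      2 * b + ∫ x in Set.Ioi 0, gaussTest b 0 x * x * φ x

lemma EdgeLimit.isEdgeSolution {φ : ℝ → ℝ} {ν : Measure ℝ} (h : EdgeLimit φ ν) {δ : ℝ} (hδ0 : 0 < δ)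
    (hδ : δ < 1) (hφ : EdgeProfile δ φ) : IsEdgeSolution φ ν := by
  intro b hb
  obtain ⟨h1, h2⟩ := h.integral_gaussTrig hδ0 hδ hφ hb (gaussTest_neg 0)
  change Integrable (edgeTransform (gaussTest b 0)) ν at h1
  change ∫ t, edgeTransform (gaussTest b 0) t ∂ν = deriv (gaussTest b 0) 0 +
    ∫ x in Set.Ioi 0, gaussTest b 0 x * x * φ x at h2
  rw [funext (edgeTransform_gaussTest_zero hb)] at h1
  simp only [edgeTransform_gaussTest_zero hb, deriv_gaussTest_zero] at h2
  have hne : √(Real.pi / b) / 2 ≠ 0 := by positivity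
  refine ⟨(integrable_const_mul_iff hne.isUnit _).1 h1, ?_⟩
  rw [← integral_const_mul, h2]
  ring

open ProbabilityTheory in
/-- Measures on the line are determined by their Laplace transform on `(0, ∞)`. -/
lemma Measure.ext_of_laplace {ν ν' : Measure ℝ}
    (h : ∀ c : ℝ, 0 < c → Integrable (fun t => Real.exp (-(c * t))) ν)
    (h' : ∀ c : ℝ, 0 < c → Integrable (fun t => Real.exp (-(c * t))) ν')
    (heq : ∀ c : ℝ, 0 < c → ∫ t, Real.exp (-(c * t)) ∂ν = ∫ t, Real.exp (-(c * t)) ∂ν') : ν = ν' := by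
  have an : ∀ {ν : Measure ℝ}, (∀ c : ℝ, 0 < c → Integrable (fun t => Real.exp (-(c * t))) ν) →
      AnalyticOnNhd ℂ (complexMGF id ν) {z | z.re ∈ Set.Iio (0 : ℝ)} := by
    intro ν h
    refine analyticOnNhd_complexMGF.mono fun z hz => ?_
    refine interior_maximal (t := Set.Iio 0) (fun v hv => ?_) isOpen_Iio hz
    have := h (-v) (by simpa using hv)
    simpa [integrableExpSet] using this
  -- Both transforms are analytic in the left half-plane and agree on its real axis near `-1`.
  have key : Set.EqOn (complexMGF id ν) (complexMGF id ν') {z | z.re ∈ Set.Iio (0 : ℝ)} := by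
    refine AnalyticOnNhd.eqOn_of_preconnected_of_frequently_eq (an h) (an h')
      ((convex_Iio 0).linear_preimage Complex.reLm).isPreconnected
      (z₀ := ((-1 : ℝ) : ℂ)) (by simp) ?_
    have h_real : ∃ᶠ (x : ℝ) in 𝓝[≠] (-1), complexMGF id ν x = complexMGF id ν' x := by
      apply Eventually.frequently
      filter_upwards [nhdsWithin_le_nhds (gt_mem_nhds (show (-1 : ℝ) < 0 by norm_num))] with y hy
      rw [complexMGF_ofReal, complexMGF_ofReal]
      have := heq (-y) (by linarith)
      simp only [mgf, id]
      simpa using this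
    rw [frequently_iff_seq_forall] at h_real ⊢
    obtain ⟨xs, hx_tendsto, hx_eq⟩ := h_real
    refine ⟨fun n ↦ xs n, ?_, fun n ↦ ?_⟩
    · rw [tendsto_nhdsWithin_iff] at hx_tendsto ⊢
      exact ⟨(Complex.continuous_ofReal.tendsto _).comp hx_tendsto.1,
        hx_tendsto.2.mono fun n hn hc => hn (Complex.ofReal_injective hc)⟩
    · simp [hx_eq]
  -- The measures may be infinite. Tilting by `exp(-t)` makes them finite, with characteristic
  -- function the transform on the line `Re z = -1`; the tilt is then undone.
  set w : ℝ → ENNReal := fun t => ENNReal.ofReal (Real.exp (-(1 * t))) with hw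
  have hwm : Measurable w := by fun_prop
  have fin : ∀ {ν : Measure ℝ}, (∀ c : ℝ, 0 < c → Integrable (fun t => Real.exp (-(c * t))) ν) →
      IsFiniteMeasure (ν.withDensity w) := fun h =>
    isFiniteMeasure_withDensity_ofReal (h 1 one_pos).2
  have cf : ∀ (ν : Measure ℝ) (y : ℝ), charFun (ν.withDensity w) y =
      complexMGF id ν (-1 + y * Complex.I) := by
    intro ν y
    rw [charFun_apply_real, integral_withDensity_eq_integral_toReal_smul hwm
      (Eventually.of_forall fun t => ENNReal.ofReal_lt_top), complexMGF]
    congr 1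
    funext t
    simp only [hw, id]
    rw [ENNReal.toReal_ofReal (Real.exp_nonneg _), Complex.real_smul, Complex.ofReal_exp,
      ← Complex.exp_add]
    congr 1
    push_cast
    ring
  have e : ν.withDensity w = ν'.withDensity w := by
    have := fin h
    have := fin h'
    apply Measure.ext_of_charFun
    funext y
    rw [cf, cf]
    exact key (by simp)
  have inv : ∀ ν : Measure ℝ, (ν.withDensity w).withDensity w⁻¹ = ν := fun ν =>
    withDensity_inv_same hwm (Eventually.of_forall fun t => by simp [hw, Real.exp_pos])
      (Eventually.of_forall fun t => ENNReal.ofReal_ne_top)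
  rw [← inv ν, e, inv ν']

/-- As `b` runs over `(0, ∞)`, so does the Laplace variable `c = 1/(4b)`. -/
lemma IsEdgeSolution.unique {φ : ℝ → ℝ} {ν ν' : Measure ℝ} (h : IsEdgeSolution φ ν)
    (h' : IsEdgeSolution φ ν') : ν = ν' := by
  have e : ∀ c : ℝ, 0 < c → 1 / (4 * (1 / (4 * c))) = c := fun c hc => by field_simp
  refine Measure.ext_of_laplace (fun c hc => ?_) (fun c hc => ?_) fun c hc => ?_
  · have := (h (1 / (4 * c)) (by positivity)).1
    rwa [e c hc] at this
  · have := (h' (1 / (4 * c)) (by positivity)).1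
    rwa [e c hc] at this
  · have h1 := (h (1 / (4 * c)) (by positivity)).2
    have h2 := (h' (1 / (4 * c)) (by positivity)).2
    rw [e c hc] at h1 h2
    have hne : √(Real.pi / (1 / (4 * c))) / 2 ≠ 0 := by positivity
    exact mul_left_cancel₀ hne (h1.trans h2.symm)

/-! ### Growth of the limit at `+∞` -/

/-- The Gaussian transform at `t ≥ 0`: a bump in `√t` around `u`. -/
noncomputable def edgeBump (u t : ℝ) : ℝ :=
  √(Real.pi / (1 / 2)) / 4 * (Real.exp (-(√t - u) ^ 2 / 2) + Real.exp (-(√t + u) ^ 2 / 2))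

lemma edgeBump_nonneg (u t : ℝ) : 0 ≤ edgeBump u t := by unfold edgeBump; positivity

lemma continuous_edgeBump : Continuous fun p : ℝ × ℝ => edgeBump p.1 p.2 := by
  unfold edgeBump; fun_prop

lemma edgeTransform_gaussTest_half (u : ℝ) {t : ℝ} (ht : 0 ≤ t) :
    edgeTransform (gaussTest (1 / 2) u) t = edgeBump u t := by
  have := edgeTransform_gaussTest_sq u (show (0 : ℝ) < 1 / 2 by norm_num) (Real.sqrt_nonneg t)
  rw [Real.sq_sqrt ht] at this
  rw [this, edgeBump]
  norm_num

lemma EdgeProfile.exists_integral_gaussTest_le {δ : ℝ} (hδ0 : 0 < δ) (hδ : δ < 1) {φ : ℝ → ℝ}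
    (hφ : EdgeProfile δ φ) : ∃ K, 0 ≤ K ∧ ∀ u, 0 ≤ u →
      |∫ x in Set.Ioi 0, gaussTest (1 / 2) u x * x * φ x| ≤ K * (1 + u) := by
  have hi := (hφ.integrableOn_gaussian hδ0 hδ (show (0 : ℝ) < 1 / 4 by norm_num)).norm.const_mul 2
  refine ⟨∫ x in Set.Ioi 0, 2 * ‖Real.exp (-(1 / 4) * x ^ 2) * x * φ x‖,
    integral_nonneg fun x => by positivity, fun u hu => ?_⟩
  rw [← integral_mul_const, ← Real.norm_eq_abs]
  refine norm_integral_le_of_norm_le (hi.mul_const _) ((ae_restrict_iff' measurableSet_Ioi).2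
    (Eventually.of_forall fun x hx => ?_))
  have hx' : 0 < x := hx
  have h1 : |gaussTest (1 / 2) u x| ≤ 2 * Real.exp (-(1 / 4) * x ^ 2) * (1 + u) := by
    rw [gaussTest_apply, abs_mul, Real.abs_exp]
    have h2 : |2 * (1 / 2) * x * Real.cos (u * x) + u * Real.sin (u * x)| ≤ x + u := by
      refine (abs_add_le _ _).trans (add_le_add ?_ ?_)
      · rw [abs_mul, abs_of_pos (by positivity)]
        refine (mul_le_of_le_one_right (by positivity) (Real.abs_cos_le_one _)).trans (by linarith)
      · rw [abs_mul, abs_of_nonneg hu]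
        exact mul_le_of_le_one_right hu (Real.abs_sin_le_one _)
    have h3 : 1 + x ≤ 2 * Real.exp (1 / 4 * x ^ 2) := by
      have := Real.add_one_le_exp (1 / 4 * x ^ 2)
      nlinarith [sq_nonneg (x - 1)]
    have h4 : x + u ≤ (1 + x) * (1 + u) := by nlinarith
    have e : Real.exp (-(1 / 4) * x ^ 2) = Real.exp (-(1 / 2) * x ^ 2) * Real.exp (1 / 4 * x ^ 2) := by
      rw [← Real.exp_add]; ring_nf
    calc _ ≤ Real.exp (-(1 / 2) * x ^ 2) * ((2 * Real.exp (1 / 4 * x ^ 2)) * (1 + u)) := by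
          gcongr
          refine h2.trans (h4.trans ?_)
          gcongr
      _ = _ := by rw [e]; ring
  rw [norm_mul, norm_mul, norm_mul, norm_mul, Real.norm_of_nonneg (Real.exp_nonneg _),
    Real.norm_eq_abs (gaussTest _ _ _)]
  calc _ ≤ 2 * Real.exp (-(1 / 4) * x ^ 2) * (1 + u) * ‖x‖ * ‖φ x‖ := by gcongr
    _ = _ := by ring

namespace EdgeLimit

variable {φ : ℝ → ℝ} {ν : Measure ℝ}

/-- The test with `b = 1/2` has derivative `1 + u²` at `0`; the profile contributes `O(1 + u)`, and
the part of the integral over `t < 0` is bounded by `M` uniformly in `u`. Lower integrals are used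
with a view to Tonelli. -/
lemma exists_lintegral_edgeBump_le (h : EdgeLimit φ ν) {δ : ℝ} (hδ0 : 0 < δ) (hδ : δ < 1)
    (hφ : EdgeProfile δ φ) : ∃ K, 0 ≤ K ∧ ∀ u, 0 ≤ u →
      ∫⁻ t in Set.Ici 0, ENNReal.ofReal (edgeBump u t) ∂ν ≤ ENNReal.ofReal (u ^ 2 + K * (1 + u)) ∧
      ENNReal.ofReal (u ^ 2) ≤ (∫⁻ t in Set.Ici 0, ENNReal.ofReal (edgeBump u t) ∂ν) +
        ENNReal.ofReal (K * (1 + u)) := by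
  obtain ⟨K, hK, h1⟩ := hφ.exists_integral_gaussTest_le hδ0 hδ
  have hb : (0 : ℝ) < 1 / 2 := by norm_num
  have he := (h.exp (1 / 2)).mono_set Set.Iio_subset_Iic_self |>.const_mul (√(Real.pi / (1 / 2)) / 2)
  set M := ∫ t in Set.Iio 0, √(Real.pi / (1 / 2)) / 2 * Real.exp (-(1 / 2 * t)) ∂ν with hM
  have hM0 : 0 ≤ M := integral_nonneg fun t => by positivity
  refine ⟨K + M + 1, by positivity, fun u hu => ?_⟩
  obtain ⟨h2, h3⟩ := h.integral_gaussTrig hδ0 hδ hφ hb (gaussTest_neg u)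
  change Integrable (edgeTransform (gaussTest (1 / 2) u)) ν at h2
  change ∫ t, edgeTransform (gaussTest (1 / 2) u) t ∂ν = deriv (gaussTest (1 / 2) u) 0 +
    ∫ x in Set.Ioi 0, gaussTest (1 / 2) u x * x * φ x at h3
  rw [deriv_gaussTest_zero, ← integral_add_compl (measurableSet_Ici (a := (0 : ℝ))) h2,
    Set.compl_Ici] at h3
  have h4 : |∫ t in Set.Iio 0, edgeTransform (gaussTest (1 / 2) u) t ∂ν| ≤ M := by
    rw [← Real.norm_eq_abs]
    refine norm_integral_le_of_norm_le he ((ae_restrict_iff' measurableSet_Iio).2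
      (Eventually.of_forall fun t ht => ?_))
    have ht0 : 0 < -t := by linarith [Set.mem_Iio.1 ht]
    have := abs_edgeTransform_gaussTest_le u hb (Real.sqrt_pos.2 ht0)
    rw [Real.sq_sqrt ht0.le, neg_neg] at this
    refine this.trans (le_of_eq ?_)
    congr 2
    ring
  have h5 : ∫ t in Set.Ici 0, edgeTransform (gaussTest (1 / 2) u) t ∂ν =
      ∫ t in Set.Ici 0, edgeBump u t ∂ν :=
    setIntegral_congr_fun measurableSet_Ici fun t ht => edgeTransform_gaussTest_half u ht
  have h6 : IntegrableOn (edgeBump u) (Set.Ici 0) ν :=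
    h2.integrableOn.congr_fun (fun t ht => edgeTransform_gaussTest_half u ht) measurableSet_Ici
  rw [h5] at h3
  rw [← ofReal_integral_eq_lintegral_ofReal h6 (Eventually.of_forall fun t => edgeBump_nonneg u t)]
  have h7 := h1 u hu
  rw [abs_le] at h4 h7
  have h8 : 0 ≤ M * u := by positivity
  have h9 : 0 ≤ ∫ t in Set.Ici 0, edgeBump u t ∂ν := integral_nonneg fun t => edgeBump_nonneg u t
  constructor
  · apply ENNReal.ofReal_le_ofReal
    linarith
  · rw [← ENNReal.ofReal_add h9 (by positivity)]
    apply ENNReal.ofReal_le_ofReal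
    linarith

end EdgeLimit

/-- Half of the exponent supplies the small factor, the other half stays integrable. -/
lemma gaussian_tail_setIntegral_le {k d : ℝ} (hd : 0 ≤ d) {B : Set ℝ} (hB : MeasurableSet B)
    (h : ∀ u ∈ B, d ≤ |k - u|) :
    ∫ u in B, Real.exp (-(k - u) ^ 2 / 2) ≤ √(Real.pi / (1 / 4)) * Real.exp (-d ^ 2 / 4) := by
  have e : ∀ b u : ℝ, Real.exp (-(k - u) ^ 2 * b) = Real.exp (-b * (u - k) ^ 2) := fun b u => by
    ring_nf
  have i : ∀ b : ℝ, 0 < b → Integrable fun u => Real.exp (-(k - u) ^ 2 * b) := fun b hb => by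
    simp only [e b]
    exact (integrable_exp_neg_mul_sq hb).comp_sub_right k
  have i1 := i (1 / 2) (by norm_num)
  have i2 := i (1 / 4) (by norm_num)
  have e2 : ∫ u, Real.exp (-(k - u) ^ 2 * (1 / 4)) = √(Real.pi / (1 / 4)) := by
    simp only [e]
    rw [integral_sub_right_eq_self (fun u => Real.exp (-(1 / 4) * u ^ 2)) k, integral_gaussian]
  simp only [mul_one_div] at i1 i2 e2
  calc ∫ u in B, Real.exp (-(k - u) ^ 2 / 2)
      ≤ ∫ u in B, Real.exp (-(k - u) ^ 2 / 4) * Real.exp (-d ^ 2 / 4) := by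
        refine setIntegral_mono_on i1.integrableOn (i2.integrableOn.mul_const _) hB fun u hu => ?_
        rw [← Real.exp_add]
        apply Real.exp_le_exp.2
        have := pow_le_pow_left₀ hd (h u hu) 2
        rw [sq_abs] at this
        linarith
    _ = (∫ u in B, Real.exp (-(k - u) ^ 2 / 4)) * Real.exp (-d ^ 2 / 4) := integral_mul_const _ _
    _ ≤ (∫ u, Real.exp (-(k - u) ^ 2 / 4)) * Real.exp (-d ^ 2 / 4) := by
        refine mul_le_mul_of_nonneg_right ?_ (Real.exp_nonneg _)
        exact setIntegral_le_integral i2 (Eventually.of_forall fun u => Real.exp_nonneg _)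
    _ = _ := by rw [e2]

/-- The two Gaussians of the bump fold into one, centred at `√t`, over `(-K, K]`; its full integral,
with the prefactor, is `2π/4`. If `√t ≤ K`, what is missing lies at distance at least `K - √t` from
the centre; otherwise all that is present lies at distance at least `√t - K`. -/
lemma integral_edgeBump_bounds {K : ℝ} (hK : 0 ≤ K) (t : ℝ) :
    ∫ u in Set.Ioc 0 K, edgeBump u t ≤
      (Set.Iic (K ^ 2)).indicator (fun _ => Real.pi / 2) t + 3 * Real.exp (-(√t - K) ^ 2 / 4) * 3 ∧
    (Set.Iic (K ^ 2)).indicator (fun _ => Real.pi / 2) t ≤ (∫ u in Set.Ioc 0 K, edgeBump u t) +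
      3 * Real.exp (-(√t - K) ^ 2 / 4) * 3 := by
  set k := √t with hk
  have hk0 : 0 ≤ k := Real.sqrt_nonneg _
  set g : ℝ → ℝ := fun u => Real.exp (-(k - u) ^ 2 / 2) with hg
  have hgc : Continuous g := by fun_prop
  have e : ∀ u : ℝ, g u = Real.exp (-(1 / 2) * (u - k) ^ 2) := fun u => by simp only [hg]; ring_nf
  have ig : Integrable g := by
    rw [funext e]
    exact (integrable_exp_neg_mul_sq (by norm_num)).comp_sub_right k
  have eg : ∫ u, g u = √(Real.pi / (1 / 2)) := by
    simp only [e]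
    rw [integral_sub_right_eq_self (fun u => Real.exp (-(1 / 2) * u ^ 2)) k, integral_gaussian]
  have hI : ∫ u in Set.Ioc 0 K, edgeBump u t = √(Real.pi / (1 / 2)) / 4 * ∫ u in Set.Ioc (-K) K, g u := by
    rw [← intervalIntegral.integral_of_le hK, ← intervalIntegral.integral_of_le (by linarith),
      ← intervalIntegral.integral_add_adjacent_intervals (hgc.intervalIntegrable (-K) 0)
        (hgc.intervalIntegrable 0 K)]
    have h1 := intervalIntegral.integral_comp_neg (a := 0) (b := K) g
    rw [neg_zero] at h1
    have h2 : IntervalIntegrable (fun u => g (-u)) volume 0 K :=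
      (hgc.comp continuous_neg).intervalIntegrable _ _
    rw [← h1, ← intervalIntegral.integral_add h2 (hgc.intervalIntegrable _ _), ← intervalIntegral.integral_const_mul]
    refine intervalIntegral.integral_congr fun u _ => ?_
    simp only [edgeBump, hg, ← hk, sub_neg_eq_add]
    ring
  set w := √(Real.pi / (1 / 2)) with hw
  have hww : w * w = 2 * Real.pi := by
    rw [hw, Real.mul_self_sqrt (by positivity)]; ring
  have hw0 : 0 ≤ w := Real.sqrt_nonneg _
  have hw3 : w ≤ 3 := by nlinarith [Real.pi_lt_d2]
  have hv : √(Real.pi / (1 / 4)) ≤ 4 := by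
    rw [Real.sqrt_le_left (by norm_num)]; linarith [Real.pi_le_four]
  set E := Real.exp (-(k - K) ^ 2 / 4) with hE
  have hE0 : 0 ≤ E := Real.exp_nonneg _
  set I := ∫ u in Set.Ioc (-K) K, g u with hIdef
  have hI0 : 0 ≤ I := setIntegral_nonneg measurableSet_Ioc fun u _ => Real.exp_nonneg _
  have hIw : I ≤ w := by
    rw [← eg]
    exact setIntegral_le_integral ig (Eventually.of_forall fun u => Real.exp_nonneg _)
  rw [hI]
  rcases le_or_gt t (K ^ 2) with q | q
  · have hkK : k ≤ K := Real.sqrt_le_iff.2 ⟨hK, q⟩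
    rw [Set.indicator_of_mem (show t ∈ Set.Iic (K ^ 2) from q)]
    have h1 : ∫ u in (Set.Ioc (-K) K)ᶜ, g u ≤ 4 * E := by
      have := gaussian_tail_setIntegral_le (k := k) (d := K - k) (by linarith)
        (B := (Set.Ioc (-K) K)ᶜ) measurableSet_Ioc.compl fun u hu => by
          simp only [Set.mem_compl_iff, Set.mem_Ioc, not_and_or, not_lt, not_le] at hu
          rcases hu with hu | hu
          · rw [abs_of_nonneg (by linarith)]; linarith
          · rw [abs_of_nonpos (by linarith)]; linarith
      rw [← neg_sub k K, neg_sq] at this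
      refine this.trans ?_
      gcongr
    have h2 := integral_add_compl (measurableSet_Ioc (a := -K) (b := K)) ig
    rw [eg] at h2
    have h3 : w - 4 * E ≤ I := by linarith
    constructor
    · nlinarith
    · nlinarith
  · have hkK : K < k := Real.lt_sqrt_of_sq_lt q
    rw [Set.indicator_of_notMem (by simpa using q)]
    have h1 : I ≤ 4 * E := by
      have := gaussian_tail_setIntegral_le (k := k) (d := k - K) (by linarith)
        (B := Set.Ioc (-K) K) measurableSet_Ioc fun u hu => by
          rw [abs_of_nonneg (by linarith [hu.2])]; linarith [hu.2]
      refine this.trans ?_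
      gcongr
    constructor
    · nlinarith
    · have : 0 ≤ w / 4 * I := by positivity
      nlinarith

/-- The error at the sharp cut is itself dominated by a superposition of bumps with `u` near `K`, so
the same identity bounds its integral. -/
lemma exp_neg_sq_le_lintegral (t K : ℝ) :
    ENNReal.ofReal (Real.exp (-(√t - K) ^ 2 / 4)) ≤ ENNReal.ofReal 10 *
      ∫⁻ u in Set.Ioi 0, ENNReal.ofReal (Real.exp (-(u - K) ^ 2 / 8) * edgeBump u t) := by
  set k := √t with hk
  have hk0 : 0 ≤ k := Real.sqrt_nonneg _
  have hw2 : 2 ≤ √(Real.pi / (1 / 2)) := Real.le_sqrt_of_sq_le (by linarith [Real.pi_gt_three])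
  -- Uses `(u - K)² ≤ 2(u - k)² + 2(k - K)²` and `|u - k| ≤ 1`, which cost `exp(-3/4) ≥ 1/5`; the
  -- prefactor of the bump gives the other `1/2`.
  have h1 : ∀ u ∈ Set.Ioc k (k + 1), Real.exp (-(k - K) ^ 2 / 4) / 10 ≤
      Real.exp (-(u - K) ^ 2 / 8) * edgeBump u t := by
    intro u hu
    have hl : (2 : ℝ) / 4 * Real.exp (-(k - u) ^ 2 / 2) ≤ edgeBump u t := by
      rw [edgeBump, ← hk]
      gcongr
      linarith [Real.exp_nonneg (-(k + u) ^ 2 / 2)]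
    have h2 : Real.exp (-(k - K) ^ 2 / 4 + -(3 / 4)) ≤
        Real.exp (-(u - K) ^ 2 / 8) * Real.exp (-(k - u) ^ 2 / 2) := by
      rw [← Real.exp_add]
      apply Real.exp_le_exp.2
      have h3 : (u - k) ^ 2 ≤ 1 := by nlinarith [hu.1, hu.2]
      nlinarith [sq_nonneg (2 * k - u - K)]
    have h4 : (1 : ℝ) / 5 ≤ Real.exp (-(3 / 4)) := by
      have := Real.add_one_le_exp (-(3 / 4) : ℝ)
      linarith
    rw [Real.exp_add] at h2
    have h5 := Real.exp_nonneg (-(k - K) ^ 2 / 4)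
    calc Real.exp (-(k - K) ^ 2 / 4) / 10 ≤ 2 / 4 * (Real.exp (-(k - K) ^ 2 / 4) * Real.exp (-(3 / 4))) := by
          nlinarith
      _ ≤ 2 / 4 * (Real.exp (-(u - K) ^ 2 / 8) * Real.exp (-(k - u) ^ 2 / 2)) := by gcongr
      _ = Real.exp (-(u - K) ^ 2 / 8) * (2 / 4 * Real.exp (-(k - u) ^ 2 / 2)) := by ring
      _ ≤ _ := by gcongr
  calc ENNReal.ofReal (Real.exp (-(k - K) ^ 2 / 4))
      = ENNReal.ofReal 10 * ∫⁻ u in Set.Ioc k (k + 1), ENNReal.ofReal (Real.exp (-(k - K) ^ 2 / 4) / 10) := by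
        rw [setLIntegral_const, Real.volume_Ioc, add_sub_cancel_left, ENNReal.ofReal_one, mul_one,
          ← ENNReal.ofReal_mul (by norm_num)]
        congr 1
        ring
    _ ≤ ENNReal.ofReal 10 *
        ∫⁻ u in Set.Ioc k (k + 1), ENNReal.ofReal (Real.exp (-(u - K) ^ 2 / 8) * edgeBump u t) := by
        gcongr ENNReal.ofReal 10 * ?_
        exact setLIntegral_mono' measurableSet_Ioc fun u hu => ENNReal.ofReal_le_ofReal (h1 u hu)
    _ ≤ _ := by
        gcongr
        exact fun u hu => hk0.trans_lt hu.1

lemma exists_lintegral_gaussian_weight_le (A : ℝ) (hA : 0 ≤ A) : ∃ C, 0 ≤ C ∧ ∀ K : ℝ,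
    ∫⁻ u : ℝ, ENNReal.ofReal (Real.exp (-(u - K) ^ 2 / 8) * (A * (1 + u ^ 2))) ≤
      ENNReal.ofReal (C * (1 + K ^ 2)) := by
  have i := integrable_exp_neg_mul_sq (show (0 : ℝ) < 1 / 16 by norm_num)
  refine ⟨32 * A * √(Real.pi / (1 / 16)), by positivity, fun K => ?_⟩
  have h1 : ∀ u : ℝ, Real.exp (-(u - K) ^ 2 / 8) * (A * (1 + u ^ 2)) ≤
      32 * A * (1 + K ^ 2) * Real.exp (-(1 / 16) * (u - K) ^ 2) := by
    intro u
    have h2 : 1 + u ^ 2 ≤ 2 * (1 + K ^ 2) * (1 + (u - K) ^ 2) := by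
      nlinarith [sq_nonneg (u - 2 * K), mul_nonneg (sq_nonneg K) (sq_nonneg (u - K))]
    have h3 : 1 + (u - K) ^ 2 ≤ 16 * Real.exp (1 / 16 * (u - K) ^ 2) := by
      have := Real.add_one_le_exp (1 / 16 * (u - K) ^ 2)
      linarith
    have e : Real.exp (-(1 / 16) * (u - K) ^ 2) =
        Real.exp (-(u - K) ^ 2 / 8) * Real.exp (1 / 16 * (u - K) ^ 2) := by
      rw [← Real.exp_add]; ring_nf
    calc _ ≤ Real.exp (-(u - K) ^ 2 / 8) *
          (A * (2 * (1 + K ^ 2) * (16 * Real.exp (1 / 16 * (u - K) ^ 2)))) := by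
          gcongr
          refine h2.trans ?_
          gcongr
      _ = _ := by rw [e]; ring
  have i2 : Integrable fun u : ℝ => 32 * A * (1 + K ^ 2) * Real.exp (-(1 / 16) * (u - K) ^ 2) :=
    (i.comp_sub_right K).const_mul _
  calc _ ≤ ∫⁻ u : ℝ, ENNReal.ofReal (32 * A * (1 + K ^ 2) * Real.exp (-(1 / 16) * (u - K) ^ 2)) :=
        lintegral_mono fun u => ENNReal.ofReal_le_ofReal (h1 u)
    _ = ENNReal.ofReal (∫ u : ℝ, 32 * A * (1 + K ^ 2) * Real.exp (-(1 / 16) * (u - K) ^ 2)) :=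
        (ofReal_integral_eq_lintegral_ofReal i2 (Eventually.of_forall fun u => by positivity)).symm
    _ ≤ _ := by
        rw [integral_const_mul, integral_sub_right_eq_self (fun u => Real.exp (-(1 / 16) * u ^ 2)) K,
          integral_gaussian]
        apply ENNReal.ofReal_le_ofReal
        linarith

lemma lintegral_gaussian_sqrt_le {ν' : Measure ℝ} [SFinite ν'] {F : ℝ → ℝ} {M K : ℝ}
    (hF : ∀ u, 0 ≤ u → ∫⁻ t, ENNReal.ofReal (edgeBump u t) ∂ν' ≤ ENNReal.ofReal (F u))
    (hM : ∫⁻ u : ℝ, ENNReal.ofReal (Real.exp (-(u - K) ^ 2 / 8) * F u) ≤ ENNReal.ofReal M) :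
    ∫⁻ t, ENNReal.ofReal (3 * Real.exp (-(√t - K) ^ 2 / 4) * 3) ∂ν' ≤ ENNReal.ofReal (90 * M) := by
  have hm2 : Measurable fun p : ℝ × ℝ =>
      ENNReal.ofReal (Real.exp (-(p.2 - K) ^ 2 / 8) * edgeBump p.2 p.1) := by
    have := continuous_edgeBump.comp (continuous_swap (X := ℝ) (Y := ℝ))
    exact ((by fun_prop : Continuous fun p : ℝ × ℝ => Real.exp (-(p.2 - K) ^ 2 / 8)).mul
      this).measurable.ennreal_ofReal
  have h1 : ∀ u ∈ Set.Ioi (0 : ℝ), ∫⁻ t, ENNReal.ofReal (Real.exp (-(u - K) ^ 2 / 8) * edgeBump u t) ∂ν' ≤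
      ENNReal.ofReal (Real.exp (-(u - K) ^ 2 / 8) * F u) := by
    intro u hu
    have hmu : Measurable fun t => ENNReal.ofReal (edgeBump u t) :=
      (continuous_edgeBump.comp (continuous_const.prodMk continuous_id)).measurable.ennreal_ofReal
    simp only [ENNReal.ofReal_mul (Real.exp_nonneg _)]
    rw [lintegral_const_mul _ hmu]
    exact mul_le_mul_right (hF u (Set.mem_Ioi.1 hu).le) _
  have h2 : ∀ t, ENNReal.ofReal (3 * Real.exp (-(√t - K) ^ 2 / 4) * 3) ≤ ENNReal.ofReal 90 *
      ∫⁻ u in Set.Ioi 0, ENNReal.ofReal (Real.exp (-(u - K) ^ 2 / 8) * edgeBump u t) := by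
    intro t
    rw [show 3 * Real.exp (-(√t - K) ^ 2 / 4) * 3 = 9 * Real.exp (-(√t - K) ^ 2 / 4) by ring,
      ENNReal.ofReal_mul (by norm_num), show (90 : ℝ) = 9 * 10 by norm_num,
      ENNReal.ofReal_mul (by norm_num), mul_assoc]
    exact mul_le_mul_right (exp_neg_sq_le_lintegral t K) _
  calc _ ≤ ∫⁻ t, ENNReal.ofReal 90 * (∫⁻ u in Set.Ioi 0,
          ENNReal.ofReal (Real.exp (-(u - K) ^ 2 / 8) * edgeBump u t)) ∂ν' := lintegral_mono h2
    _ = ENNReal.ofReal 90 * ∫⁻ t, (∫⁻ u in Set.Ioi 0,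
          ENNReal.ofReal (Real.exp (-(u - K) ^ 2 / 8) * edgeBump u t)) ∂ν' :=
        lintegral_const_mul _ hm2.lintegral_prod_right'
    _ = ENNReal.ofReal 90 * ∫⁻ u in Set.Ioi 0, ∫⁻ t,
          ENNReal.ofReal (Real.exp (-(u - K) ^ 2 / 8) * edgeBump u t) ∂ν' :=
        congrArg _ (lintegral_lintegral_swap hm2.aemeasurable)
    _ ≤ ENNReal.ofReal 90 * ENNReal.ofReal M :=
        mul_le_mul_right (((setLIntegral_mono' measurableSet_Ioi h1).trans
          (setLIntegral_le_lintegral _ _)).trans hM) _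
    _ = _ := (ENNReal.ofReal_mul (by norm_num)).symm

namespace EdgeLimit

variable {φ : ℝ → ℝ} {ν : Measure ℝ}

/-- Integrate the bump estimate over `0 < u ≤ K` and exchange the integrals. One order gives `K³/3 +
O(1 + K²)`; the other gives `π/2` times the mass of `[0, K²]`, with an error concentrated at `√t =
K` whose integral is `O(1 + K²)`. -/
lemma exists_abs_measure_sub_le [SigmaFinite ν] (h : EdgeLimit φ ν) {δ : ℝ} (hδ0 : 0 < δ) (hδ : δ < 1)
    (hφ : EdgeProfile δ φ) (hfin : ∀ t, ν (Set.Iic t) < ⊤) : ∃ C, 0 ≤ C ∧ ∀ K, 0 ≤ K →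
      |Real.pi / 2 * ν.real (Set.Icc 0 (K ^ 2)) - K ^ 3 / 3| ≤ C * (1 + K ^ 2) := by
  obtain ⟨D, hD, h1⟩ := h.exists_lintegral_edgeBump_le hδ0 hδ hφ
  obtain ⟨B, hB, h2⟩ := exists_lintegral_gaussian_weight_le (1 + 2 * D) (by positivity)
  refine ⟨90 * B + 2 * D, by positivity, fun K hK => ?_⟩
  set ν' := ν.restrict (Set.Ici 0) with hν'
  have hmeas : Measurable fun p : ℝ × ℝ => ENNReal.ofReal (edgeBump p.1 p.2) :=
    continuous_edgeBump.measurable.ennreal_ofReal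
  set E : ℝ → ℝ := fun t => 3 * Real.exp (-(√t - K) ^ 2 / 4) * 3 with hE
  have hEm : Measurable E := by fun_prop
  have hE0 : ∀ t, 0 ≤ E t := fun t => by positivity
  have hEi : ∫⁻ t, ENNReal.ofReal (E t) ∂ν' ≤ ENNReal.ofReal (90 * B * (1 + K ^ 2)) := by
    rw [mul_assoc]
    refine lintegral_gaussian_sqrt_le (fun u hu => (h1 u hu).1.trans (ENNReal.ofReal_le_ofReal ?_)) (h2 K)
    nlinarith [mul_nonneg hD (sq_nonneg (u - 1)), mul_nonneg hD (sq_nonneg u)]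
  set X := ∫⁻ u in Set.Ioc 0 K, ∫⁻ t, ENNReal.ofReal (edgeBump u t) ∂ν' with hX
  have hpoly : ∀ {p : ℝ → ℝ} (_ : Continuous p) (_ : ∀ u, 0 ≤ u → 0 ≤ p u),
      ∫⁻ u in Set.Ioc 0 K, ENNReal.ofReal (p u) = ENNReal.ofReal (∫ u in (0 : ℝ)..K, p u) := by
    intro p hp hp0
    rw [intervalIntegral.integral_of_le hK, ofReal_integral_eq_lintegral_ofReal]
    · exact hp.integrableOn_Ioc
    · exact (ae_restrict_iff' measurableSet_Ioc).2 (Eventually.of_forall fun u hu => hp0 u hu.1.le)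
  have hX1 : X ≤ ENNReal.ofReal (K ^ 3 / 3 + D * (K + K ^ 2 / 2)) := by
    calc X ≤ ∫⁻ u in Set.Ioc 0 K, ENNReal.ofReal (u ^ 2 + D * (1 + u)) :=
          setLIntegral_mono' measurableSet_Ioc fun u hu => (h1 u hu.1.le).1
      _ = ENNReal.ofReal (∫ u in (0 : ℝ)..K, (u ^ 2 + D * (1 + u))) :=
          hpoly (by fun_prop) fun u hu => by positivity
      _ = _ := by
          congr 1
          rw [intervalIntegral.integral_add (by apply Continuous.intervalIntegrable; fun_prop)
            (by apply Continuous.intervalIntegrable; fun_prop), intervalIntegral.integral_const_mul,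
            intervalIntegral.integral_add (by apply Continuous.intervalIntegrable; fun_prop)
            (by apply Continuous.intervalIntegrable; fun_prop), integral_pow, integral_id]
          simp
          ring
  have hX2 : ENNReal.ofReal (K ^ 3 / 3) ≤ X + ENNReal.ofReal (D * (K + K ^ 2 / 2)) := by
    calc ENNReal.ofReal (K ^ 3 / 3) = ENNReal.ofReal (∫ u in (0 : ℝ)..K, u ^ 2) := by
          rw [integral_pow]; norm_num
      _ = ∫⁻ u in Set.Ioc 0 K, ENNReal.ofReal (u ^ 2) :=
          (hpoly (by fun_prop) fun u hu => by positivity).symm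
      _ ≤ ∫⁻ u in Set.Ioc 0 K, ((∫⁻ t, ENNReal.ofReal (edgeBump u t) ∂ν') +
            ENNReal.ofReal (D * (1 + u))) :=
          setLIntegral_mono' measurableSet_Ioc fun u hu => (h1 u hu.1.le).2
      _ = X + ∫⁻ u in Set.Ioc 0 K, ENNReal.ofReal (D * (1 + u)) :=
          lintegral_add_right _ (by fun_prop)
      _ = X + ENNReal.ofReal (∫ u in (0 : ℝ)..K, D * (1 + u)) := by
          rw [hpoly (by fun_prop) fun u hu => by positivity]
      _ = _ := by
          congr 2
          rw [intervalIntegral.integral_const_mul,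
            intervalIntegral.integral_add (by apply Continuous.intervalIntegrable; fun_prop)
            (by apply Continuous.intervalIntegrable; fun_prop), integral_id]
          simp
  have hXt : X = ∫⁻ t, ENNReal.ofReal (∫ u in Set.Ioc 0 K, edgeBump u t) ∂ν' := by
    rw [hX, lintegral_lintegral_swap hmeas.aemeasurable]
    refine lintegral_congr fun t => ?_
    rw [ofReal_integral_eq_lintegral_ofReal]
    · exact (continuous_edgeBump.comp (continuous_id.prodMk continuous_const)).integrableOn_Ioc
    · exact Eventually.of_forall fun u => edgeBump_nonneg u t
  set P : ℝ → ℝ := (Set.Iic (K ^ 2)).indicator fun _ => Real.pi / 2 with hP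
  have hPm : Measurable P := measurable_const.indicator measurableSet_Iic
  have hP0 : ∀ t, 0 ≤ P t := fun t => Set.indicator_nonneg (fun _ _ => by positivity) t
  have hAfin : ν (Set.Icc 0 (K ^ 2)) < ⊤ :=
    (measure_mono Set.Icc_subset_Iic_self).trans_lt (hfin _)
  have hPi : ∫⁻ t, ENNReal.ofReal (P t) ∂ν' =
      ENNReal.ofReal (Real.pi / 2 * ν.real (Set.Icc 0 (K ^ 2))) := by
    have e : ∀ t, ENNReal.ofReal (P t) =
        (Set.Iic (K ^ 2)).indicator (fun _ => ENNReal.ofReal (Real.pi / 2)) t := by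
      intro t
      by_cases q : t ∈ Set.Iic (K ^ 2)
      · rw [hP, Set.indicator_of_mem q, Set.indicator_of_mem q]
      · rw [hP, Set.indicator_of_notMem q, Set.indicator_of_notMem q, ENNReal.ofReal_zero]
    simp only [e]
    rw [lintegral_indicator measurableSet_Iic, setLIntegral_const, hν',
      Measure.restrict_apply measurableSet_Iic, ENNReal.ofReal_mul (by positivity),
      ofReal_measureReal hAfin.ne, Set.inter_comm, Set.Ici_inter_Iic]
  have r1 : X ≤ ENNReal.ofReal (Real.pi / 2 * ν.real (Set.Icc 0 (K ^ 2))) +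
      ENNReal.ofReal (90 * B * (1 + K ^ 2)) := by
    rw [← hPi]
    refine le_trans ?_ (add_le_add_right hEi _)
    rw [← lintegral_add_left hPm.ennreal_ofReal, hXt]
    refine lintegral_mono fun t => ?_
    rw [← ENNReal.ofReal_add (hP0 t) (hE0 t)]
    exact ENNReal.ofReal_le_ofReal (integral_edgeBump_bounds hK t).1
  have r2 : ENNReal.ofReal (Real.pi / 2 * ν.real (Set.Icc 0 (K ^ 2))) ≤ X +
      ENNReal.ofReal (90 * B * (1 + K ^ 2)) := by
    rw [← hPi]
    refine le_trans ?_ (add_le_add_right hEi _)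
    rw [hXt, ← lintegral_add_right _ hEm.ennreal_ofReal]
    refine lintegral_mono fun t => ?_
    rw [← ENNReal.ofReal_add (integral_nonneg fun u => edgeBump_nonneg u t) (hE0 t)]
    exact ENNReal.ofReal_le_ofReal (integral_edgeBump_bounds hK t).2
  have n1 : 0 ≤ Real.pi / 2 * ν.real (Set.Icc 0 (K ^ 2)) := by positivity
  have s1 := hX2.trans (add_le_add_left r1 _)
  have s2 := r2.trans (add_le_add_left hX1 _)
  rw [← ENNReal.ofReal_add (by positivity) (by positivity),
    ← ENNReal.ofReal_add (by positivity) (by positivity),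
    ENNReal.ofReal_le_ofReal_iff (by positivity)] at s1
  rw [← ENNReal.ofReal_add (by positivity) (by positivity),
    ENNReal.ofReal_le_ofReal_iff (by positivity)] at s2
  have s3 : D * (K + K ^ 2 / 2) ≤ 2 * D * (1 + K ^ 2) := by
    nlinarith [mul_nonneg hD (sq_nonneg (K - 1)), mul_nonneg hD (sq_nonneg K)]
  rw [abs_le]
  constructor <;> linarith

lemma isBigO_sub [SigmaFinite ν] (h : EdgeLimit φ ν) {δ : ℝ} (hδ0 : 0 < δ) (hδ : δ < 1)
    (hφ : EdgeProfile δ φ) (hfin : ∀ t, ν (Set.Iic t) < ⊤) :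
    (fun t : ℝ => ν.real (Set.Iic t) - 2 / (3 * Real.pi) * t ^ (3 / 2 : ℝ)) =O[atTop]
      (fun t : ℝ => t) := by
  obtain ⟨C, hC, h1⟩ := h.exists_abs_measure_sub_le hδ0 hδ hφ hfin
  apply IsBigO.of_bound (ν.real (Set.Iio 0) + 2 * C)
  filter_upwards [eventually_ge_atTop 1] with t ht
  have ht0 : 0 ≤ t := by linarith
  have h2 := h1 (√t) (Real.sqrt_nonneg t)
  rw [Real.sq_sqrt ht0] at h2
  have e1 : √t ^ 3 = t ^ (3 / 2 : ℝ) := by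
    rw [Real.sqrt_eq_rpow, ← Real.rpow_natCast, ← Real.rpow_mul ht0]
    norm_num
  have e2 : ν.real (Set.Iic t) = ν.real (Set.Iio 0) + ν.real (Set.Icc 0 t) := by
    rw [← Set.Iio_union_Icc_eq_Iic ht0, measureReal_union
      (Set.disjoint_left.2 fun x (hx : x ∈ Set.Iio 0) hx' => absurd hx'.1 (not_le.2 hx)) measurableSet_Icc
      ((measure_mono Set.Iio_subset_Iic_self).trans_lt (hfin 0)).ne
      ((measure_mono Set.Icc_subset_Iic_self).trans_lt (hfin t)).ne]
  rw [Real.norm_eq_abs, Real.norm_of_nonneg ht0, e2]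
  rw [e1] at h2
  set m := ν.real (Set.Icc 0 t)
  set z := t ^ (3 / 2 : ℝ)
  have hm0 : 0 ≤ ν.real (Set.Iio 0) := measureReal_nonneg
  have e3 : m - 2 / (3 * Real.pi) * z = 2 / Real.pi * (Real.pi / 2 * m - z / 3) := by
    have := Real.pi_ne_zero
    field_simp
  have h3 : |m - 2 / (3 * Real.pi) * z| ≤ C * (1 + t) := by
    rw [e3, abs_mul, abs_of_pos (by positivity)]
    have : 2 / Real.pi ≤ 1 := by
      rw [div_le_one Real.pi_pos]; linarith [Real.pi_gt_three]
    calc _ ≤ 1 * (C * (1 + t)) := by gcongr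
      _ = _ := one_mul _
  calc |ν.real (Set.Iio 0) + m - 2 / (3 * Real.pi) * z|
      ≤ |ν.real (Set.Iio 0)| + |m - 2 / (3 * Real.pi) * z| := by
        rw [add_sub_assoc]; exact abs_add_le _ _
    _ ≤ ν.real (Set.Iio 0) + C * (1 + t) := by rw [abs_of_nonneg hm0]; gcongr
    _ ≤ _ := by nlinarith

end EdgeLimit

/-! ### Convergence of distribution functions -/

/-- Continuous ramp around `c`, of slope `-n`, from `1` down to `0`. -/
noncomputable def ramp (c n a x : ℝ) : ℝ := max 0 (min 1 (a - n * (x - c)))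

lemma continuous_ramp (c n a : ℝ) : Continuous (ramp c n a) := by
  unfold ramp; fun_prop

lemma ramp_nonneg (c n a x : ℝ) : 0 ≤ ramp c n a x := le_max_left _ _

lemma ramp_le_one (c n a x : ℝ) : ramp c n a x ≤ 1 := max_le zero_le_one (min_le_left _ _)

lemma ramp_eq_zero {c n a x : ℝ} (h : a ≤ n * (x - c)) : ramp c n a x = 0 := by
  rw [ramp, max_eq_left]
  exact (min_le_right _ _).trans (by linarith)

lemma ramp_eq_one {c n a x : ℝ} (h : 1 ≤ a - n * (x - c)) : ramp c n a x = 1 := by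
  rw [ramp, min_eq_left h, max_eq_right zero_le_one]

lemma ramp_le_div {c n a : ℝ} (hn : 1 ≤ n) (ha : a ≤ 1) {x : ℝ} (hx : 0 < x) :
    |ramp c n a x| ≤ (1 + (c + 1) ^ 2) / x ^ 2 := by
  rw [abs_of_nonneg (ramp_nonneg _ _ _ _), le_div_iff₀ (by positivity)]
  rcases le_or_gt (c + 1) x with h | h
  · rw [ramp_eq_zero (by nlinarith), zero_mul]; positivity
  · have := ramp_le_one c n a x
    nlinarith [ramp_nonneg c n a x, sq_nonneg x]

/-- For every `a` the ramps converge to the indicator off the point `c`, which is null. The values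
used are `a = 0`, below the indicator of `Iio c`, and `a = 1`, above that of `Iic c`. -/
lemma tendsto_integral_ramp {σ : Measure ℝ} (hfin : ∀ t, σ (Set.Iic t) < ⊤) {c : ℝ}
    (hc : σ {c} = 0) {a : ℝ} (ha : a ≤ 1) :
    Tendsto (fun n : ℕ => ∫ x, ramp c (n + 1) a x ∂σ) atTop (𝓝 (σ.real (Set.Iic c))) := by
  rw [← integral_indicator_one measurableSet_Iic]
  refine tendsto_integral_of_dominated_convergence ((Set.Iic (c + 1)).indicator 1)
    (fun n => (continuous_ramp _ _ _).aestronglyMeasurable)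
    ((integrable_indicator_iff measurableSet_Iic).2 (integrableOn_const (hfin _).ne))
    (fun n => Eventually.of_forall fun x => ?_) ?_
  · rw [Real.norm_of_nonneg (ramp_nonneg _ _ _ _)]
    by_cases hx : x ∈ Set.Iic (c + 1)
    · rw [Set.indicator_of_mem hx]; exact ramp_le_one _ _ _ _
    · rw [Set.indicator_of_notMem hx, ramp_eq_zero]
      rw [Set.mem_Iic, not_le] at hx
      have : (0 : ℝ) ≤ n := n.cast_nonneg
      nlinarith
  · have hae : ∀ᵐ x ∂σ, x ≠ c := by
      rw [ae_iff]; simpa using hc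
    filter_upwards [hae] with x hx
    apply tendsto_const_nhds.congr'
    rcases lt_or_gt_of_ne hx with h | h
    · rw [Set.indicator_of_mem (show x ∈ Set.Iic c from h.le)]
      filter_upwards [tendsto_natCast_atTop_atTop.eventually_ge_atTop ((1 - a) / (c - x))] with n hn
      rw [div_le_iff₀ (by linarith)] at hn
      rw [ramp_eq_one, Pi.one_apply]
      nlinarith
    · rw [Set.indicator_of_notMem (show x ∉ Set.Iic c by simpa using h)]
      filter_upwards [tendsto_natCast_atTop_atTop.eventually_ge_atTop (a / (x - c))] with n hn
      rw [div_le_iff₀ (by linarith)] at hn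
      rw [ramp_eq_zero]
      nlinarith

open Classical in
/-- The limiting edge measure attached to a profile on `(0, ∞)`. -/
noncomputable def edgeSolution (ψ : Set.Ioi (0 : ℝ) → ℝ) : Measure ℝ :=
  if h : ∃ σ, IsEdgeSolution (fun x => if hx : 0 < x then ψ ⟨x, hx⟩ else 0) σ then h.choose else 0

/-- The defining identity sees only values on `(0, ∞)`, so extension by zero is harmless, and
uniqueness identifies the chosen solution. -/
lemma IsEdgeSolution.eq_edgeSolution {φ : ℝ → ℝ} {ν : Measure ℝ} (h : IsEdgeSolution φ ν) :
    ν = edgeSolution ((Set.Ioi 0).domRestrict φ) := by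
  have h' : IsEdgeSolution
      (fun x => if hx : 0 < x then (Set.Ioi 0).domRestrict φ ⟨x, hx⟩ else 0) ν := by
    intro b hb
    refine ⟨(h b hb).1, (h b hb).2.trans ?_⟩
    congr 1
    refine setIntegral_congr_fun measurableSet_Ioi fun x hx => ?_
    have hx' : 0 < x := hx
    simp [hx']
  have hex : ∃ σ, IsEdgeSolution
      (fun x => if hx : 0 < x then (Set.Ioi 0).domRestrict φ ⟨x, hx⟩ else 0) σ := ⟨ν, h'⟩
  rw [edgeSolution, dif_pos hex]
  exact h'.unique hex.choose_spec

namespace EdgeAsymptotics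

variable {μ : ℕ → Measure ℝ} {s : ℕ → ℝ} {φR φL : ℝ → ℝ} {ε : ℕ → ℕ → ℝ}
  {𝒰 : Ultrafilter ℕ} {ν : Measure ℝ}

lemma edgeLimit (h : EdgeAsymptotics μ s φR φL ε) {δ : ℝ} (hδ0 : 0 < δ) (hδ : δ < 1)
    (hR : EdgeProfile δ φR) (hL : EdgeProfile δ φL) (hU : (𝒰 : Filter ℕ) ≤ atTop) [ν.Regular]
    (hν : VagueTendsto (fun N => edgeMeasure (μ N) (s N)) 𝒰 ν) : EdgeLimit φR ν where
  decay := by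
    have hpos : ∀ t : ℝ, 0 < 1 + max t 0 := fun t => by
      have := le_max_right t 0; linarith
    refine (h.tendsto_integral_of_decay hδ hR hL hU hν (C := 1) ?_ (fun t => ?_) fun t ht => ?_).1
    · exact Continuous.div continuous_const (by fun_prop) fun t => (pow_pos (hpos t) 2).ne'
    · rw [abs_of_nonneg (by positivity), div_le_one (by have := hpos t; positivity)]
      have := le_max_right t 0
      nlinarith
    · rw [abs_of_nonneg (by positivity), max_eq_left ht.le]
      gcongr
      linarith
  exp := h.limit_integrableOn_exp hδ0 hδ hR hL hU hν
  test _ _ ha hi := h.integral_edgeTransform hδ hR hL hU hν ha hi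

/-- Along every ultrafilter the rescaled measures converge to the same measure. -/
lemma vagueTendsto_edgeSolution (h : EdgeAsymptotics μ s φR φL ε) {δ : ℝ} (hδ0 : 0 < δ) (hδ : δ < 1)
    (hR : EdgeProfile δ φR) (hL : EdgeProfile δ φL) (hU : (𝒰 : Filter ℕ) ≤ atTop) :
    (edgeSolution ((Set.Ioi 0).domRestrict φR)).Regular ∧
      VagueTendsto (fun N => edgeMeasure (μ N) (s N)) 𝒰
        (edgeSolution ((Set.Ioi 0).domRestrict φR)) := by
  have := h.prob
  obtain ⟨ν, hν, hv⟩ := exists_vagueTendsto 𝒰 (fun N => edgeMeasure (μ N) (s N)) fun T => by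
    obtain ⟨C, hC⟩ := h.exists_mass_le hδ hR hL T
    exact ⟨C, hC.filter_mono hU⟩
  rw [← ((h.edgeLimit hδ0 hδ hR hL hU hv).isEdgeSolution hδ0 hδ hR).eq_edgeSolution]
  exact ⟨hν, hv⟩

lemma edgeSolution_Iic_lt_top (h : EdgeAsymptotics μ s φR φL ε) {δ : ℝ} (hδ0 : 0 < δ) (hδ : δ < 1)
    (hR : EdgeProfile δ φR) (hL : EdgeProfile δ φL) (t : ℝ) :
    edgeSolution ((Set.Ioi 0).domRestrict φR) (Set.Iic t) < ⊤ := by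
  obtain ⟨h1, h2⟩ := h.vagueTendsto_edgeSolution hδ0 hδ hR hL (Ultrafilter.of_le atTop)
  exact (h.limit_left_tail hδ0 hδ hR hL (Ultrafilter.of_le atTop) h2).1 t

lemma edgeTails (h : EdgeAsymptotics μ s φR φL ε) {δ : ℝ} (hδ0 : 0 < δ) (hδ : δ < 1)
    (hR : EdgeProfile δ φR) (hL : EdgeProfile δ φL) :
    EdgeTails δ (edgeSolution ((Set.Ioi 0).domRestrict φR)) := by
  obtain ⟨h1, h2⟩ := h.vagueTendsto_edgeSolution hδ0 hδ hR hL (Ultrafilter.of_le atTop)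
  have := isLocallyFiniteMeasure_of_isFiniteMeasureOnCompacts
    (μ := edgeSolution ((Set.Ioi 0).domRestrict φR))
  exact ⟨(h.edgeLimit hδ0 hδ hR hL (Ultrafilter.of_le atTop) h2).isBigO_sub hδ0 hδ hR
    (h.edgeSolution_Iic_lt_top hδ0 hδ hR hL),
    (h.limit_left_tail hδ0 hδ hR hL (Ultrafilter.of_le atTop) h2).2⟩

/-- Ramps are not compactly supported, but they are bounded and vanish on the right, so tightness at
`-∞` makes their integrals converge. Steep ramps then squeeze `F`. -/
lemma tendsto_of_ramp_le (h : EdgeAsymptotics μ s φR φL ε) {δ : ℝ} (hδ0 : 0 < δ) (hδ : δ < 1)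
    (hR : EdgeProfile δ φR) (hL : EdgeProfile δ φL) {F : ℕ → ℝ} {t : ℝ}
    (ht : edgeSolution ((Set.Ioi 0).domRestrict φR) {t} = 0)
    (h1 : ∀ N, (edgeMeasure (μ N) (s N)).real (Set.Iio t) ≤ F N)
    (h2 : ∀ N, F N ≤ (edgeMeasure (μ N) (s N)).real (Set.Iic t)) :
    Tendsto F atTop (𝓝 ((edgeSolution ((Set.Ioi 0).domRestrict φR)).real (Set.Iic t))) := by
  have := h.prob
  have hfin := h.edgeSolution_Iic_lt_top hδ0 hδ hR hL
  -- The limit measure is the same along every ultrafilter, which is what convergence of the whole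
  -- sequence requires.
  rw [tendsto_iff_ultrafilter]
  intro 𝒰 hU
  obtain ⟨hreg, hv⟩ := h.vagueTendsto_edgeSolution hδ0 hδ hR hL hU
  set σ := edgeSolution ((Set.Ioi 0).domRestrict φR)
  have hint : ∀ n a N, Integrable (ramp t n a) (edgeMeasure (μ N) (s N)) := fun n a N =>
    Integrable.of_bound (continuous_ramp t n a).aestronglyMeasurable 1
      (Eventually.of_forall fun x => by
        rw [Real.norm_of_nonneg (ramp_nonneg _ _ _ _)]; exact ramp_le_one _ _ _ _)
  have hlow : ∀ (n : ℕ) N, ∫ x, ramp t (n + 1) 0 x ∂(edgeMeasure (μ N) (s N)) ≤ F N := by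
    intro n N
    refine le_trans ?_ (h1 N)
    rw [← integral_indicator_one measurableSet_Iio]
    refine integral_mono (hint _ _ _) ((integrable_const _).indicator measurableSet_Iio) fun x => ?_
    by_cases hx : x ∈ Set.Iio t
    · rw [Set.indicator_of_mem hx]; exact ramp_le_one _ _ _ _
    · rw [Set.indicator_of_notMem hx, ramp_eq_zero]
      rw [Set.mem_Iio, not_lt] at hx
      exact mul_nonneg (by positivity) (by linarith)
  have hup : ∀ (n : ℕ) N, F N ≤ ∫ x, ramp t (n + 1) 1 x ∂(edgeMeasure (μ N) (s N)) := by
    intro n N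
    refine (h2 N).trans ?_
    rw [← integral_indicator_one measurableSet_Iic]
    refine integral_mono ((integrable_const _).indicator measurableSet_Iic) (hint _ _ _) fun x => ?_
    by_cases hx : x ∈ Set.Iic t
    · rw [Set.indicator_of_mem hx, ramp_eq_one, Pi.one_apply]
      have : 0 ≤ ((n : ℝ) + 1) * (t - x) := mul_nonneg (by positivity) (by linarith [Set.mem_Iic.1 hx])
      linarith
    · rw [Set.indicator_of_notMem hx]; exact ramp_nonneg _ _ _ _
  have hconv : ∀ (n : ℕ) a, a ≤ 1 →
      Tendsto (fun N => ∫ x, ramp t (n + 1) a x ∂(edgeMeasure (μ N) (s N))) 𝒰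
        (𝓝 (∫ x, ramp t (n + 1) a x ∂σ)) := fun n a ha =>
    (h.tendsto_integral_of_decay hδ hR hL hU hv (continuous_ramp t _ a)
      (C := 1 + (t + 1) ^ 2) (fun x => by
        rw [abs_of_nonneg (ramp_nonneg _ _ _ _)]
        have := ramp_le_one t (n + 1) a x
        nlinarith [sq_nonneg (t + 1)])
      fun x hx => ramp_le_div (by linarith [n.cast_nonneg (α := ℝ)]) ha hx).2
  refine tendsto_order.2 ⟨fun y hy => ?_, fun y hy => ?_⟩
  · obtain ⟨n, hn⟩ := ((tendsto_integral_ramp hfin ht zero_le_one).eventually_const_lt hy).exists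
    exact ((hconv n 0 zero_le_one).eventually_const_lt hn).mono fun N hN => hN.trans_le (hlow n N)
  · obtain ⟨n, hn⟩ := ((tendsto_integral_ramp hfin ht le_rfl).eventually_lt_const hy).exists
    exact ((hconv n 1 le_rfl).eventually_lt_const hn).mono fun N hN => (hup n N).trans_lt hN

end EdgeAsymptotics

theorem proposition6 :
    -- `S φ` is the limiting measure, determined by the restriction of `φ` to `(0,∞)` alone
    ∃ S : (Set.Ioi (0 : ℝ) → ℝ) → Measure ℝ,
      ∀ (μ : ℕ → Measure ℝ) (s : ℕ → ℝ) (φR φL : ℝ → ℝ) (ε : ℕ → ℕ → ℝ) (δ : ℝ),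
        0 < δ → δ < 1 → EdgeProfile δ φR → EdgeProfile δ φL → EdgeAsymptotics μ s φR φL ε →
          EdgeTendsto (fun N => edgeRight (μ N) (s N)) (S ((Set.Ioi 0).domRestrict φR)) ∧
          EdgeTendsto (fun N => edgeLeft (μ N) (s N)) (S ((Set.Ioi 0).domRestrict φL)) ∧
          EdgeTails δ (S ((Set.Ioi 0).domRestrict φR)) ∧
          EdgeTails δ (S ((Set.Ioi 0).domRestrict φL)) := by
  refine ⟨edgeSolution, fun μ s φR φL ε δ hδ0 hδ hR hL h => ?_⟩
  -- The left edge is the right edge of the reflected measures, with the profiles exchanged; the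
  -- same map `edgeSolution` therefore serves both.
  have h' := h.reflect
  have := h.prob
  have := h'.prob
  refine ⟨⟨h.edgeSolution_Iic_lt_top hδ0 hδ hR hL, fun t ht => ?_⟩,
    ⟨h'.edgeSolution_Iic_lt_top hδ0 hδ hL hR, fun t ht => ?_⟩,
    h.edgeTails hδ0 hδ hR hL, h'.edgeTails hδ0 hδ hL hR⟩
  · refine h.tendsto_of_ramp_le hδ0 hδ hR hL ht (fun N => ?_) fun N => ?_
    · beta_reduce
      rw [edgeRight_eq (h.scale_pos N)]
    · beta_reduce
      rw [edgeRight_eq (h.scale_pos N)]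
      exact measureReal_mono Set.Iio_subset_Iic_self
  · refine h'.tendsto_of_ramp_le hδ0 hδ hL hR ht (fun N => ?_) fun N => ?_
    · beta_reduce
      rw [edgeLeft_eq (h.scale_pos N)]
      exact measureReal_mono Set.Iio_subset_Iic_self
    · beta_reduce
      rw [edgeLeft_eq (h.scale_pos N)]
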